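/- **Setting.** Let $\mathbb T^2=\mathbb R^2/\mathbb Z^2$ with the Euclidean toroidal distance $d_{\mathbb T^2}$, and let $C^1$ stand for Lipschitz functions. For even $\alpha\in\mathbb N$ put $$T_{V}(x,y)=\begin{cases}(x,\,y+\alpha x)& x\in[\tfrac12,1)\\(x,\,y-\alpha x)&x\in[0,\tfrac12)\end{cases},\qquad T_{H}(x,y)=\begin{cases}(x+\alpha y,\,y)& y\in[\tfrac12,1)\\(x-\alpha y,\,y)&y\in[0,\tfrac12)\end{cases}\pmod 1,$$ $T_\alpha=T_H\circ T_V$, and $\mathcal L_\alpha h=\alpha^{-2}(DT_\alpha h)\circ T_\alpha^{-1}$ for $h:\mathbb T^2\to\mathbb C^2$. Here $DT_\alpha=\begin{pmatrix}1+ss'\alpha^2&s'\alpha\\ s\alpha&1\end{pmatrix}$ at $(x,y)$, where $s=1$ if $x\ge\frac12$ and $s=-1$ otherwise, and $s'=1$ if the second coordinate of $T_V(x,y)$ is $\ge\frac12$ and $s'=-1$ otherwise. Admissible leaves are the segments $W=\{\mathbf x+t\mathbf v:0\le t\le S\}\subset\mathbb T^2$ with $\mathbf x\in\mathbb T^2$,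 $|\mathbf v|=1$, $v_2>0$, $|v_1|\le 2\alpha^{-1}|v_2|$ and $0<S\le1$; if $\mathbf v=(0,1)$ and $S=1$ the base point $\mathbf x$ is taken with $x_2=0$. Write $|W|=S$, $\gamma_W(t)=\mathbf x+t\mathbf v$, and $d_\Sigma(W_1,W_2)=d_{\mathbb T^2}(\mathbf x_1,\mathbf x_2)+|\mathbf v_1-\mathbf v_2|+|S_1-S_2|$. For $0<r\le1$ let $\|\varphi\|_{C^r(W)}=\|\varphi\circ\gamma_W\|_{C^r([0,S])}$ (supremum plus $r$-Hölder seminorm), and let $C^r(W)$ be the closure of the Lipschitz functions on $\mathbb T^2$ in this norm. Put $d_q(\varphi_1,\varphi_2)=\|\varphi_1\circ\gamma_{W_1}-\varphi_2\circ\gamma_{W_2}\|_{C^q([0,S_1\wedge S_2])}$. Fix $\sigma,\beta,q\in(0,1)$ with $\beta<\sigma$ and $\beta<1-q$, and define, with arc-length integrals, $$|f|_w=\sup_W\ \sup_{\varphi\in C^1(W),\,\|\varphi\|_{C^1(W)}\le1}\Big|\int_Wf\varphi\Big|,\qquad \|f\|_s=\sup_W\ \sup_{\varphi\in C^q(W),\,\|\varphi\|_{C^q(W)}|W|^\sigma\le1}\Big|\int_Wf\varphi\Big|,$$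 $$\|f\|_u=\sup_{0<\delta\le2/\alpha}\ \sup_{d_\Sigma(W_1,W_2)<\delta}\ \sup_{\substack{\varphi_i\in C^1(W_i),\ \|\varphi_i\|_{C^1(W_i)}\le1\\ d_q(\varphi_1,\varphi_2)<\delta}}\delta^{-\beta}\Big|\int_{W_1}f\varphi_1-\int_{W_2}f\varphi_2\Big|,\qquad\|f\|=\|f\|_s+\|f\|_u .$$ Let $X$ (depending on $\alpha$) be the completion of the Lipschitz functions $\mathbb T^2\to\mathbb C^2$ in $\|\cdot\|$; the norms $|\cdot|_w,\|\cdot\|_s,\|\cdot\|_u$ extend to $X$ by continuity. An element of $X$ is identified with a piecewise Lipschitz function $u$ if some Lipschitz functions converge to it in $X$ and to $u$ in the norm $\|\cdot\|$ (given by the same formulas). **Proposition.** (1) There are $C,\alpha_0>0$ such that for every even $\alpha\ge\alpha_0$ the operator $\mathcal L_\alpha$, defined on Lipschitz functions, extends to a bounded linear operator $X\to X$, and for all $h\in X$ $$|\mathcal L_\alpha h|_w\le C|h|_w,\qquad \|\mathcal L_\alpha h\|_s\le C(\alpha^{-2q}+\alpha^{2\sigma-2})\|h\|_s+C|h|_w,$$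 $$\|\mathcal L_\alpha h\|_u\le C\big[(\alpha^{-2+\sigma+\beta}+\alpha^{-1+\beta}+\alpha^{-2q+\beta-\sigma})\|h\|_s+\alpha^{-2\beta}\|h\|_u+\alpha^{\beta-\sigma}|h|_w\big].$$ (2) There is $\eta>0$ such that for every Lipschitz $g:\mathbb T^2\to\mathbb R$ there are $C,\alpha_0>0$ such that for every even $\alpha\ge\alpha_0$ the operator $e^{2\pi ig}\mathcal L_\alpha$ extends likewise to a bounded operator on $X$, and for all $h\in X$ $$\|e^{2\pi ig}\mathcal L_\alpha h\|\le C\alpha^{-\eta}\|h\|+C|h|_w,\qquad |e^{2\pi ig}\mathcal L_\alpha h|_w\le C|h|_w .$$ Moreover, with the same $C$ and $\eta$, every point of the spectrum of $e^{2\pi ig}\mathcal L_\alpha$ on $X$ of modulus strictly greater than $C\alpha^{-\eta}$ is an eigenvalue, is isolated in the spectrum, and has finite algebraic multiplicity. The constants may depend on $\sigma,\beta,q$ (and, in (2), $C$ and $\alpha_0$ on $g$), but not on $\alpha$ or $h$. -/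

import Mathlib

open Set Filter Topology MeasureTheory
open scoped NNReal ENNReal

namespace StretchFold

/-! ### The torus and the hyperbolic map -/

/-- The flat two-dimensional torus `ℝ²/ℤ²`. -/
abbrev Torus : Type := UnitAddCircle × UnitAddCircle

/-- `ℂ²` with its Euclidean norm. -/
abbrev C2 : Type := EuclideanSpace ℂ (Fin 2)

/-- The standard (Euclidean) toroidal distance. -/
noncomputable def torusDist (p q : Torus) : ℝ :=
  Real.sqrt (‖p.1 - q.1‖ ^ 2 + ‖p.2 - q.2‖ ^ 2)

/-- `+1` if the representative of `x` in `[0,1)` is at least `1/2`, and `-1` otherwise. -/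
noncomputable def halfSign (x : UnitAddCircle) : ℤ :=
  if (1 / 2 : ℝ) ≤ (AddCircle.equivIco (1 : ℝ) 0 x : ℝ) then 1 else -1

/-- The vertical shear `(x,y) ↦ (x, y + αx)` for `x ≥ 1/2`, `(x, y - αx)` for `x < 1/2`. -/
noncomputable def shearV (α : ℕ) : Torus ≃ Torus where
  toFun p := (p.1, p.2 + (halfSign p.1 * (α : ℤ)) • p.1)
  invFun p := (p.1, p.2 - (halfSign p.1 * (α : ℤ)) • p.1)
  left_inv p := by simp
  right_inv p := by simp

/-- The horizontal shear `(x,y) ↦ (x + αy, y)` for `y ≥ 1/2`, `(x - αy, y)` for `y < 1/2`. -/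
noncomputable def shearH (α : ℕ) : Torus ≃ Torus where
  toFun p := (p.1 + (halfSign p.2 * (α : ℤ)) • p.2, p.2)
  invFun p := (p.1 - (halfSign p.2 * (α : ℤ)) • p.2, p.2)
  left_inv p := by simp
  right_inv p := by simp

/-- The map `T_α`: first the vertical shear, then the horizontal one. -/
noncomputable def torusMap (α : ℕ) : Torus ≃ Torus := (shearV α).trans (shearH α)

/-- The derivative `DT_α`, an integer matrix that is constant on each of the four regions determined
by the sign of `x - 1/2` and by the sign of `y' - 1/2`, where `(x, y')` is the image of `(x, y)`
under the vertical shear. -/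
noncomputable def derivMatrix (α : ℕ) (p : Torus) : Matrix (Fin 2) (Fin 2) ℤ :=
  let s := halfSign p.1
  let s' := halfSign (shearV α p).2
  !![1 + s' * s * (α : ℤ) ^ 2, s' * (α : ℤ); s * (α : ℤ), 1]

/-- On each region the map is the linear map given by its derivative, modulo `ℤ²`. -/
theorem torusMap_eq (α : ℕ) (p : Torus) :
    torusMap α p = (derivMatrix α p 0 0 • p.1 + derivMatrix α p 0 1 • p.2,
      derivMatrix α p 1 0 • p.1 + derivMatrix α p 1 1 • p.2) := by
  ext <;> simp [torusMap, shearV, shearH, derivMatrix] <;> module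

/-- The normalized vector-valued transfer operator `α⁻² (DT_α h) ∘ T_α⁻¹`, on functions. -/
noncomputable def transfer (α : ℕ) (h : Torus → C2) (p : Torus) : C2 :=
  ((α : ℂ) ^ 2)⁻¹ • WithLp.toLp 2
    (((derivMatrix α ((torusMap α).symm p)).map (Int.cast : ℤ → ℂ)).mulVec
      (h ((torusMap α).symm p)).ofLp)

/-- Multiplication by the phase `e^{2πig}` after the transfer operator. -/
noncomputable def phaseTransfer (g : Torus → ℝ) (α : ℕ) (h : Torus → C2) (p : Torus) : C2 :=
  Complex.exp (2 * Real.pi * Complex.I * (g p : ℂ)) • transfer α h p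

/-! ### Admissible leaves -/

/-- An admissible stable leaf: a segment of length in `(0,1]` with unit direction in the stable cone
`|v₁| ≤ 2 α⁻¹ |v₂|`, `v₂ > 0`, in its unique parametrization; a closed vertical circle is based at
height `0`. -/
structure Leaf (α : ℕ) where
  base : Torus
  dir : EuclideanSpace ℝ (Fin 2)
  len : ℝ
  norm_dir : ‖dir‖ = 1
  cone : |dir 0| ≤ 2 * (α : ℝ)⁻¹ * |dir 1|
  dir_pos : 0 < dir 1
  len_pos : 0 < len
  len_le : len ≤ 1
  base_eq : dir 0 = 0 → len = 1 → base.2 = 0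

/-- The arc-length parametrization of a leaf (used for `t ∈ [0, len]`). -/
noncomputable def Leaf.path {α : ℕ} (W : Leaf α) (t : ℝ) : Torus :=
  (W.base.1 + ((t * W.dir 0 : ℝ) : UnitAddCircle), W.base.2 + ((t * W.dir 1 : ℝ) : UnitAddCircle))

/-- The distance between two leaves. -/
noncomputable def leafDist {α : ℕ} (W₁ W₂ : Leaf α) : ℝ :=
  torusDist W₁.base W₂.base + ‖W₁.dir - W₂.dir‖ + |W₁.len - W₂.len|

/-- The integral `∫_W f φ` with respect to arc length. -/
noncomputable def leafIntegral {α : ℕ} (W : Leaf α) (f : Torus → C2) (φ : Torus → ℂ) : C2 :=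
  ∫ t in (0 : ℝ)..W.len, φ (W.path t) • f (W.path t)

/-- The norm of `C^r([0,S])`: supremum plus Hölder seminorm (Lipschitz seminorm for `r = 1`). -/
noncomputable def holderNorm (r S : ℝ) (u : ℝ → ℂ) : ℝ≥0∞ :=
  (⨆ t ∈ Icc (0 : ℝ) S, ‖u t‖ₑ) +
    ⨆ s ∈ Icc (0 : ℝ) S, ⨆ t ∈ Icc (0 : ℝ) S, ⨆ _ : s ≠ t,
      ‖u s - u t‖ₑ / ENNReal.ofReal (|s - t| ^ r)

/-- The norm of `C^r(W)`, distances being measured along the leaf. -/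
noncomputable def leafNorm {α : ℕ} (r : ℝ) (W : Leaf α) (φ : Torus → ℂ) : ℝ≥0∞ :=
  holderNorm r W.len fun t => φ (W.path t)

/-- `φ` belongs to `C^r(W)`, the closure of the Lipschitz functions on the torus in the norm of
`C^r(W)`. Only the values of `φ` on `W` matter. -/
def MemLeaf {α : ℕ} (r : ℝ) (W : Leaf α) (φ : Torus → ℂ) : Prop :=
  ∀ ε : ℝ≥0∞, 0 < ε → ∃ ψ : Torus → ℂ, (∃ K : ℝ≥0, LipschitzWith K ψ) ∧
    leafNorm r W (fun p => φ p - ψ p) ≤ ε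

/-- The pseudo-distance between a function on one leaf and a function on another. -/
noncomputable def testDist {α : ℕ} (q : ℝ) (W₁ W₂ : Leaf α) (φ₁ φ₂ : Torus → ℂ) : ℝ≥0∞ :=
  holderNorm q (min W₁.len W₂.len) fun t => φ₁ (W₁.path t) - φ₂ (W₂.path t)

/-! ### The norms -/

/-- The fixed parameters of the norms. -/
structure Params where
  σ : ℝ
  β : ℝ
  q : ℝ
  σ_pos : 0 < σ
  σ_lt : σ < 1
  β_pos : 0 < β
  β_lt : β < 1
  q_pos : 0 < q
  q_lt : q < 1
  β_lt_σ : β < σ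
  β_lt_q : β < 1 - q

/-- The weak norm. -/
noncomputable def weakENorm (α : ℕ) (f : Torus → C2) : ℝ≥0∞ :=
  ⨆ (W : Leaf α) (φ : Torus → ℂ) (_ : MemLeaf 1 W φ ∧ leafNorm 1 W φ ≤ 1),
    ‖leafIntegral W f φ‖ₑ

/-- The strong stable norm. -/
noncomputable def stableENorm (P : Params) (α : ℕ) (f : Torus → C2) : ℝ≥0∞ :=
  ⨆ (W : Leaf α) (φ : Torus → ℂ)
    (_ : MemLeaf P.q W φ ∧ leafNorm P.q W φ * ENNReal.ofReal (W.len ^ P.σ) ≤ 1),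
    ‖leafIntegral W f φ‖ₑ

/-- The pairs of test functions, on leaves at distance less than `δ`, of the strong unstable norm. -/
structure IsTestPair (P : Params) {α : ℕ} (δ : ℝ) (W₁ W₂ : Leaf α) (φ₁ φ₂ : Torus → ℂ) :
    Prop where
  pos : 0 < δ
  le : δ ≤ 2 / (α : ℝ)
  dist_lt : leafDist W₁ W₂ < δ
  mem₁ : MemLeaf 1 W₁ φ₁
  mem₂ : MemLeaf 1 W₂ φ₂
  norm₁ : leafNorm 1 W₁ φ₁ ≤ 1
  norm₂ : leafNorm 1 W₂ φ₂ ≤ 1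
  test_lt : testDist P.q W₁ W₂ φ₁ φ₂ < ENNReal.ofReal δ

/-- The strong unstable norm. -/
noncomputable def unstableENorm (P : Params) (α : ℕ) (f : Torus → C2) : ℝ≥0∞ :=
  ⨆ (δ : ℝ) (W₁ : Leaf α) (W₂ : Leaf α) (φ₁ : Torus → ℂ) (φ₂ : Torus → ℂ)
    (_ : IsTestPair P δ W₁ W₂ φ₁ φ₂),
    ‖leafIntegral W₁ f φ₁ - leafIntegral W₂ f φ₂‖ₑ / ENNReal.ofReal (δ ^ P.β)

/-- The strong norm. -/
noncomputable def strongENorm (P : Params) (α : ℕ) (f : Torus → C2) : ℝ≥0∞ :=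
  stableENorm P α f + unstableENorm P α f

/-! ### The norms are finite seminorms on Lipschitz functions -/

/-- The space of Lipschitz functions from the torus to `ℂ²`. -/
def lipFun : Submodule ℂ (Torus → C2) where
  carrier := {f | ∃ K : ℝ≥0, LipschitzWith K f}
  add_mem' := by
    rintro f g ⟨K, hK⟩ ⟨L, hL⟩
    exact ⟨K + L, hK.add hL⟩
  zero_mem' := ⟨0, LipschitzWith.const 0⟩
  smul_mem' := by
    rintro c f ⟨K, hK⟩
    refine ⟨‖c‖₊ * K, LipschitzWith.of_dist_le_mul fun x y => ?_⟩
    have := hK.dist_le_mul x y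
    simp only [Pi.smul_apply, dist_smul₀, NNReal.coe_mul, coe_nnnorm]
    calc ‖c‖ * dist (f x) (f y) ≤ ‖c‖ * (K * dist x y) := by gcongr
      _ = _ := by ring

theorem holder_sup_le {r S t : ℝ} {u : ℝ → ℂ} (ht : t ∈ Icc (0 : ℝ) S) :
    ‖u t‖ₑ ≤ holderNorm r S u :=
  le_trans (le_iSup₂ (f := fun t (_ : t ∈ Icc (0 : ℝ) S) => ‖u t‖ₑ) t ht) le_self_add

theorem holder_diff_le {r S s t : ℝ} {u : ℝ → ℂ} (hs : s ∈ Icc (0 : ℝ) S)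
    (ht : t ∈ Icc (0 : ℝ) S) :
    ‖u s - u t‖ₑ ≤ holderNorm r S u * ENNReal.ofReal (|s - t| ^ r) := by
  by_cases hst : s = t
  · subst hst; simp
  have h1 : 0 < |s - t| ^ r := Real.rpow_pos_of_pos (abs_pos.2 (sub_ne_zero.2 hst)) r
  have h2 : ‖u s - u t‖ₑ / ENNReal.ofReal (|s - t| ^ r) ≤ holderNorm r S u := by
    refine le_trans ?_ le_add_self
    refine le_trans ?_ (le_iSup₂ s hs)
    refine le_trans ?_ (le_iSup₂ t ht)
    exact le_iSup (fun _ : s ≠ t => ‖u s - u t‖ₑ / ENNReal.ofReal (|s - t| ^ r)) hst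
  rwa [ENNReal.div_le_iff (by simpa using h1) ENNReal.ofReal_ne_top] at h2

theorem holder_continuousOn {r S : ℝ} {u : ℝ → ℂ} (hr : 0 < r) (h : holderNorm r S u ≠ ⊤) :
    ContinuousOn u (Icc 0 S) := by
  intro t ht
  rw [ContinuousWithinAt, tendsto_iff_edist_tendsto_0]
  have h0 : Tendsto (fun s : ℝ => holderNorm r S u * ENNReal.ofReal (|s - t| ^ r))
      (𝓝[Icc 0 S] t) (𝓝 0) := by
    have h1 : Tendsto (fun s : ℝ => ENNReal.ofReal (|s - t| ^ r)) (𝓝[Icc 0 S] t) (𝓝 0) := by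
      have h2 : Continuous fun s : ℝ => ENNReal.ofReal (|s - t| ^ r) :=
        ENNReal.continuous_ofReal.comp
          ((continuous_id.sub continuous_const).abs.rpow_const fun _ => Or.inr hr.le)
      have h3 := h2.tendsto t
      simp only [sub_self, abs_zero, Real.zero_rpow hr.ne', ENNReal.ofReal_zero] at h3
      exact h3.mono_left nhdsWithin_le_nhds
    simpa using ENNReal.Tendsto.const_mul h1 (Or.inr h)
  refine tendsto_of_tendsto_of_tendsto_of_le_of_le' tendsto_const_nhds h0
    (Eventually.of_forall fun _ => zero_le) ?_
  filter_upwards [self_mem_nhdsWithin] with s hs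
  rw [edist_eq_enorm_sub]
  exact holder_diff_le hs ht

theorem holderNorm_mono_exp {q S : ℝ} {u : ℝ → ℂ} (hq : q < 1) (hS : S ≤ 1) :
    holderNorm q S u ≤ holderNorm 1 S u := by
  unfold holderNorm
  refine add_le_add le_rfl (iSup₂_mono fun s hs => iSup₂_mono fun t ht => iSup_mono fun hst => ?_)
  refine ENNReal.div_le_div_left (ENNReal.ofReal_le_ofReal ?_) _
  have h1 : |s - t| ≤ 1 := abs_le.2 ⟨by linarith [hs.1, ht.2], by linarith [hs.2, ht.1]⟩
  have h2 : 0 < |s - t| := abs_pos.2 (sub_ne_zero.2 hst)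
  exact Real.rpow_le_rpow_of_exponent_ge h2 h1 hq.le

theorem Leaf.continuous_path {α : ℕ} (W : Leaf α) : Continuous W.path := by
  unfold Leaf.path
  have h (c : ℝ) : Continuous fun t : ℝ => ((t * c : ℝ) : UnitAddCircle) :=
    (AddCircle.continuous_mk' (1 : ℝ)).comp (continuous_id.mul continuous_const)
  exact (continuous_const.add (h _)).prodMk (continuous_const.add (h _))

theorem leaf_intervalIntegrable {α : ℕ} {r : ℝ} (hr : 0 < r) {W : Leaf α} {φ : Torus → ℂ}
    (hφ : leafNorm r W φ ≠ ⊤) {f : Torus → C2} (hf : Continuous f) :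
    IntervalIntegrable (fun t => φ (W.path t) • f (W.path t)) volume 0 W.len := by
  apply ContinuousOn.intervalIntegrable
  rw [uIcc_of_le W.len_pos.le]
  exact (holder_continuousOn hr hφ).smul (hf.comp W.continuous_path).continuousOn

theorem lipFun_continuous {f : Torus → C2} (hf : f ∈ lipFun) : Continuous f := by
  obtain ⟨K, hK⟩ := hf
  exact hK.continuous

theorem lipFun_bound {f : Torus → C2} (hf : f ∈ lipFun) : ∃ B : ℝ, 0 ≤ B ∧ ∀ p, ‖f p‖ ≤ B := by
  obtain ⟨B, hB⟩ := isCompact_univ.exists_bound_of_continuousOn (lipFun_continuous hf).continuousOn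
  exact ⟨B, (norm_nonneg _).trans (hB 0 trivial), fun p => hB p trivial⟩

theorem leafIntegral_add {α : ℕ} {r : ℝ} (hr : 0 < r) {W : Leaf α} {φ : Torus → ℂ}
    (hφ : leafNorm r W φ ≠ ⊤) {f g : Torus → C2} (hf : f ∈ lipFun) (hg : g ∈ lipFun) :
    leafIntegral W (f + g) φ = leafIntegral W f φ + leafIntegral W g φ := by
  unfold leafIntegral
  rw [← intervalIntegral.integral_add (leaf_intervalIntegrable hr hφ (lipFun_continuous hf))
    (leaf_intervalIntegrable hr hφ (lipFun_continuous hg))]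
  simp only [Pi.add_apply, smul_add]

theorem leafIntegral_smul {α : ℕ} (W : Leaf α) (φ : Torus → ℂ) (c : ℂ) (f : Torus → C2) :
    leafIntegral W (c • f) φ = c • leafIntegral W f φ := by
  unfold leafIntegral
  rw [← intervalIntegral.integral_smul]
  simp only [Pi.smul_apply, smul_comm c]

theorem weakENorm_le_stableENorm (P : Params) (α : ℕ) (f : Torus → C2) :
    weakENorm α f ≤ stableENorm P α f := by
  refine iSup_le fun W => iSup_le fun φ => iSup_le fun h => ?_
  have hm (ψ : Torus → ℂ) : leafNorm P.q W ψ ≤ leafNorm 1 W ψ :=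
    holderNorm_mono_exp P.q_lt W.len_le
  refine le_trans ?_ (le_iSup₂ W φ)
  refine le_iSup_of_le ⟨fun ε hε => ?_, ?_⟩ le_rfl
  · obtain ⟨ψ, hψ, hψ'⟩ := h.1 ε hε
    exact ⟨ψ, hψ, (hm _).trans hψ'⟩
  · have h1 : ENNReal.ofReal (W.len ^ P.σ) ≤ 1 := by
      rw [ENNReal.ofReal_le_one]
      exact Real.rpow_le_one W.len_pos.le W.len_le P.σ_pos.le
    calc leafNorm P.q W φ * ENNReal.ofReal (W.len ^ P.σ) ≤ 1 * 1 := by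
          gcongr
          exact (hm φ).trans h.2
      _ = 1 := one_mul 1

theorem stable_test_ne_top (P : Params) {α : ℕ} {W : Leaf α} {φ : Torus → ℂ}
    (h : leafNorm P.q W φ * ENNReal.ofReal (W.len ^ P.σ) ≤ 1) : leafNorm P.q W φ ≠ ⊤ := by
  intro htop
  have h1 : 0 < W.len ^ P.σ := Real.rpow_pos_of_pos W.len_pos _
  rw [htop, ENNReal.top_mul (by simpa using h1)] at h
  simp at h

theorem stableENorm_lt_top (P : Params) (α : ℕ) {f : Torus → C2} (hf : f ∈ lipFun) :
    stableENorm P α f < ⊤ := by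
  obtain ⟨B, hB0, hB⟩ := lipFun_bound hf
  refine lt_of_le_of_lt (b := ENNReal.ofReal B) ?_ ENNReal.ofReal_lt_top
  refine iSup_le fun W => iSup_le fun φ => iSup_le fun h => ?_
  have hS := W.len_pos
  have hpos : 0 < W.len ^ P.σ := Real.rpow_pos_of_pos hS _
  have hφ : ∀ t ∈ Icc (0 : ℝ) W.len, ‖φ (W.path t)‖ ≤ (W.len ^ P.σ)⁻¹ := by
    intro t ht
    have h1 : ‖φ (W.path t)‖ₑ * ENNReal.ofReal (W.len ^ P.σ) ≤ 1 :=
      le_trans (by gcongr; exact holder_sup_le (u := fun t => φ (W.path t)) ht) h.2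
    rw [← ofReal_norm, ← ENNReal.ofReal_mul (norm_nonneg _), ENNReal.ofReal_le_one] at h1
    rwa [← one_div, le_div_iff₀ hpos]
  have key : ‖leafIntegral W f φ‖ ≤ (W.len ^ P.σ)⁻¹ * B * |W.len - 0| := by
    refine intervalIntegral.norm_integral_le_of_norm_le_const fun t ht => ?_
    rw [uIoc_of_le hS.le] at ht
    rw [norm_smul]
    exact mul_le_mul (hφ t ⟨ht.1.le, ht.2⟩) (hB _) (norm_nonneg _) (inv_nonneg.2 hpos.le)
  rw [← ofReal_norm]
  refine ENNReal.ofReal_le_ofReal (key.trans ?_)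
  rw [sub_zero, abs_of_pos hS]
  have h1 : W.len ≤ W.len ^ P.σ := by
    conv_lhs => rw [← Real.rpow_one W.len]
    exact Real.rpow_le_rpow_of_exponent_ge hS W.len_le P.σ_lt.le
  have h2 : (W.len ^ P.σ)⁻¹ * W.len ≤ 1 := by
    rw [inv_mul_le_iff₀ hpos, mul_one]; exact h1
  nlinarith

theorem dist_le_torusDist (p q : Torus) : dist p q ≤ torusDist p q := by
  rw [Prod.dist_eq, dist_eq_norm, dist_eq_norm]
  refine max_le ?_ ?_
  · exact Real.le_sqrt_of_sq_le (by nlinarith [sq_nonneg ‖p.2 - q.2‖])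
  · exact Real.le_sqrt_of_sq_le (by nlinarith [sq_nonneg ‖p.1 - q.1‖])

theorem circle_norm_coe_le (x : ℝ) : ‖(x : UnitAddCircle)‖ ≤ |x| := by
  simpa using QuotientAddGroup.norm_mk_le_norm (S := AddSubgroup.zmultiples (1 : ℝ)) (m := x)

theorem dist_path_le {α : ℕ} (W₁ W₂ : Leaf α) {t : ℝ} (ht : |t| ≤ 1) :
    dist (W₁.path t) (W₂.path t) ≤ torusDist W₁.base W₂.base + ‖W₁.dir - W₂.dir‖ := by
  have hb := dist_le_torusDist W₁.base W₂.base
  rw [Prod.dist_eq, max_le_iff, dist_eq_norm, dist_eq_norm] at hb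
  have hc (i : Fin 2) (a b : UnitAddCircle) :
      dist (a + ((t * W₁.dir i : ℝ) : UnitAddCircle)) (b + ((t * W₂.dir i : ℝ) : UnitAddCircle))
        ≤ ‖a - b‖ + ‖W₁.dir - W₂.dir‖ := by
    rw [dist_eq_norm, add_sub_add_comm, ← AddCircle.coe_sub, ← mul_sub]
    refine (norm_add_le _ _).trans (add_le_add_right ?_ _)
    refine (circle_norm_coe_le _).trans ?_
    rw [abs_mul]
    have h1 : |W₁.dir i - W₂.dir i| ≤ ‖W₁.dir - W₂.dir‖ := by
      simpa using PiLp.norm_apply_le (W₁.dir - W₂.dir) i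
    nlinarith [abs_nonneg t, abs_nonneg (W₁.dir i - W₂.dir i)]
  rw [Prod.dist_eq]
  exact max_le ((hc 0 _ _).trans (by linarith [hb.1])) ((hc 1 _ _).trans (by linarith [hb.2]))

theorem leafNorm_one_bound {α : ℕ} {W : Leaf α} {φ : Torus → ℂ} (h : leafNorm 1 W φ ≤ 1)
    {t : ℝ} (ht : t ∈ Icc (0 : ℝ) W.len) : ‖φ (W.path t)‖ ≤ 1 := by
  have h1 : ‖φ (W.path t)‖ₑ ≤ 1 := (holder_sup_le (u := fun t => φ (W.path t)) ht).trans h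
  rwa [← ofReal_norm, ENNReal.ofReal_le_one] at h1

theorem unstableENorm_lt_top (P : Params) (α : ℕ) {f : Torus → C2} (hf : f ∈ lipFun) :
    unstableENorm P α f < ⊤ := by
  obtain ⟨B, hB0, hB⟩ := lipFun_bound hf
  have hfc := lipFun_continuous hf
  obtain ⟨K, hK⟩ := hf
  refine lt_of_le_of_lt (b := ENNReal.ofReal ((3 * B + K) * (2 / (α : ℝ)) ^ (1 - P.β))) ?_
    ENNReal.ofReal_lt_top
  refine iSup_le fun δ => iSup_le fun W₁ => iSup_le fun W₂ => iSup_le fun φ₁ => iSup_le fun φ₂ =>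
    iSup_le fun h => ?_
  have hδ := h.pos
  set m := min W₁.len W₂.len with hm
  have hm0 : 0 < m := lt_min W₁.len_pos W₂.len_pos
  have hd : torusDist W₁.base W₂.base + ‖W₁.dir - W₂.dir‖ + |W₁.len - W₂.len| < δ := h.dist_lt
  have hd0 : 0 ≤ torusDist W₁.base W₂.base := Real.sqrt_nonneg _
  set F₁ : ℝ → C2 := fun t => φ₁ (W₁.path t) • f (W₁.path t) with hF₁
  set F₂ : ℝ → C2 := fun t => φ₂ (W₂.path t) • f (W₂.path t) with hF₂
  have i₁ : IntervalIntegrable F₁ volume 0 W₁.len := leaf_intervalIntegrable one_pos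
    (ne_top_of_le_ne_top ENNReal.one_ne_top h.norm₁) hfc
  have i₂ : IntervalIntegrable F₂ volume 0 W₂.len := leaf_intervalIntegrable one_pos
    (ne_top_of_le_ne_top ENNReal.one_ne_top h.norm₂) hfc
  have hsub (S : ℝ) (hS : m ≤ S) : uIcc 0 m ⊆ uIcc 0 S ∧ uIcc m S ⊆ uIcc 0 S := by
    rw [uIcc_of_le hm0.le, uIcc_of_le hS, uIcc_of_le (hm0.le.trans hS)]
    exact ⟨Icc_subset_Icc_right hS, Icc_subset_Icc_left hm0.le⟩
  have s₁ := hsub W₁.len (min_le_left _ _)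
  have s₂ := hsub W₂.len (min_le_right _ _)
  have e₁ : leafIntegral W₁ f φ₁ = (∫ t in (0 : ℝ)..m, F₁ t) + ∫ t in m..W₁.len, F₁ t :=
    (intervalIntegral.integral_add_adjacent_intervals (i₁.mono_set s₁.1) (i₁.mono_set s₁.2)).symm
  have e₂ : leafIntegral W₂ f φ₂ = (∫ t in (0 : ℝ)..m, F₂ t) + ∫ t in m..W₂.len, F₂ t :=
    (intervalIntegral.integral_add_adjacent_intervals (i₂.mono_set s₂.1) (i₂.mono_set s₂.2)).symm
  have tail₁ : ‖∫ t in m..W₁.len, F₁ t‖ ≤ B * |W₁.len - m| := by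
    refine intervalIntegral.norm_integral_le_of_norm_le_const fun t ht => ?_
    rw [uIoc_of_le (min_le_left _ _)] at ht
    have := leafNorm_one_bound h.norm₁ ⟨hm0.le.trans ht.1.le, ht.2⟩
    rw [hF₁, norm_smul]
    nlinarith [hB (W₁.path t), norm_nonneg (f (W₁.path t)), norm_nonneg (φ₁ (W₁.path t))]
  have tail₂ : ‖∫ t in m..W₂.len, F₂ t‖ ≤ B * |W₂.len - m| := by
    refine intervalIntegral.norm_integral_le_of_norm_le_const fun t ht => ?_
    rw [uIoc_of_le (min_le_right _ _)] at ht
    have := leafNorm_one_bound h.norm₂ ⟨hm0.le.trans ht.1.le, ht.2⟩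
    rw [hF₂, norm_smul]
    nlinarith [hB (W₂.path t), norm_nonneg (f (W₂.path t)), norm_nonneg (φ₂ (W₂.path t))]
  have main : ‖∫ t in (0 : ℝ)..m, (F₁ t - F₂ t)‖ ≤ (B * δ + K * δ) * |m - 0| := by
    refine intervalIntegral.norm_integral_le_of_norm_le_const fun t ht => ?_
    rw [uIoc_of_le hm0.le] at ht
    have ht' : t ∈ Icc (0 : ℝ) m := ⟨ht.1.le, ht.2⟩
    have b₂ := leafNorm_one_bound h.norm₂ ⟨ht'.1, ht'.2.trans (min_le_right _ _)⟩
    have hdiff : ‖φ₁ (W₁.path t) - φ₂ (W₂.path t)‖ ≤ δ := by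
      have h1 := (holder_sup_le (r := P.q)
        (u := fun t => φ₁ (W₁.path t) - φ₂ (W₂.path t)) ht').trans h.test_lt.le
      rw [← ofReal_norm] at h1
      exact (ENNReal.ofReal_le_ofReal_iff hδ.le).1 h1
    have hpath : ‖f (W₁.path t) - f (W₂.path t)‖ ≤ K * δ := by
      rw [← dist_eq_norm]
      refine (hK.dist_le_mul _ _).trans ?_
      have ht1 : |t| ≤ 1 := by
        rw [abs_of_pos ht.1]
        exact ht.2.trans ((min_le_left _ _).trans W₁.len_le)
      have := dist_path_le W₁ W₂ ht1
      gcongr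
      linarith [abs_nonneg (W₁.len - W₂.len)]
    have e : F₁ t - F₂ t = (φ₁ (W₁.path t) - φ₂ (W₂.path t)) • f (W₁.path t)
        + φ₂ (W₂.path t) • (f (W₁.path t) - f (W₂.path t)) := by
      simp only [hF₁, hF₂, sub_smul, smul_sub]; abel
    rw [e]
    refine (norm_add_le _ _).trans ?_
    rw [norm_smul, norm_smul]
    have hKδ : 0 ≤ (K : ℝ) * δ := by positivity
    have a1 : ‖φ₁ (W₁.path t) - φ₂ (W₂.path t)‖ * ‖f (W₁.path t)‖ ≤ δ * B :=
      mul_le_mul hdiff (hB _) (norm_nonneg _) hδ.le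
    have a2 : ‖φ₂ (W₂.path t)‖ * ‖f (W₁.path t) - f (W₂.path t)‖ ≤ 1 * (K * δ) :=
      mul_le_mul b₂ hpath (norm_nonneg _) zero_le_one
    linarith
  have total : ‖leafIntegral W₁ f φ₁ - leafIntegral W₂ f φ₂‖ ≤ (3 * B + K) * δ := by
    rw [e₁, e₂, add_sub_add_comm, ← intervalIntegral.integral_sub (i₁.mono_set s₁.1)
      (i₂.mono_set s₂.1)]
    refine (norm_add_le _ _).trans ?_
    have t3 := norm_sub_le (∫ t in m..W₁.len, F₁ t) (∫ t in m..W₂.len, F₂ t)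
    have hm1 : |m - 0| ≤ 1 := by
      rw [sub_zero, abs_of_pos hm0]
      exact (min_le_left _ _).trans W₁.len_le
    have l1 : |W₁.len - m| ≤ δ := by
      rw [abs_of_nonneg (sub_nonneg.2 (min_le_left _ _))]
      rcases min_cases W₁.len W₂.len with hc | hc <;> rw [hm, hc.1] <;>
        linarith [le_abs_self (W₁.len - W₂.len), norm_nonneg (W₁.dir - W₂.dir)]
    have l2 : |W₂.len - m| ≤ δ := by
      rw [abs_of_nonneg (sub_nonneg.2 (min_le_right _ _))]
      rcases min_cases W₁.len W₂.len with hc | hc <;> rw [hm, hc.1] <;>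
        linarith [neg_abs_le (W₁.len - W₂.len), norm_nonneg (W₁.dir - W₂.dir)]
    have hK0 : (0 : ℝ) ≤ K := K.2
    have m1 : (B * δ + K * δ) * |m - 0| ≤ (B * δ + K * δ) * 1 :=
      mul_le_mul_of_nonneg_left hm1 (by positivity)
    have m2 : B * |W₁.len - m| ≤ B * δ := mul_le_mul_of_nonneg_left l1 hB0
    have m3 : B * |W₂.len - m| ≤ B * δ := mul_le_mul_of_nonneg_left l2 hB0
    linarith
  have hδβ : 0 < δ ^ P.β := Real.rpow_pos_of_pos hδ _
  rw [ENNReal.div_le_iff (by simpa using hδβ) ENNReal.ofReal_ne_top, ← ofReal_norm,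
    ← ENNReal.ofReal_mul (by have := K.2; positivity)]
  refine ENNReal.ofReal_le_ofReal (total.trans ?_)
  have hK0 : (0 : ℝ) ≤ K := K.2
  have e : δ = δ ^ (1 - P.β) * δ ^ P.β := by
    rw [← Real.rpow_add hδ]; simp
  have mono : δ ^ (1 - P.β) ≤ (2 / (α : ℝ)) ^ (1 - P.β) :=
    Real.rpow_le_rpow hδ.le h.le (by linarith [P.β_lt])
  calc (3 * B + K) * δ = (3 * B + K) * (δ ^ (1 - P.β) * δ ^ P.β) := by rw [← e]
    _ ≤ (3 * B + K) * ((2 / (α : ℝ)) ^ (1 - P.β) * δ ^ P.β) := by gcongr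
    _ = _ := by ring

theorem weakENorm_lt_top (P : Params) (α : ℕ) {f : Torus → C2} (hf : f ∈ lipFun) :
    weakENorm α f < ⊤ :=
  (weakENorm_le_stableENorm P α f).trans_lt (stableENorm_lt_top P α hf)

theorem weakENorm_add (α : ℕ) {f g : Torus → C2} (hf : f ∈ lipFun) (hg : g ∈ lipFun) :
    weakENorm α (f + g) ≤ weakENorm α f + weakENorm α g := by
  refine iSup_le fun W => iSup_le fun φ => iSup_le fun h => ?_
  rw [leafIntegral_add one_pos (ne_top_of_le_ne_top ENNReal.one_ne_top h.2) hf hg]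
  refine (enorm_add_le _ _).trans (add_le_add ?_ ?_)
  · exact le_iSup_of_le W (le_iSup_of_le φ (le_iSup_of_le h le_rfl))
  · exact le_iSup_of_le W (le_iSup_of_le φ (le_iSup_of_le h le_rfl))

theorem stableENorm_add (P : Params) (α : ℕ) {f g : Torus → C2} (hf : f ∈ lipFun)
    (hg : g ∈ lipFun) : stableENorm P α (f + g) ≤ stableENorm P α f + stableENorm P α g := by
  refine iSup_le fun W => iSup_le fun φ => iSup_le fun h => ?_
  rw [leafIntegral_add P.q_pos (stable_test_ne_top P h.2) hf hg]
  refine (enorm_add_le _ _).trans (add_le_add ?_ ?_)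
  · exact le_iSup_of_le W (le_iSup_of_le φ (le_iSup_of_le h le_rfl))
  · exact le_iSup_of_le W (le_iSup_of_le φ (le_iSup_of_le h le_rfl))

theorem unstableENorm_add (P : Params) (α : ℕ) {f g : Torus → C2} (hf : f ∈ lipFun)
    (hg : g ∈ lipFun) :
    unstableENorm P α (f + g) ≤ unstableENorm P α f + unstableENorm P α g := by
  refine iSup_le fun δ => iSup_le fun W₁ => iSup_le fun W₂ => iSup_le fun φ₁ => iSup_le fun φ₂ =>
    iSup_le fun h => ?_
  rw [leafIntegral_add one_pos (ne_top_of_le_ne_top ENNReal.one_ne_top h.norm₁) hf hg,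
    leafIntegral_add one_pos (ne_top_of_le_ne_top ENNReal.one_ne_top h.norm₂) hf hg,
    add_sub_add_comm]
  have hle (k : Torus → C2) : ‖leafIntegral W₁ k φ₁ - leafIntegral W₂ k φ₂‖ₑ
      / ENNReal.ofReal (δ ^ P.β) ≤ unstableENorm P α k :=
    le_iSup_of_le δ <| le_iSup_of_le W₁ <| le_iSup_of_le W₂ <| le_iSup_of_le φ₁ <|
      le_iSup_of_le φ₂ <| le_iSup_of_le h le_rfl
  refine le_trans ?_ (add_le_add (hle f) (hle g))
  rw [← ENNReal.add_div]
  gcongr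
  exact enorm_add_le _ _

theorem weakENorm_smul (α : ℕ) (c : ℂ) (f : Torus → C2) :
    weakENorm α (c • f) = ‖c‖ₑ * weakENorm α f := by
  simp only [weakENorm, leafIntegral_smul, enorm_smul, ENNReal.mul_iSup]

theorem stableENorm_smul (P : Params) (α : ℕ) (c : ℂ) (f : Torus → C2) :
    stableENorm P α (c • f) = ‖c‖ₑ * stableENorm P α f := by
  simp only [stableENorm, leafIntegral_smul, enorm_smul, ENNReal.mul_iSup]

theorem unstableENorm_smul (P : Params) (α : ℕ) (c : ℂ) (f : Torus → C2) :
    unstableENorm P α (c • f) = ‖c‖ₑ * unstableENorm P α f := by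
  simp only [unstableENorm, leafIntegral_smul, ← smul_sub, enorm_smul, ENNReal.mul_iSup,
    mul_div_assoc]

/-- A finite extended norm on Lipschitz functions, as a real-valued seminorm. -/
noncomputable def toSeminorm (N : (Torus → C2) → ℝ≥0∞) (hfin : ∀ f ∈ lipFun, N f < ⊤)
    (hadd : ∀ f ∈ lipFun, ∀ g ∈ lipFun, N (f + g) ≤ N f + N g)
    (hsmul : ∀ (c : ℂ) (f : Torus → C2), N (c • f) = ‖c‖ₑ * N f) : Seminorm ℂ lipFun :=
  Seminorm.of (fun f => (N f).toReal)
    (fun f g => by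
      have hf := hfin f f.2
      have hg := hfin g g.2
      rw [← ENNReal.toReal_add hf.ne hg.ne]
      exact ENNReal.toReal_mono (ENNReal.add_lt_top.2 ⟨hf, hg⟩).ne (hadd f f.2 g g.2))
    (fun c f => by
      change (N (c • (f : Torus → C2))).toReal = _
      rw [hsmul, ENNReal.toReal_mul, toReal_enorm])

noncomputable def weakSeminorm (P : Params) (α : ℕ) : Seminorm ℂ lipFun :=
  toSeminorm (weakENorm α) (fun _ hf => weakENorm_lt_top P α hf)
    (fun _ hf _ hg => weakENorm_add α hf hg) (weakENorm_smul α)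

noncomputable def stableSeminorm (P : Params) (α : ℕ) : Seminorm ℂ lipFun :=
  toSeminorm (stableENorm P α) (fun _ hf => stableENorm_lt_top P α hf)
    (fun _ hf _ hg => stableENorm_add P α hf hg) (stableENorm_smul P α)

noncomputable def unstableSeminorm (P : Params) (α : ℕ) : Seminorm ℂ lipFun :=
  toSeminorm (unstableENorm P α) (fun _ hf => unstableENorm_lt_top P α hf)
    (fun _ hf _ hg => unstableENorm_add P α hf hg) (unstableENorm_smul P α)

/-! ### The Banach space -/

/-- The Lipschitz functions, with the strong norm `‖f‖ = ‖f‖_s + ‖f‖_u`. -/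
def StrongLip (_ : Params) (_ : ℕ) : Type := lipFun

noncomputable instance (P : Params) (α : ℕ) : AddCommGroup (StrongLip P α) :=
  inferInstanceAs (AddCommGroup lipFun)

noncomputable instance (P : Params) (α : ℕ) : Module ℂ (StrongLip P α) :=
  inferInstanceAs (Module ℂ lipFun)

/-- The function underlying an element of `StrongLip`. -/
def StrongLip.fn {P : Params} {α : ℕ} (f : StrongLip P α) : Torus → C2 :=
  Subtype.val (p := (· ∈ lipFun)) f

noncomputable def strongSeminorm (P : Params) (α : ℕ) : Seminorm ℂ (StrongLip P α) :=
  (stableSeminorm P α + unstableSeminorm P α : Seminorm ℂ lipFun)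

noncomputable instance (P : Params) (α : ℕ) : SeminormedAddCommGroup (StrongLip P α) :=
  (strongSeminorm P α).toAddGroupSeminorm.toSeminormedAddCommGroup

noncomputable instance (P : Params) (α : ℕ) : NormedSpace ℂ (StrongLip P α) where
  norm_smul_le c f := (map_smul_eq_mul (strongSeminorm P α) c f).le

/-- The anisotropic Banach space: the completion of the Lipschitz functions in the strong norm. -/
abbrev X (P : Params) (α : ℕ) : Type := UniformSpace.Completion (StrongLip P α)

/-- The weak norm on `X`: the continuous extension of the weak norm of Lipschitz functions. -/
noncomputable def weakNorm {P : Params} {α : ℕ} : X P α → ℝ :=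
  UniformSpace.Completion.extension fun f : StrongLip P α => (weakENorm α f.fn).toReal

/-- The strong stable norm on `X`, extended likewise. -/
noncomputable def stableNorm {P : Params} {α : ℕ} : X P α → ℝ :=
  UniformSpace.Completion.extension fun f : StrongLip P α => (stableENorm P α f.fn).toReal

/-- The strong unstable norm on `X`, extended likewise. -/
noncomputable def unstableNorm {P : Params} {α : ℕ} : X P α → ℝ :=
  UniformSpace.Completion.extension fun f : StrongLip P α => (unstableENorm P α f.fn).toReal

theorem strongLip_norm {P : Params} {α : ℕ} (f : StrongLip P α) :
    ‖f‖ = (stableENorm P α f.fn).toReal + (unstableENorm P α f.fn).toReal := rfl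

theorem uniformContinuous_seminorm {P : Params} {α : ℕ} (p : Seminorm ℂ lipFun)
    (hp : p ≤ stableSeminorm P α + unstableSeminorm P α) :
    UniformContinuous fun f : StrongLip P α => p (show lipFun from f) := by
  refine (LipschitzWith.of_dist_le_mul (K := 1) fun f g => ?_).uniformContinuous
  rw [NNReal.coe_one, one_mul, Real.dist_eq, dist_eq_norm]
  exact (abs_sub_map_le_sub p (show lipFun from f) (show lipFun from g)).trans (hp _)

theorem uniformContinuous_weak (P : Params) (α : ℕ) :
    UniformContinuous fun f : StrongLip P α => (weakENorm α f.fn).toReal := by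
  refine uniformContinuous_seminorm (weakSeminorm P α) fun f => ?_
  have h1 : weakSeminorm P α f ≤ stableSeminorm P α f :=
    ENNReal.toReal_mono (stableENorm_lt_top P α f.2).ne (weakENorm_le_stableENorm P α f)
  exact h1.trans (le_add_of_nonneg_right (apply_nonneg (unstableSeminorm P α) f))

theorem uniformContinuous_stable (P : Params) (α : ℕ) :
    UniformContinuous fun f : StrongLip P α => (stableENorm P α f.fn).toReal :=
  uniformContinuous_seminorm (stableSeminorm P α) fun f =>
    le_add_of_nonneg_right (apply_nonneg (unstableSeminorm P α) f)

theorem uniformContinuous_unstable (P : Params) (α : ℕ) :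
    UniformContinuous fun f : StrongLip P α => (unstableENorm P α f.fn).toReal :=
  uniformContinuous_seminorm (unstableSeminorm P α) fun f =>
    le_add_of_nonneg_left (apply_nonneg (stableSeminorm P α) f)

theorem weakNorm_coe {P : Params} {α : ℕ} (f : StrongLip P α) :
    weakNorm (f : X P α) = (weakENorm α f.fn).toReal :=
  UniformSpace.Completion.extension_coe (uniformContinuous_weak P α) f

theorem stableNorm_coe {P : Params} {α : ℕ} (f : StrongLip P α) :
    stableNorm (f : X P α) = (stableENorm P α f.fn).toReal :=
  UniformSpace.Completion.extension_coe (uniformContinuous_stable P α) f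

theorem unstableNorm_coe {P : Params} {α : ℕ} (f : StrongLip P α) :
    unstableNorm (f : X P α) = (unstableENorm P α f.fn).toReal :=
  UniformSpace.Completion.extension_coe (uniformContinuous_unstable P α) f

/-- The element `x` of `X` is the (possibly discontinuous) function `u`: some Lipschitz functions
converge to `x` in `X` and to `u` in the strong norm. -/
def Represents {P : Params} {α : ℕ} (x : X P α) (u : Torus → C2) : Prop :=
  ∀ ε : ℝ, 0 < ε → ∃ f : StrongLip P α, ‖x - (f : X P α)‖ < ε ∧
    strongENorm P α (u - f.fn) < ENNReal.ofReal ε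

/-- The bounded operator `L` on `X` is the continuous extension of the operator `A` on Lipschitz
functions. -/
def Extends {P : Params} {α : ℕ} (L : X P α →L[ℂ] X P α) (A : (Torus → C2) → Torus → C2) :
    Prop :=
  ∀ f : StrongLip P α, Represents (L (f : X P α)) (A f.fn)

end StretchFold

open StretchFold

namespace StretchFold

/-! ### Riesz theory for operators that are small up to a finite-rank seminorm -/

section Riesz

open Module.End

variable {E F : Type*} [NormedAddCommGroup E] [NormedSpace ℂ E] [NormedAddCommGroup F]
  [NormedSpace ℂ F] [FiniteDimensional ℂ F] {L : E →L[ℂ] E} {l : E →L[ℂ] F} {r ρ : ℝ}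

/-! Square root of the operator. Exchanging the coordinates conjugates the vertical shear to the
horizontal one, so T_α is the square of a single map, whose inverse is `halfInv`, and the transfer
operator is the square of `halfTransfer` (`halfTransfer_halfTransfer`). Every norm is estimated for
one half step, and the half step is then applied twice.

Geometry of a half step. The sign is constant between consecutive half-integer heights, so a leaf
splits into at most eight strands. On each of them `halfInv` is affine, stretches by a factor
comparable to α, and produces a graph whose direction lies again in the stable cone
(`Leaf.abs_slope_le`). The change of variables contributes 1/α, which pays for the order of α
admissible pieces that a long image contains. This bounds the weak norm. In the stable norm the
transported test function is flatter by 1/α: its constant part on each piece is charged to the weak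
norm and its oscillation gains α^(-q), while a leaf shorter than 1/α gains α^(σ-1) from the weight
(`stable_halfTransfer`). Two leaves at distance δ have images at distance of order δ/α over a common
range of heights, which gives the factor α^(-β) in front of the unstable norm. The unmatched ends
and the mismatch of the test functions are absorbed by the stable norm with the factor α^(β-1), by
means of β < σ and β < 1 - q (`unstable_strand`).

Staying in the space. The image of a Lipschitz function jumps where the sign does, so all estimates
are made for bounded measurable functions. Replacing the sign by a Lipschitz ramp of width ε creates
an error supported in thin strips that leaves cross transversally. The error is small in the strong
norm (`stable_errorMul`, `unstable_errorMul`), so the image is a limit of Lipschitz functions, and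
the operator extends (`exists_extends`). Multiplication by the phase is bounded on the stable and
weak norms separately; on the unstable norm it costs a multiple of the stable one
(`unstable_multiplier`).

Spectrum. Leaves together with their test functions form a totally bounded family, so for every ε
the weak norm is at most a finite-rank seminorm plus ε times the strong norm (`exists_finiteRank`).
Inserted in the bound on the twisted operator, this gives ‖L h‖ ≤ r‖h‖ + ‖l h‖ with l of finite rank
and r a multiple of α^(-η). Riesz's classical arguments for compact operators survive this
perturbation outside the disc of radius 4r (`spectrum_outside_disc`), so one application of the
operator suffices and no iteration is needed. -/

theorem exists_subseq_cauchy (l : E →L[ℂ] F) {x : ℕ → E} {R : ℝ} (hx : ∀ n, ‖x n‖ ≤ R) :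
    ∃ φ : ℕ → ℕ, StrictMono φ ∧ CauchySeq fun n => l (x (φ n)) := by
  have : ProperSpace F := FiniteDimensional.proper ℂ F
  have hb : ∀ n, l (x n) ∈ Metric.closedBall (0 : F) (‖l‖ * R) := fun n => by
    rw [mem_closedBall_zero_iff]
    exact (l.le_opNorm _).trans (by gcongr; exact hx n)
  obtain ⟨a, -, φ, hφ, ha⟩ := tendsto_subseq_of_bounded Metric.isBounded_closedBall hb
  exact ⟨φ, hφ, ha.cauchySeq⟩

/-- The common contradiction of the Riesz arguments. Along a subsequence the finite-rank part is
Cauchy, so two of its terms differ by less than 1/4 under `l`. Their difference has norm at most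
3/ρ, and r · 3/ρ ≤ 3/4 because 4r ≤ ρ. The two images are then at distance less than one. This is
where the radius 4r originates. -/
theorem false_of_separated (hr : ∀ x, ‖L x‖ ≤ r * ‖x‖ + ‖l x‖) (hr0 : 0 ≤ r) (hρ : 0 < ρ)
    (hrρ : 4 * r ≤ ρ) {z : ℕ → E} (hz : ∀ n, ‖z n‖ ≤ 3 / 2 / ρ)
    (hsep : ∀ n m, n < m → 1 ≤ ‖L (z m) - L (z n)‖) : False := by
  obtain ⟨φ, hφ, hc⟩ := exists_subseq_cauchy l hz
  obtain ⟨N, hN⟩ := Metric.cauchySeq_iff'.1 hc (1 / 4) (by norm_num)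
  have h1 := hsep (φ N) (φ (N + 1)) (hφ N.lt_succ_self)
  have h2 := hN (N + 1) (by omega)
  rw [dist_eq_norm, ← map_sub] at h2
  rw [← map_sub] at h1
  have h3 := hr (z (φ (N + 1)) - z (φ N))
  have h4 : ‖z (φ (N + 1)) - z (φ N)‖ ≤ 3 / 2 / ρ + 3 / 2 / ρ :=
    (norm_sub_le _ _).trans (add_le_add (hz _) (hz _))
  have h5 : r * ‖z (φ (N + 1)) - z (φ N)‖ ≤ 3 / 4 := by
    calc _ ≤ r * (3 / 2 / ρ + 3 / 2 / ρ) := by gcongr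
      _ = 3 / 4 * ((4 * r) / ρ) := by field_simp; ring
      _ ≤ 3 / 4 * 1 := by gcongr; exact (div_le_one hρ).2 hrρ
      _ = _ := by ring
  linarith

/-- Riesz's lemma inside the larger subspace; 3/2 is the norm bound that `false_of_separated`
expects. -/
theorem exists_far_point {V W : Submodule ℂ E} (hV : IsClosed (V : Set E)) (hVW : V < W) :
    ∃ x ∈ W, ‖x‖ ≤ 3 / 2 ∧ ∀ y ∈ V, 1 ≤ ‖x - y‖ := by
  have h₁ : IsClosed (V.comap W.subtype : Set W) := hV.preimage continuous_subtype_val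
  obtain ⟨w, hwW, hwV⟩ := SetLike.exists_of_lt hVW
  obtain ⟨⟨x, hx⟩, hx1, hx2⟩ := riesz_lemma_of_norm_lt (𝕜 := ℂ) (c := (5 / 4 : ℝ)) (R := 3 / 2)
    (by rw [Complex.norm_real]; norm_num) (by rw [Complex.norm_real]; norm_num) h₁ ⟨⟨w, hwW⟩, hwV⟩
  exact ⟨x, hx, hx1, fun y hy => hx2 ⟨y, hVW.le hy⟩ hy⟩

/-- Far points x_n of Y_(n+1) from Y_n are rescaled by 1/ν_n. For n < m the image of the m-th is x_m
plus an element of Y_m, and the image of the n-th lies in Y_m, so the images are 1-separated. It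
serves both for the number of eigenvalues and for the ascent of a single one. -/
theorem false_of_flag (hr : ∀ x, ‖L x‖ ≤ r * ‖x‖ + ‖l x‖) (hr0 : 0 ≤ r) (hρ : 0 < ρ)
    (hrρ : 4 * r ≤ ρ) (Y : ℕ → Submodule ℂ E) (ν : ℕ → ℂ) (hν : ∀ n, ρ ≤ ‖ν n‖)
    (hYc : ∀ n, IsClosed (Y n : Set E)) (hY : ∀ n, Y n < Y (n + 1))
    (hLY : ∀ n, ∀ x ∈ Y n, L x ∈ Y n) (hL : ∀ n, ∀ x ∈ Y (n + 1), L x - ν n • x ∈ Y n) :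
    False := by
  have hν0 : ∀ n, ν n ≠ 0 := fun n => norm_pos_iff.1 (hρ.trans_le (hν n))
  choose x hxY hx hxd using fun n => exists_far_point (hYc n) (hY n)
  have hmono : Monotone Y := monotone_nat_of_le_succ fun n => (hY n).le
  refine false_of_separated hr hr0 hρ hrρ (z := fun n => (ν n)⁻¹ • x n) (fun n => ?_)
    fun n m hnm => ?_
  · rw [norm_smul, norm_inv, div_eq_inv_mul]
    exact mul_le_mul (inv_anti₀ hρ (hν n)) (hx n) (norm_nonneg _) (inv_nonneg.2 hρ.le)
  · have e : L ((ν m)⁻¹ • x m) - L ((ν n)⁻¹ • x n)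
        = x m - (L ((ν n)⁻¹ • x n) - (ν m)⁻¹ • (L (x m) - ν m • x m)) := by
      rw [map_smul, smul_sub, smul_smul, inv_mul_cancel₀ (hν0 m), one_smul]; abel
    rw [e]
    refine hxd m _ (Submodule.sub_mem _ ?_ (Submodule.smul_mem _ _ (hL m _ (hxY m))))
    exact hLY m _ (Submodule.smul_mem _ _ (hmono hnm (hxY n)))

/-- Otherwise there are unit vectors x_n with (L - μ)x_n → 0. Applied to differences, (‖μ‖ - r)‖y‖ ≤
‖l y‖ + ‖(L - μ)y‖ makes a subsequence Cauchy once its image under `l` is Cauchy, and the limit is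
an eigenvector. -/
theorem antilipschitz_of_not_hasEigenvalue (hr : ∀ x, ‖L x‖ ≤ r * ‖x‖ + ‖l x‖)
    [CompleteSpace E] {μ : ℂ} (hμ : r < ‖μ‖)
    (h : ¬ HasEigenvalue (L : E →ₗ[ℂ] E) μ) : ∃ K, AntilipschitzWith K (L - μ • 1 : E →L[ℂ] E) := by
  rw [antilipschitzWith_iff_exists_mul_le_norm]
  by_contra! hK
  have hunit : ∀ n : ℕ, ∃ x : E, ‖x‖ = 1 ∧ ‖(L - μ • 1) x‖ < 1 / ((n : ℝ) + 1) := by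
    intro n
    obtain ⟨x, hx⟩ := hK (1 / ((n : ℝ) + 1)) (by positivity)
    have hx0 : 0 < ‖x‖ := by
      rw [norm_pos_iff]; rintro rfl; simp at hx
    refine ⟨(‖x‖⁻¹ : ℂ) • x, ?_, ?_⟩
    · rw [norm_smul, norm_inv, Complex.norm_real, norm_norm, inv_mul_cancel₀ hx0.ne']
    · rw [map_smul, norm_smul, norm_inv, Complex.norm_real, norm_norm, inv_mul_lt_iff₀ hx0]
      linarith
  choose x hx1 hx2 using hunit
  have hlim0 : Tendsto (fun n => (L - μ • 1) (x n)) atTop (𝓝 0) :=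
    squeeze_zero_norm (fun n => (hx2 n).le) tendsto_one_div_add_atTop_nhds_zero_nat
  obtain ⟨φ, hφ, hc⟩ := exists_subseq_cauchy l (fun n => (hx1 n).le)
  have hc2 : CauchySeq fun n => (L - μ • 1) (x (φ n)) :=
    (hlim0.comp hφ.tendsto_atTop).cauchySeq
  have hgap : 0 < ‖μ‖ - r := sub_pos.2 hμ
  have hcx : CauchySeq fun n => x (φ n) := by
    rw [Metric.cauchySeq_iff] at hc hc2 ⊢
    intro ε hε
    obtain ⟨N₁, h₁⟩ := hc ((‖μ‖ - r) * ε / 2) (by positivity)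
    obtain ⟨N₂, h₂⟩ := hc2 ((‖μ‖ - r) * ε / 2) (by positivity)
    refine ⟨max N₁ N₂, fun m hm n hn => ?_⟩
    have a1 := h₁ m (le_of_max_le_left hm) n (le_of_max_le_left hn)
    have a2 := h₂ m (le_of_max_le_right hm) n (le_of_max_le_right hn)
    rw [dist_eq_norm, ← map_sub] at a1 a2
    rw [dist_eq_norm]
    set y := x (φ m) - x (φ n)
    have a3 : μ • y = L y - (L - μ • 1) y := by simp
    have a4 : ‖μ‖ * ‖y‖ ≤ ‖L y‖ + ‖(L - μ • 1) y‖ := by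
      rw [← norm_smul, a3]; exact norm_sub_le _ _
    have a5 := hr y
    have a6 : (‖μ‖ - r) * ‖y‖ < (‖μ‖ - r) * ε := by nlinarith
    exact lt_of_mul_lt_mul_left a6 hgap.le
  obtain ⟨a, ha⟩ := cauchySeq_tendsto_of_complete hcx
  have ha1 : ‖a‖ = 1 := tendsto_nhds_unique ha.norm (by simp [hx1])
  have ha2 : (L - μ • 1) a = 0 :=
    tendsto_nhds_unique (((L - μ • 1).continuous.tendsto a).comp ha) (hlim0.comp hφ.tendsto_atTop)
  refine h (hasEigenvalue_of_hasEigenvector (x := a) ⟨?_, ?_⟩)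
  · rw [mem_eigenspace_iff]
    simpa [sub_eq_zero] using ha2
  · rintro rfl; simp at ha1

/-- If μ is in the spectrum but not an eigenvalue, then S = L - μ is a closed embedding that is not
onto, so the ranges of its powers are closed and strictly decreasing. Points of each range far from
the next one contradict `false_of_separated`; the order is opposite to that of a flag, and the
earlier point is the far one. -/
theorem hasEigenvalue_of_mem_spectrum (hr : ∀ x, ‖L x‖ ≤ r * ‖x‖ + ‖l x‖) (hr0 : 0 ≤ r)
    [CompleteSpace E] {μ : ℂ} (hμ0 : 0 < ‖μ‖) (hμ : 4 * r ≤ ‖μ‖) (hs : μ ∈ spectrum ℂ L) :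
    HasEigenvalue (L : E →ₗ[ℂ] E) μ := by
  by_contra h
  obtain ⟨K, hK⟩ := antilipschitz_of_not_hasEigenvalue hr (by linarith) h
  set S : E →L[ℂ] E := L - μ • 1 with hS
  have hce : IsClosedEmbedding S := hK.isClosedEmbedding S.uniformContinuous
  have hnot : ¬ Function.Surjective S := by
    intro hsurj
    refine hs ?_
    rw [spectrum.mem_resolventSet_iff, ← IsUnit.neg_iff, ContinuousLinearMap.isUnit_iff_bijective]
    have e : -(algebraMap ℂ (E →L[ℂ] E) μ - L) = S := by
      rw [hS, Algebra.algebraMap_eq_smul_one, neg_sub]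
    rw [e]
    exact ⟨hK.injective, hsurj⟩
  set T : E →ₗ[ℂ] E := S.toLinearMap
  set V : ℕ → Submodule ℂ E := fun n => LinearMap.range (T ^ n)
  have hVs (n : ℕ) : V (n + 1) = (V n).map T := by
    simp only [V, pow_succ', Module.End.mul_eq_comp, LinearMap.range_comp]
  have hVc (n : ℕ) : IsClosed (V n : Set E) := by
    induction n with
    | zero => simp [V, Module.End.one_eq_id]
    | succ n ih => rw [hVs]; exact hce.isClosedMap _ ih
  have hVle (n : ℕ) : V (n + 1) ≤ V n := by
    rintro _ ⟨y, rfl⟩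
    exact ⟨T y, by rw [pow_succ]; rfl⟩
  have hVanti : Antitone V := antitone_nat_of_succ_le hVle
  have hinj (n : ℕ) : Function.Injective (T ^ n) := by
    rw [Module.End.coe_pow]; exact hK.injective.iterate n
  have hVlt (n : ℕ) : V (n + 1) < V n := by
    refine lt_of_le_of_ne (hVle n) fun heq => hnot fun y => ?_
    have : (T ^ n) y ∈ V (n + 1) := heq ▸ ⟨y, rfl⟩
    obtain ⟨z, hz⟩ := this
    refine ⟨z, hinj n ?_⟩
    rw [← hz, pow_succ]; rfl
  choose x hxV hx hxd using fun n => exists_far_point (hVc (n + 1)) (hVlt n)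
  have hμne : μ ≠ 0 := norm_pos_iff.1 hμ0
  have hT (n : ℕ) {y : E} (hy : y ∈ V n) : T y ∈ V (n + 1) := by
    rw [hVs]; exact ⟨y, hy, rfl⟩
  have hLT (y : E) : L y = T y + μ • y := by simp [T, hS]
  refine false_of_separated hr hr0 hμ0 hμ (z := fun n => μ⁻¹ • x n) (fun n => ?_)
    fun n m hnm => ?_
  · rw [norm_smul, norm_inv, div_eq_inv_mul]
    exact mul_le_mul_of_nonneg_left (hx n) (by positivity)
  · have e : L (μ⁻¹ • x m) - L (μ⁻¹ • x n)
        = -(x n - (μ⁻¹ • T (x m) + x m - μ⁻¹ • T (x n))) := by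
      rw [map_smul, map_smul, hLT, hLT, smul_add, smul_add, smul_smul, smul_smul,
        inv_mul_cancel₀ hμne, one_smul, one_smul]; abel
    rw [e, norm_neg]
    have hm : x m ∈ V (n + 1) := hVanti hnm (hxV m)
    exact hxd n _ (Submodule.sub_mem _ (Submodule.add_mem _ (Submodule.smul_mem _ _
      (hVle _ (hT _ hm))) hm) (Submodule.smul_mem _ _ (hT _ (hxV n))))

/-- Eigenvectors of infinitely many distinct eigenvalues are independent, and the spans of the first
n of them form a flag forbidden by `false_of_flag`. -/
theorem finite_eigenvalues (hr : ∀ x, ‖L x‖ ≤ r * ‖x‖ + ‖l x‖) (hr0 : 0 ≤ r) (hρ : 0 < ρ)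
    (hrρ : 4 * r ≤ ρ) : {μ : ℂ | ρ ≤ ‖μ‖ ∧ HasEigenvalue (L : E →ₗ[ℂ] E) μ}.Finite := by
  by_contra hinf
  set ν : ℕ ↪ _ := Set.Infinite.natEmbedding _ hinf
  choose v hv using fun n => (ν n).2.2.exists_hasEigenvector
  have hli : LinearIndependent ℂ v := eigenvectors_linearIndependent' (L : E →ₗ[ℂ] E)
    (fun n => (ν n : ℂ)) (fun a b hab => ν.injective (Subtype.ext hab)) v hv
  have hLv (n : ℕ) : L (v n) = (ν n : ℂ) • v n := (hv n).apply_eq_smul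
  set Y : ℕ → Submodule ℂ E := fun n => Submodule.span ℂ (v '' Iio n)
  have hfd (n : ℕ) : FiniteDimensional ℂ (Y n) :=
    FiniteDimensional.span_of_finite ℂ ((Set.finite_Iio n).image v)
  have hmem {n i : ℕ} (hi : i < n) : v i ∈ Y n := Submodule.subset_span ⟨i, hi, rfl⟩
  have hle (n : ℕ) : Y n ≤ Y (n + 1) :=
    Submodule.span_mono (image_mono (Iio_subset_Iio n.le_succ))
  have hLY (n : ℕ) : ∀ x ∈ Y n, L x ∈ Y n := by
    intro x hx
    refine Submodule.span_induction (p := fun x _ => L x ∈ Y n) ?_ ?_ ?_ ?_ hx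
    · rintro _ ⟨i, hi, rfl⟩
      rw [hLv]; exact Submodule.smul_mem _ _ (hmem hi)
    · simp
    · intro x y _ _ hx hy; rw [map_add]; exact Submodule.add_mem _ hx hy
    · intro a x _ hx; rw [map_smul]; exact Submodule.smul_mem _ _ hx
  refine false_of_flag hr hr0 hρ hrρ Y (fun n => ν n) (fun n => (ν n).2.1)
    (fun n => Submodule.closed_of_finiteDimensional _) (fun n => ?_) hLY fun n x hx => ?_
  · refine lt_of_le_of_ne (hle n) fun heq => ?_
    have h1 : v n ∈ Y n := heq ▸ hmem n.lt_succ_self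
    exact hli.notMem_span_image (s := Iio n) (x := n) (by simp) h1
  · refine Submodule.span_induction (p := fun x _ => L x - (ν n : ℂ) • x ∈ Y n) ?_ ?_ ?_ ?_ hx
    · rintro _ ⟨i, hi, rfl⟩
      rcases (Nat.lt_succ_iff_lt_or_eq.1 hi) with hi | rfl
      · exact Submodule.sub_mem _ (hLY n _ (hmem hi)) (Submodule.smul_mem _ _ (hmem hi))
      · rw [hLv]; simp
    · simp
    · intro x y _ _ hx hy
      have := Submodule.add_mem _ hx hy
      rwa [sub_add_sub_comm, ← map_add, ← smul_add] at this
    · intro a x _ hx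
      have := Submodule.smul_mem _ a hx
      rwa [smul_sub, ← map_smul, smul_comm] at this

/-- The kernels of the powers of L - μ stabilize, since otherwise they form a forbidden flag. The
first kernel is finite-dimensional, since otherwise it contains a bounded separated sequence on
which L acts as μ. Each kernel is mapped into the previous one by L - μ with finite-dimensional
kernel, so induction finishes. -/
theorem finiteDimensional_maxGenEigenspace (hr : ∀ x, ‖L x‖ ≤ r * ‖x‖ + ‖l x‖) (hr0 : 0 ≤ r)
    {μ : ℂ} (hμ0 : 0 < ‖μ‖) (hμ : 4 * r ≤ ‖μ‖) :
    FiniteDimensional ℂ (maxGenEigenspace (L : E →ₗ[ℂ] E) μ) := by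
  set S : E →L[ℂ] E := L - μ • 1 with hS
  set T : E →ₗ[ℂ] E := S.toLinearMap with hT
  have hTL : T = (L : E →ₗ[ℂ] E) - μ • 1 := by ext; simp [hT, hS]
  have hLT (y : E) : L y = T y + μ • y := by simp [T, hS]
  set Y : ℕ → Submodule ℂ E := fun n => LinearMap.ker (T ^ n) with hY
  have hYg (n : ℕ) : Y n = genEigenspace (L : E →ₗ[ℂ] E) μ n := by
    rw [genEigenspace_nat, hY, hTL]
  have hYc (n : ℕ) : IsClosed (Y n : Set E) := by
    have : Y n = LinearMap.ker ((S ^ n : E →L[ℂ] E) : E →ₗ[ℂ] E) := by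
      rw [hY]; simp [hT]
    rw [this]; exact (S ^ n).isClosed_ker
  have hYs (n : ℕ) : Y (n + 1) = (Y n).comap T := by
    ext x; simp only [hY, LinearMap.mem_ker, Submodule.mem_comap, pow_succ]; rfl
  have hYle (n : ℕ) : Y n ≤ Y (n + 1) := by
    intro x hx
    simp only [hY, LinearMap.mem_ker] at hx ⊢
    rw [pow_succ']; change T ((T ^ n) x) = 0; rw [hx, map_zero]
  have hstab : ∃ n, Y n = Y (n + 1) := by
    by_contra! hne
    refine false_of_flag hr hr0 hμ0 hμ Y (fun _ => μ) (fun _ => le_rfl) hYc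
      (fun n => lt_of_le_of_ne (hYle n) (hne n)) (fun n x hx => ?_) fun n x hx => ?_
    · rw [hLT]
      refine Submodule.add_mem _ ?_ (Submodule.smul_mem _ _ hx)
      have := hYle n hx; rw [hYs] at this; exact this
    · rw [hLT, add_sub_cancel_right]; rw [hYs] at hx; exact hx
  obtain ⟨n, hn⟩ := hstab
  have hstab' (m : ℕ) : Y m ≤ Y n := by
    have hup (k : ℕ) : Y (n + k) = Y n := by
      induction k with
      | zero => rfl
      | succ k ih => rw [← add_assoc, hYs, ih, ← hYs, ← hn]
    rw [← hup m]
    exact monotone_nat_of_le_succ hYle (by omega)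
  have hmax : maxGenEigenspace (L : E →ₗ[ℂ] E) μ = Y n := by
    ext x
    rw [mem_maxGenEigenspace]
    constructor
    · rintro ⟨k, hk⟩; exact hstab' k (by simpa only [hY, LinearMap.mem_ker, hTL] using hk)
    · intro hx; exact ⟨n, by simpa only [hY, LinearMap.mem_ker, hTL] using hx⟩
  have hker : FiniteDimensional ℂ (LinearMap.ker T) := by
    by_contra hfd
    obtain ⟨f, hf1, hf2⟩ := exists_seq_norm_le_one_le_norm_sub' (𝕜 := ℂ) (c := (5 / 4 : ℝ))
      (by rw [Complex.norm_real]; norm_num) (R := 3 / 2) (by rw [Complex.norm_real]; norm_num) hfd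
    have hLf (n : ℕ) : L (μ⁻¹ • (f n : E)) = f n := by
      rw [hLT, map_smul, (f n).2, smul_zero, zero_add, smul_smul,
        mul_inv_cancel₀ (norm_pos_iff.1 hμ0), one_smul]
    refine false_of_separated hr hr0 hμ0 hμ (z := fun n => μ⁻¹ • (f n : E)) (fun n => ?_)
      fun n m hnm => ?_
    · rw [norm_smul, norm_inv, div_eq_inv_mul]
      exact mul_le_mul_of_nonneg_left (hf1 n) (by positivity)
    · rw [hLf, hLf]; exact hf2 hnm.ne'
  have hfin (k : ℕ) : (Y k).FG := by
    induction k with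
    | zero => simp only [hY, pow_zero, Module.End.one_eq_id, LinearMap.ker_id]; exact Submodule.fg_bot
    | succ k ih =>
      have : FiniteDimensional ℂ (Y k) := Module.Finite.iff_fg.2 ih
      refine Submodule.fg_of_fg_map_of_fg_inf_ker T ?_ ?_
      · refine Module.Finite.iff_fg.1 (Submodule.finiteDimensional_of_le (S₂ := Y k) ?_)
        rw [hYs]; exact Submodule.map_comap_le _ _
      · exact Module.Finite.iff_fg.1 (Submodule.finiteDimensional_of_le
          (S₂ := LinearMap.ker T) inf_le_right)
  rw [hmax]
  exact Module.Finite.iff_fg.2 (hfin n)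

/-- An operator on a complex Banach space that is bounded by `r` up to a finite-rank seminorm has
only isolated eigenvalues of finite algebraic multiplicity outside a disc of radius `4 r`. -/
theorem spectrum_outside_disc (hr : ∀ x, ‖L x‖ ≤ r * ‖x‖ + ‖l x‖) (hr0 : 0 ≤ r)
    [CompleteSpace E] {μ : ℂ} (hs : μ ∈ spectrum ℂ L) (hμ : 4 * r < ‖μ‖) :
    HasEigenvalue (L : E →ₗ[ℂ] E) μ ∧ (∀ᶠ z in 𝓝[≠] μ, z ∉ spectrum ℂ L) ∧
      FiniteDimensional ℂ (maxGenEigenspace (L : E →ₗ[ℂ] E) μ) := by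
  have hμ0 : 0 < ‖μ‖ := by linarith
  refine ⟨hasEigenvalue_of_mem_spectrum hr hr0 hμ0 hμ.le hs, ?_,
    finiteDimensional_maxGenEigenspace hr hr0 hμ0 hμ.le⟩
  -- Near μ every modulus exceeds ρ, and only finitely many eigenvalues have modulus at least ρ.
  obtain ⟨ρ, hρ1, hρ2⟩ := exists_between hμ
  have hρ0 : 0 < ρ := by linarith
  have hfin := finite_eigenvalues hr hr0 hρ0 hρ1.le
  have h1 : ∀ᶠ z in 𝓝[≠] μ, z ∉ {μ : ℂ | ρ ≤ ‖μ‖ ∧ HasEigenvalue (L : E →ₗ[ℂ] E) μ} := by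
    have := (hfin.subset (sdiff_subset (t := {μ}))).isClosed.isOpen_compl.mem_nhds
      (x := μ) (by simp)
    filter_upwards [nhdsWithin_le_nhds this, self_mem_nhdsWithin] with z hz hzμ hmem
    exact hz ⟨hmem, hzμ⟩
  have h2 : ∀ᶠ z in 𝓝[≠] μ, ρ < ‖z‖ :=
    nhdsWithin_le_nhds (continuous_norm.continuousAt.eventually (lt_mem_nhds hρ2))
  filter_upwards [h1, h2] with z hz1 hz2 hz
  exact hz1 ⟨hz2.le, hasEigenvalue_of_mem_spectrum hr hr0 (by linarith) (by linarith) hz⟩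

end Riesz

end StretchFold

namespace StretchFold

/-! ### Bounded measurable functions -/

/-- Bounded measurable functions on the torus. -/
def BddMeas (f : Torus → C2) : Prop := Measurable f ∧ ∃ B : ℝ, ∀ p, ‖f p‖ ≤ B

theorem BddMeas.of_lip {f : Torus → C2} (hf : f ∈ lipFun) : BddMeas f :=
  ⟨(lipFun_continuous hf).measurable, let ⟨B, _, hB⟩ := lipFun_bound hf; ⟨B, hB⟩⟩

theorem BddMeas.const_smul {f : Torus → C2} (hf : BddMeas f) (c : ℂ) : BddMeas (c • f) := by
  obtain ⟨hf, B, hB⟩ := hf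
  exact ⟨hf.const_smul c, ‖c‖ * B, fun p => by
    rw [Pi.smul_apply, norm_smul]; gcongr; exact hB p⟩

theorem BddMeas.sub {f g : Torus → C2} (hf : BddMeas f) (hg : BddMeas g) : BddMeas (f - g) := by
  obtain ⟨hf, B, hB⟩ := hf
  obtain ⟨hg, D, hD⟩ := hg
  exact ⟨hf.sub hg, B + D, fun p => (norm_sub_le _ _).trans (add_le_add (hB p) (hD p))⟩

theorem BddMeas.exists_bound {f : Torus → C2} (hf : BddMeas f) : ∃ B : ℝ, 0 < B ∧ ∀ p, ‖f p‖ ≤ B :=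
  let ⟨_, B, hB⟩ := hf
  ⟨max B 1, by positivity, fun p => (hB p).trans (le_max_left _ _)⟩

theorem BddMeas.intervalIntegrable {f : Torus → C2} (hf : BddMeas f) {γ : ℝ → Torus}
    (hγ : Measurable γ) {u : ℝ → ℂ} {a b : ℝ} (hu : ContinuousOn u (uIcc a b)) :
    IntervalIntegrable (fun t => u t • f (γ t)) volume a b := by
  obtain ⟨hfm, B, hB⟩ := hf
  obtain ⟨D, hD⟩ := isCompact_uIcc.exists_bound_of_continuousOn hu
  rw [intervalIntegrable_iff]
  have : IsFiniteMeasure (volume.restrict (uIoc a b)) := by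
    rw [uIoc]; infer_instance
  refine Integrable.of_bound (C := D * B) ?_ ?_
  · exact ((hu.mono uIoc_subset_uIcc).aestronglyMeasurable measurableSet_uIoc).smul
      (hfm.comp hγ).aestronglyMeasurable
  · filter_upwards [ae_restrict_mem measurableSet_uIoc] with t ht
    rw [norm_smul]
    exact mul_le_mul (hD t (uIoc_subset_uIcc ht)) (hB _) (norm_nonneg _)
      ((norm_nonneg _).trans (hD t (uIoc_subset_uIcc ht)))

/-! ### Test functions on intervals -/

/-- `u` is bounded by `B` and `Λ`-Lipschitz on `[a, b]`. -/
structure TestOn (a b B Λ : ℝ) (u : ℝ → ℂ) : Prop where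
  bdd : ∀ t ∈ Icc a b, ‖u t‖ ≤ B
  lip : ∀ s ∈ Icc a b, ∀ t ∈ Icc a b, ‖u s - u t‖ ≤ Λ * |s - t|

theorem TestOn.mono {a b B Λ a' b' B' Λ' : ℝ} {u : ℝ → ℂ} (h : TestOn a b B Λ u) (ha : a ≤ a')
    (hb : b' ≤ b) (hB : B ≤ B') (hΛ : Λ ≤ Λ') : TestOn a' b' B' Λ' u where
  bdd t ht := (h.bdd t (Icc_subset_Icc ha hb ht)).trans hB
  lip s hs t ht := (h.lip s (Icc_subset_Icc ha hb hs) t (Icc_subset_Icc ha hb ht)).trans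
    (by gcongr)

theorem TestOn.continuousOn {a b B Λ : ℝ} {u : ℝ → ℂ} (h : TestOn a b B Λ u) :
    ContinuousOn u (Icc a b) := by
  have : LipschitzOnWith (Real.toNNReal Λ) u (Icc a b) :=
    LipschitzOnWith.of_dist_le_mul fun s hs t ht => by
      rw [dist_eq_norm, Real.dist_eq]
      refine (h.lip s hs t ht).trans ?_
      gcongr
      exact Real.le_coe_toNNReal Λ
  exact this.continuousOn

theorem TestOn.const_mul {a b B Λ : ℝ} {u : ℝ → ℂ} (h : TestOn a b B Λ u) (c : ℂ) :
    TestOn a b (‖c‖ * B) (‖c‖ * Λ) (fun t => c * u t) where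
  bdd t ht := by rw [norm_mul]; gcongr; exact h.bdd t ht
  lip s hs t ht := by
    rw [← mul_sub, norm_mul, mul_assoc]; gcongr; exact h.lip s hs t ht

theorem TestOn.sub {a b B Λ B' Λ' : ℝ} {u v : ℝ → ℂ} (h : TestOn a b B Λ u)
    (h' : TestOn a b B' Λ' v) : TestOn a b (B + B') (Λ + Λ') (fun t => u t - v t) where
  bdd t ht := (norm_sub_le _ _).trans (add_le_add (h.bdd t ht) (h'.bdd t ht))
  lip s hs t ht := by
    rw [sub_sub_sub_comm, add_mul]
    exact (norm_sub_le _ _).trans (add_le_add (h.lip s hs t ht) (h'.lip s hs t ht))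

/-- Composition with an affine map. -/
theorem TestOn.comp {a b a' b' B Λ K : ℝ} {u : ℝ → ℂ} (h : TestOn a b B Λ u) (hΛ : 0 ≤ Λ)
    {θ : ℝ → ℝ} (hθ : ∀ t ∈ Icc a' b', θ t ∈ Icc a b)
    (hK : ∀ s ∈ Icc a' b', ∀ t ∈ Icc a' b', |θ s - θ t| ≤ K * |s - t|) :
    TestOn a' b' B (Λ * K) (fun t => u (θ t)) where
  bdd t ht := h.bdd _ (hθ t ht)
  lip s hs t ht := by
    refine (h.lip _ (hθ s hs) _ (hθ t ht)).trans ?_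
    rw [mul_assoc]; gcongr; exact hK s hs t ht

/-- Interpolation between the bound and the Lipschitz constant. -/
theorem TestOn.holder {a b B Λ q : ℝ} {u : ℝ → ℂ} (h : TestOn a b B Λ u) (hΛ : 0 ≤ Λ)
    (hq0 : 0 ≤ q) (hq1 : q ≤ 1) {s t : ℝ} (hs : s ∈ Icc a b) (ht : t ∈ Icc a b) :
    ‖u s - u t‖ ≤ (2 * B) ^ (1 - q) * Λ ^ q * |s - t| ^ q := by
  have h1 : ‖u s - u t‖ ≤ 2 * B := by
    have := norm_sub_le (u s) (u t); linarith [h.bdd s hs, h.bdd t ht]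
  have h2 := h.lip s hs t ht
  calc ‖u s - u t‖ = ‖u s - u t‖ ^ (1 - q) * ‖u s - u t‖ ^ q := by
        rw [← Real.rpow_add_of_nonneg (norm_nonneg _) (by linarith) hq0]; simp
    _ ≤ (2 * B) ^ (1 - q) * (Λ * |s - t|) ^ q := by
        gcongr
        exact Real.rpow_nonneg ((norm_nonneg _).trans h1) _
    _ = _ := by rw [Real.mul_rpow hΛ (abs_nonneg _), mul_assoc]

theorem holderNorm_le {r S B H : ℝ} {u : ℝ → ℂ} (hB0 : 0 ≤ B) (hH0 : 0 ≤ H)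
    (hB : ∀ t ∈ Icc (0 : ℝ) S, ‖u t‖ ≤ B)
    (hH : ∀ s ∈ Icc (0 : ℝ) S, ∀ t ∈ Icc (0 : ℝ) S, ‖u s - u t‖ ≤ H * |s - t| ^ r) :
    holderNorm r S u ≤ ENNReal.ofReal (B + H) := by
  rw [holderNorm, ENNReal.ofReal_add hB0 hH0]
  refine add_le_add (iSup₂_le fun t ht => ?_) (iSup₂_le fun s hs => iSup₂_le fun t ht =>
    iSup_le fun hst => ?_)
  · rw [← ofReal_norm]; exact ENNReal.ofReal_le_ofReal (hB t ht)
  · have h1 : 0 < |s - t| ^ r := Real.rpow_pos_of_pos (abs_pos.2 (sub_ne_zero.2 hst)) r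
    rw [ENNReal.div_le_iff (by simpa using h1) ENNReal.ofReal_ne_top, ← ofReal_norm,
      ← ENNReal.ofReal_mul hH0]
    exact ENNReal.ofReal_le_ofReal (hH s hs t ht)

theorem norm_le_of_holderNorm {r S M t : ℝ} {u : ℝ → ℂ} (hM : 0 ≤ M)
    (h : holderNorm r S u ≤ ENNReal.ofReal M) (ht : t ∈ Icc (0 : ℝ) S) : ‖u t‖ ≤ M := by
  have := (holder_sup_le (r := r) (u := u) ht).trans h
  rwa [← ofReal_norm, ENNReal.ofReal_le_ofReal_iff hM] at this

theorem norm_sub_le_of_holderNorm {r S M s t : ℝ} {u : ℝ → ℂ} (hM : 0 ≤ M)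
    (h : holderNorm r S u ≤ ENNReal.ofReal M) (hs : s ∈ Icc (0 : ℝ) S) (ht : t ∈ Icc (0 : ℝ) S) :
    ‖u s - u t‖ ≤ M * |s - t| ^ r := by
  have := (holder_diff_le (r := r) (u := u) hs ht).trans (mul_le_mul_left h _)
  rwa [← ofReal_norm, ← ENNReal.ofReal_mul hM, ENNReal.ofReal_le_ofReal_iff (by positivity)] at this

/-! ### Test functions on leaves -/

/-- A function of arc length is compatible with the leaf closing up to a vertical circle. -/
def Leaf.Closes {α : ℕ} (W : Leaf α) (u : ℝ → ℂ) : Prop := W.len * W.dir 1 = 1 → u 0 = u W.len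

variable {α : ℕ}

theorem Leaf.dir_sq (W : Leaf α) : W.dir 0 ^ 2 + W.dir 1 ^ 2 = 1 := by
  have := W.norm_dir
  rw [EuclideanSpace.norm_eq, Real.sqrt_eq_one] at this
  simpa [Fin.sum_univ_two] using this

theorem Leaf.dir_one_le (W : Leaf α) : W.dir 1 ≤ 1 := by
  nlinarith [W.dir_sq, sq_nonneg (W.dir 0)]

theorem Leaf.abs_dir_zero_le (W : Leaf α) : |W.dir 0| ≤ 1 :=
  abs_le_one_iff_mul_self_le_one.2 (by nlinarith [W.dir_sq, sq_nonneg (W.dir 1)])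

theorem Leaf.len_mul_dir_le (W : Leaf α) : W.len * W.dir 1 ≤ 1 :=
  mul_le_one₀ W.len_le W.dir_pos.le W.dir_one_le

theorem Leaf.zero_mem (W : Leaf α) : (0 : ℝ) ∈ Icc 0 W.len := ⟨le_rfl, W.len_pos.le⟩

theorem Leaf.len_mem (W : Leaf α) : W.len ∈ Icc 0 W.len := ⟨W.len_pos.le, le_rfl⟩

theorem Leaf.len_eq_one_of_closed (W : Leaf α) (h : W.len * W.dir 1 = 1) :
    W.len = 1 ∧ W.dir 1 = 1 ∧ W.dir 0 = 0 := by
  have h1 := W.len_le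
  have h2 := W.dir_one_le
  have h3 := W.len_pos
  have h4 := W.dir_pos
  have e1 : W.len = 1 := by nlinarith
  have e2 : W.dir 1 = 1 := by nlinarith
  refine ⟨e1, e2, ?_⟩
  have := W.dir_sq
  rw [e2] at this
  nlinarith

theorem Leaf.closes_comp_path (W : Leaf α) (φ : Torus → ℂ) : W.Closes fun t => φ (W.path t) := by
  intro h
  obtain ⟨h1, h2, h3⟩ := W.len_eq_one_of_closed h
  have : W.path 0 = W.path W.len := by
    simp only [Leaf.path, h1, h2, h3]
    simp only [mul_zero, mul_one, AddCircle.coe_zero, add_zero, AddCircle.coe_period]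
  simp only [this]

theorem Leaf.path_snd_dist (W : Leaf α) (s t : ℝ) :
    ‖(((s - t) * W.dir 1 : ℝ) : UnitAddCircle)‖ ≤ dist (W.path s) (W.path t) := by
  refine le_trans (le_of_eq ?_) (le_max_right _ _ : dist (W.path s).2 (W.path t).2 ≤ _)
  rw [dist_eq_norm, Leaf.path, Leaf.path]
  congr 1
  simp only [add_sub_add_left_eq_sub]
  rw [← AddCircle.coe_sub, sub_mul]

theorem circle_norm_lower {x : ℝ} (h0 : 0 ≤ x) (h1 : x ≤ 1) :
    min x (1 - x) ≤ ‖(x : UnitAddCircle)‖ := by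
  rw [UnitAddCircle.norm_eq]
  have : |x - round x| = min (Int.fract x) (1 - Int.fract x) := abs_sub_round_eq_min x
  rw [this]
  rcases h1.lt_or_eq with h | h
  · rw [Int.fract_eq_self.2 ⟨h0, h⟩]
  · subst h; simp

/-- A Lipschitz function of arc length on a leaf is the restriction of a Lipschitz function on the
torus. -/
theorem exists_lipschitz_extension (W : Leaf α) {u : ℝ → ℂ} {Λ : ℝ} (hΛ : 0 ≤ Λ)
    (hu : ∀ s ∈ Icc 0 W.len, ∀ t ∈ Icc 0 W.len, ‖u s - u t‖ ≤ Λ * |s - t|) (hc : W.Closes u) :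
    ∃ φ : Torus → ℂ, (∃ K : ℝ≥0, LipschitzWith K φ) ∧ ∀ t ∈ Icc 0 W.len, φ (W.path t) = u t := by
  set c := W.dir 1 with hcd
  set S := W.len with hSd
  have hc0 : 0 < c := W.dir_pos
  have hS0 : 0 < S := W.len_pos
  have hSc : S * c ≤ 1 := W.len_mul_dir_le
  obtain ⟨K, hK0, hK⟩ : ∃ K : ℝ, 0 ≤ K ∧ ∀ s ∈ Icc 0 S, ∀ t ∈ Icc 0 S, s ≤ t →
      ‖u s - u t‖ ≤ K * dist (W.path s) (W.path t) := by
    have hlow (s t : ℝ) (hs : s ∈ Icc 0 S) (ht : t ∈ Icc 0 S) (hst : s ≤ t) :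
        min ((t - s) * c) (1 - (t - s) * c) ≤ dist (W.path s) (W.path t) := by
      rw [dist_comm]
      refine (circle_norm_lower (by nlinarith) ?_).trans (W.path_snd_dist t s)
      nlinarith [hs.1, ht.2]
    have hfirst (s t : ℝ) (hs : s ∈ Icc 0 S) (ht : t ∈ Icc 0 S) (hst : s ≤ t) :
        ‖u s - u t‖ ≤ Λ / c * ((t - s) * c) := by
      refine (hu s hs t ht).trans (le_of_eq ?_)
      rw [abs_of_nonpos (by linarith)]; field_simp; ring
    -- Torus distance along the leaf is controlled from below by the vertical coordinate, on a
    -- circle. If the leaf does not close up, the way round the circle leaves a gap of at least 1 -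
    -- S c.
    rcases hSc.lt_or_eq with hlt | heq
    · have hgap : 0 < 1 - S * c := by linarith
      refine ⟨max (Λ / c) (Λ * S / (1 - S * c)), by positivity, fun s hs t ht hst => ?_⟩
      have hl := hlow s t hs ht hst
      rcases min_le_iff.1 hl with h | h
      · exact (hfirst s t hs ht hst).trans (mul_le_mul (le_max_left _ _) h
          (mul_nonneg (by linarith) hc0.le) (by positivity))
      · have h1 : ‖u s - u t‖ ≤ Λ * S := (hu s hs t ht).trans (by
          gcongr; rw [abs_of_nonpos (by linarith)]; linarith [hs.1, ht.2])
        have h2 : 1 - S * c ≤ dist (W.path s) (W.path t) := by nlinarith [hs.1, ht.2]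
        calc ‖u s - u t‖ ≤ Λ * S / (1 - S * c) * (1 - S * c) := by
              rw [div_mul_cancel₀ _ hgap.ne']; exact h1
          _ ≤ _ := mul_le_mul (le_max_right _ _) h2 hgap.le (by positivity)
    -- On a closed circle two parameters may be close across the endpoint, and then the values are
    -- compared through u 0 = u S.
    · have hper := hc heq
      refine ⟨Λ / c, by positivity, fun s hs t ht hst => ?_⟩
      rcases min_le_iff.1 (hlow s t hs ht hst) with h | h
      · exact (hfirst s t hs ht hst).trans (by gcongr)
      · have h1 : ‖u s - u t‖ ≤ Λ * s + Λ * (S - t) := by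
          have e : u s - u t = (u s - u 0) + (u S - u t) := by rw [hper]; abel
          rw [e]
          refine (norm_add_le _ _).trans (add_le_add ?_ ?_)
          · simpa [abs_of_nonneg hs.1] using hu s hs 0 W.zero_mem
          · simpa [abs_of_nonneg (sub_nonneg.2 ht.2)] using hu S W.len_mem t ht
        refine h1.trans ?_
        calc Λ * s + Λ * (S - t) = Λ / c * (S * c - (t - s) * c) := by field_simp; ring
          _ ≤ _ := by rw [heq]; gcongr
  have hK' : ∀ s ∈ Icc 0 S, ∀ t ∈ Icc 0 S, ‖u s - u t‖ ≤ K * dist (W.path s) (W.path t) := by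
    intro s hs t ht
    rcases le_total s t with h | h
    · exact hK s hs t ht h
    · rw [norm_sub_rev, dist_comm]; exact hK t ht s hs h
  -- The choice of parameter is harmless: by `hK'`, parameters of the same point carry the same
  -- value.
  set g : Torus → ℂ := fun p => u (Function.invFunOn W.path (Icc 0 S) p)
  have hg : ∀ t ∈ Icc 0 S, g (W.path t) = u t := by
    intro t ht
    have hex : ∃ s ∈ Icc 0 S, W.path s = W.path t := ⟨t, ht, rfl⟩
    have h1 := hK' _ (Function.invFunOn_mem hex) t ht
    rw [Function.invFunOn_eq hex, dist_self, mul_zero] at h1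
    exact sub_eq_zero.1 (norm_le_zero_iff.1 h1)
  have hgl : LipschitzOnWith (Real.toNNReal K) g (W.path '' Icc 0 S) := by
    refine LipschitzOnWith.of_dist_le_mul ?_
    rintro _ ⟨s, hs, rfl⟩ _ ⟨t, ht, rfl⟩
    rw [hg s hs, hg t ht, dist_eq_norm, Real.coe_toNNReal _ hK0]
    exact hK' s hs t ht
  obtain ⟨φ, hφ, hφe⟩ := hgl.extend_finite_dimension
  exact ⟨φ, ⟨_, hφ⟩, fun t ht => (hφe ⟨t, ht, rfl⟩).symm.trans (hg t ht)⟩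

theorem memLeaf_of_lipschitz {r : ℝ} (W : Leaf α) {φ : Torus → ℂ}
    (hφ : ∃ K : ℝ≥0, LipschitzWith K φ) : MemLeaf r W φ := by
  intro ε _
  refine ⟨φ, hφ, ?_⟩
  simp [leafNorm, holderNorm]

theorem integral_congr_of_eqOn {W : Leaf α} {f : Torus → C2} {u v : ℝ → ℂ}
    (h : ∀ t ∈ Icc 0 W.len, u t = v t) :
    ∫ t in (0 : ℝ)..W.len, u t • f (W.path t) = ∫ t in (0 : ℝ)..W.len, v t • f (W.path t) := by
  refine intervalIntegral.integral_congr fun t ht => ?_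
  rw [uIcc_of_le W.len_pos.le] at ht
  simp only [h t ht]

/-- Lets the norm be used with functions of arc length instead of functions on the torus. The factor
2 is due to the C¹ norm being the sum of the supremum and the Lipschitz seminorm. -/
theorem weak_use {f : Torus → C2} {A M : ℝ} (hA : weakENorm α f ≤ ENNReal.ofReal A) (hA0 : 0 ≤ A)
    (hM : 0 < M) (W : Leaf α) {u : ℝ → ℂ} (hu : TestOn 0 W.len M M u) (hc : W.Closes u) :
    ‖∫ t in (0 : ℝ)..W.len, u t • f (W.path t)‖ ≤ 2 * M * A := by
  have hn : ‖((2 * M : ℝ) : ℂ)⁻¹‖ = (2 * M)⁻¹ := by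
    rw [norm_inv, Complex.norm_real, Real.norm_of_nonneg (by positivity)]
  have hv := hu.const_mul ((2 * M : ℝ) : ℂ)⁻¹
  rw [hn, show (2 * M)⁻¹ * M = 1 / 2 by field_simp] at hv
  obtain ⟨φ, hφ, hφu⟩ := exists_lipschitz_extension W (by norm_num) hv.lip
    (fun h => by rw [hc h])
  have hnorm : leafNorm 1 W φ ≤ 1 := by
    have : ENNReal.ofReal (1 / 2 + 1 / 2) = 1 := by norm_num
    rw [← this]
    refine holderNorm_le (by norm_num) (by norm_num) (fun t ht => ?_) fun s hs t ht => ?_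
    · rw [hφu t ht]; exact hv.bdd t ht
    · rw [hφu t ht, hφu s hs, Real.rpow_one]; exact hv.lip s hs t ht
  have h0 : ‖leafIntegral W f φ‖ₑ ≤ weakENorm α f :=
    le_iSup_of_le W (le_iSup_of_le φ (le_iSup_of_le ⟨memLeaf_of_lipschitz W hφ, hnorm⟩ le_rfl))
  have h1 := h0.trans hA
  rw [← ofReal_norm, ENNReal.ofReal_le_ofReal_iff hA0, leafIntegral,
    integral_congr_of_eqOn hφu] at h1
  simp only [mul_smul] at h1
  rw [intervalIntegral.integral_smul, norm_smul, hn, inv_mul_le_iff₀ (by positivity)] at h1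
  exact h1

/-- Only the Hölder bound M enters the estimate. The Lipschitz constant Λ is qualitative: it
guarantees that the test function is the restriction of a Lipschitz function on the torus, hence
belongs to the closure. -/
theorem stable_use {P : Params} {f : Torus → C2} {A M Λ : ℝ}
    (hA : stableENorm P α f ≤ ENNReal.ofReal A) (hA0 : 0 ≤ A)
    (hM : 0 < M) (hΛ : 0 ≤ Λ) (W : Leaf α) {u : ℝ → ℂ} (hu : TestOn 0 W.len M Λ u)
    (hh : ∀ s ∈ Icc 0 W.len, ∀ t ∈ Icc 0 W.len, ‖u s - u t‖ ≤ M * |s - t| ^ P.q)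
    (hc : W.Closes u) :
    ‖∫ t in (0 : ℝ)..W.len, u t • f (W.path t)‖ ≤ 2 * M * A * W.len ^ P.σ := by
  set k := W.len ^ P.σ with hk
  have hk0 : 0 < k := Real.rpow_pos_of_pos W.len_pos _
  set m := 2 * M * k with hm
  have hm0 : 0 < m := by positivity
  have hn : ‖((m : ℝ) : ℂ)⁻¹‖ = m⁻¹ := by
    rw [norm_inv, Complex.norm_real, Real.norm_of_nonneg hm0.le]
  have hv := hu.const_mul ((m : ℝ) : ℂ)⁻¹
  rw [hn] at hv
  obtain ⟨φ, hφ, hφu⟩ := exists_lipschitz_extension W (by positivity) hv.lip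
    (fun h => by rw [hc h])
  have hnorm : leafNorm P.q W φ * ENNReal.ofReal k ≤ 1 := by
    have h1 : leafNorm P.q W φ ≤ ENNReal.ofReal (m⁻¹ * M + m⁻¹ * M) := by
      refine holderNorm_le (by positivity) (by positivity) (fun t ht => ?_) fun s hs t ht => ?_
      · rw [hφu t ht]; exact hv.bdd t ht
      · rw [hφu t ht, hφu s hs, ← mul_sub, norm_mul, hn, mul_assoc]
        gcongr; exact hh s hs t ht
    refine (mul_le_mul_left h1 _).trans ?_
    rw [← ENNReal.ofReal_mul (by positivity), ENNReal.ofReal_le_one]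
    apply le_of_eq; rw [hm]; field_simp; norm_num
  have h0 : ‖leafIntegral W f φ‖ₑ ≤ stableENorm P α f :=
    le_iSup_of_le W (le_iSup_of_le φ (le_iSup_of_le ⟨memLeaf_of_lipschitz W hφ, hnorm⟩ le_rfl))
  have h1 := h0.trans hA
  rw [← ofReal_norm, ENNReal.ofReal_le_ofReal_iff hA0, leafIntegral,
    integral_congr_of_eqOn hφu] at h1
  simp only [mul_smul] at h1
  rw [intervalIntegral.integral_smul, norm_smul, hn, inv_mul_le_iff₀ (by positivity)] at h1
  rw [hm] at h1
  linarith

/-- The test functions are required to agree in arc length, so that their d_q distance is zero and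
only the distance of the leaves matters. Functions that are merely close are handled with the help
of the stable norm in `unstable_compare`. -/
theorem unstable_use {P : Params} {f : Torus → C2} {A M δ : ℝ}
    (hA : unstableENorm P α f ≤ ENNReal.ofReal A) (hA0 : 0 ≤ A) (hM : 0 < M) (hδ : 0 < δ)
    (hδα : δ ≤ 2 / (α : ℝ)) {W₁ W₂ : Leaf α} (hd : leafDist W₁ W₂ < δ) {u₁ u₂ : ℝ → ℂ}
    (hu₁ : TestOn 0 W₁.len M M u₁) (hu₂ : TestOn 0 W₂.len M M u₂)
    (hu : ∀ t ∈ Icc 0 (min W₁.len W₂.len), u₁ t = u₂ t)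
    (hc₁ : W₁.Closes u₁) (hc₂ : W₂.Closes u₂) :
    ‖(∫ t in (0 : ℝ)..W₁.len, u₁ t • f (W₁.path t))
      - ∫ t in (0 : ℝ)..W₂.len, u₂ t • f (W₂.path t)‖ ≤ 2 * M * A * δ ^ P.β := by
  have hn : ‖((2 * M : ℝ) : ℂ)⁻¹‖ = (2 * M)⁻¹ := by
    rw [norm_inv, Complex.norm_real, Real.norm_of_nonneg (by positivity)]
  have h12 : ENNReal.ofReal (1 / 2 + 1 / 2) = 1 := by norm_num
  have real (W : Leaf α) (u : ℝ → ℂ) (hu : TestOn 0 W.len M M u) (hc : W.Closes u) :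
      ∃ φ : Torus → ℂ, MemLeaf 1 W φ ∧ leafNorm 1 W φ ≤ 1 ∧
        ∀ t ∈ Icc 0 W.len, φ (W.path t) = ((2 * M : ℝ) : ℂ)⁻¹ * u t := by
    have hv := hu.const_mul ((2 * M : ℝ) : ℂ)⁻¹
    rw [hn, show (2 * M)⁻¹ * M = 1 / 2 by field_simp] at hv
    obtain ⟨φ, hφ, hφu⟩ := exists_lipschitz_extension W (by norm_num) hv.lip
      (fun h => by rw [hc h])
    refine ⟨φ, memLeaf_of_lipschitz W hφ, ?_, hφu⟩
    rw [← h12]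
    refine holderNorm_le (by norm_num) (by norm_num) (fun t ht => ?_) fun s hs t ht => ?_
    · rw [hφu t ht]; exact hv.bdd t ht
    · rw [hφu t ht, hφu s hs, Real.rpow_one]; exact hv.lip s hs t ht
  obtain ⟨φ₁, m₁, n₁, e₁⟩ := real W₁ u₁ hu₁ hc₁
  obtain ⟨φ₂, m₂, n₂, e₂⟩ := real W₂ u₂ hu₂ hc₂
  have hz : ∀ t ∈ Icc 0 (min W₁.len W₂.len), φ₁ (W₁.path t) - φ₂ (W₂.path t) = 0 := by
    intro t ht
    rw [e₁ t ⟨ht.1, ht.2.trans (min_le_left _ _)⟩, e₂ t ⟨ht.1, ht.2.trans (min_le_right _ _)⟩,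
      hu t ht, sub_self]
  have htest : testDist P.q W₁ W₂ φ₁ φ₂ < ENNReal.ofReal δ := by
    refine lt_of_le_of_lt (b := ENNReal.ofReal (0 + 0)) ?_ (by simpa using hδ)
    refine holderNorm_le le_rfl le_rfl (fun t ht => ?_) fun s hs t ht => ?_
    · rw [hz t ht, norm_zero]
    · rw [hz t ht, hz s hs]; simp
  have h0 : ‖leafIntegral W₁ f φ₁ - leafIntegral W₂ f φ₂‖ₑ / ENNReal.ofReal (δ ^ P.β)
      ≤ unstableENorm P α f :=
    le_iSup_of_le δ <| le_iSup_of_le W₁ <| le_iSup_of_le W₂ <| le_iSup_of_le φ₁ <|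
      le_iSup_of_le φ₂ <| le_iSup_of_le ⟨hδ, hδα, hd, m₁, m₂, n₁, n₂, htest⟩ le_rfl
  have h1 := h0.trans hA
  have hδβ : 0 < δ ^ P.β := Real.rpow_pos_of_pos hδ _
  rw [ENNReal.div_le_iff (by simpa using hδβ) ENNReal.ofReal_ne_top, ← ofReal_norm,
    ← ENNReal.ofReal_mul hA0, ENNReal.ofReal_le_ofReal_iff (by positivity), leafIntegral,
    leafIntegral, integral_congr_of_eqOn e₁, integral_congr_of_eqOn e₂] at h1
  simp only [mul_smul] at h1
  rw [intervalIntegral.integral_smul, intervalIntegral.integral_smul, ← smul_sub, norm_smul, hn,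
    inv_mul_le_iff₀ (by positivity)] at h1
  linarith

theorem testOn_of_leafNorm {W : Leaf α} {φ : Torus → ℂ} (h : leafNorm 1 W φ ≤ 1) :
    TestOn 0 W.len 1 1 (fun t => φ (W.path t)) where
  bdd t ht := leafNorm_one_bound h ht
  lip s hs t ht := by
    have := norm_sub_le_of_holderNorm (r := 1) (u := fun t => φ (W.path t)) zero_le_one
      (by rw [ENNReal.ofReal_one]; exact h) hs ht
    rwa [Real.rpow_one] at this

theorem weak_intro {f : Torus → C2} {A : ℝ}
    (h : ∀ (W : Leaf α) (u : ℝ → ℂ), TestOn 0 W.len 1 1 u → W.Closes u →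
      ‖∫ t in (0 : ℝ)..W.len, u t • f (W.path t)‖ ≤ A) :
    weakENorm α f ≤ ENNReal.ofReal A := by
  refine iSup_le fun W => iSup_le fun φ => iSup_le fun hφ => ?_
  rw [← ofReal_norm]
  exact ENNReal.ofReal_le_ofReal (h W _ (testOn_of_leafNorm hφ.2) (W.closes_comp_path φ))

/-- To bound the norm from above it is enough to retain the supremum part of the d_q condition, the
Hölder part being recoverable by interpolation with the Lipschitz bounds. -/
theorem unstable_intro {P : Params} {f : Torus → C2} {A : ℝ} (hA0 : 0 ≤ A)
    (h : ∀ (δ : ℝ) (W₁ W₂ : Leaf α) (u₁ u₂ : ℝ → ℂ), 0 < δ → δ ≤ 2 / (α : ℝ) →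
      leafDist W₁ W₂ < δ → TestOn 0 W₁.len 1 1 u₁ → TestOn 0 W₂.len 1 1 u₂ → W₁.Closes u₁ →
      W₂.Closes u₂ → (∀ t ∈ Icc 0 (min W₁.len W₂.len), ‖u₁ t - u₂ t‖ ≤ δ) →
      ‖(∫ t in (0 : ℝ)..W₁.len, u₁ t • f (W₁.path t))
        - ∫ t in (0 : ℝ)..W₂.len, u₂ t • f (W₂.path t)‖ ≤ A * δ ^ P.β) :
    unstableENorm P α f ≤ ENNReal.ofReal A := by
  refine iSup_le fun δ => iSup_le fun W₁ => iSup_le fun W₂ => iSup_le fun φ₁ => iSup_le fun φ₂ =>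
    iSup_le fun hp => ?_
  have hδβ : 0 < δ ^ P.β := Real.rpow_pos_of_pos hp.pos _
  rw [ENNReal.div_le_iff (by simpa using hδβ) ENNReal.ofReal_ne_top, ← ofReal_norm,
    ← ENNReal.ofReal_mul hA0]
  exact ENNReal.ofReal_le_ofReal (h δ W₁ W₂ _ _ hp.pos hp.le hp.dist_lt
    (testOn_of_leafNorm hp.norm₁) (testOn_of_leafNorm hp.norm₂) (W₁.closes_comp_path φ₁)
    (W₂.closes_comp_path φ₂) fun t ht => norm_le_of_holderNorm (r := P.q)
      (u := fun t => φ₁ (W₁.path t) - φ₂ (W₂.path t)) hp.pos.le hp.test_lt.le ht)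

/-- A test function in the closure is approximated by a Lipschitz one in the C^q norm; as f is
bounded, the integral changes little. Lipschitz test functions therefore suffice. -/
theorem stable_intro {P : Params} {f : Torus → C2} (hf : BddMeas f) {A : ℝ} (hA0 : 0 ≤ A)
    (h : ∀ (W : Leaf α) (u : ℝ → ℂ) (M Λ : ℝ), 0 < M → 0 ≤ Λ → TestOn 0 W.len M Λ u →
      (∀ s ∈ Icc 0 W.len, ∀ t ∈ Icc 0 W.len, ‖u s - u t‖ ≤ M * |s - t| ^ P.q) →
      W.Closes u → M * W.len ^ P.σ ≤ 2 →
      ‖∫ t in (0 : ℝ)..W.len, u t • f (W.path t)‖ ≤ A * (M * W.len ^ P.σ)) :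
    stableENorm P α f ≤ ENNReal.ofReal A := by
  refine iSup_le fun W => iSup_le fun φ => iSup_le fun hφ => ?_
  obtain ⟨B, hB0, hB⟩ := hf.exists_bound
  rw [← ofReal_norm]
  refine ENNReal.ofReal_le_ofReal ?_
  set k := W.len ^ P.σ with hk
  have hk0 : 0 < k := Real.rpow_pos_of_pos W.len_pos _
  have hk1 : k ≤ 1 := Real.rpow_le_one W.len_pos.le W.len_le P.σ_pos.le
  have hφM : leafNorm P.q W φ ≤ ENNReal.ofReal k⁻¹ := by
    rw [ENNReal.ofReal_inv_of_pos hk0]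
    exact ENNReal.le_inv_iff_mul_le.2 hφ.2
  refine le_of_forall_pos_le_add fun e he => ?_
  -- The approximation costs at most ε B in the integral and ε A in the norm of the test function.
  set ε := min 1 (e / (A + B)) with hε
  have hε0 : 0 < ε := by positivity
  have hε1 : ε ≤ 1 := min_le_left _ _
  have hε2 : ε * (A + B) ≤ e := by
    have := min_le_right 1 (e / (A + B))
    rwa [← hε, le_div_iff₀ (by positivity)] at this
  obtain ⟨ψ, hψ, hd⟩ := hφ.1 (ENNReal.ofReal ε) (by simpa using hε0)
  have hd1 : ∀ t ∈ Icc 0 W.len, ‖φ (W.path t) - ψ (W.path t)‖ ≤ ε := fun t ht =>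
    norm_le_of_holderNorm (r := P.q) (u := fun t => φ (W.path t) - ψ (W.path t)) hε0.le hd ht
  have hM0 : 0 < k⁻¹ + ε := by positivity
  obtain ⟨K, hK⟩ := hψ
  have hψK : ∀ s t : ℝ, ‖ψ (W.path s) - ψ (W.path t)‖ ≤ 1 * K * |s - t| := by
    intro s t
    rw [← dist_eq_norm, one_mul]
    refine (hK.dist_le_mul _ _).trans ?_
    gcongr
    rw [Prod.dist_eq]
    have hc (i : Fin 2) (x : UnitAddCircle) (hi : |W.dir i| ≤ 1) :
        dist (x + ((s * W.dir i : ℝ) : UnitAddCircle)) (x + ((t * W.dir i : ℝ) : UnitAddCircle))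
          ≤ |s - t| := by
      rw [dist_eq_norm, add_sub_add_left_eq_sub, ← AddCircle.coe_sub, ← sub_mul]
      refine (circle_norm_coe_le _).trans ?_
      rw [abs_mul]
      exact mul_le_of_le_one_right (abs_nonneg _) hi
    exact max_le (hc 0 _ W.abs_dir_zero_le)
      (hc 1 _ (by rw [abs_of_pos W.dir_pos]; exact W.dir_one_le))
  have h1 := h W (fun t => ψ (W.path t)) (k⁻¹ + ε) (1 * K) hM0 (by positivity)
    ⟨fun t ht => ?_, fun s _ t _ => hψK s t⟩ (fun s hs t ht => ?_) (W.closes_comp_path ψ) ?_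
  · have hφi : IntervalIntegrable (fun t => φ (W.path t) • f (W.path t)) volume 0 W.len :=
      hf.intervalIntegrable W.continuous_path.measurable (by
        rw [uIcc_of_le W.len_pos.le]
        exact holder_continuousOn P.q_pos (ne_top_of_le_ne_top ENNReal.ofReal_ne_top hφM))
    have hψi : IntervalIntegrable (fun t => ψ (W.path t) • f (W.path t)) volume 0 W.len :=
      hf.intervalIntegrable W.continuous_path.measurable
        (hK.continuous.comp W.continuous_path).continuousOn
    have h2 : ‖leafIntegral W f φ - ∫ t in (0 : ℝ)..W.len, ψ (W.path t) • f (W.path t)‖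
        ≤ ε * B := by
      rw [leafIntegral, ← intervalIntegral.integral_sub hφi hψi]
      refine (intervalIntegral.norm_integral_le_of_norm_le_const (C := ε * B) fun t ht => ?_).trans ?_
      · rw [uIoc_of_le W.len_pos.le] at ht
        rw [← sub_smul, norm_smul]
        exact mul_le_mul (hd1 t ⟨ht.1.le, ht.2⟩) (hB _) (norm_nonneg _) hε0.le
      · rw [sub_zero, abs_of_pos W.len_pos]
        exact mul_le_of_le_one_right (by positivity) W.len_le
    have h3 := norm_le_norm_add_norm_sub' (leafIntegral W f φ)
      (∫ t in (0 : ℝ)..W.len, ψ (W.path t) • f (W.path t))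
    have h4 : (k⁻¹ + ε) * k ≤ 1 + ε := by
      rw [add_mul, inv_mul_cancel₀ hk0.ne']; nlinarith
    nlinarith
  · have a1 := norm_le_of_holderNorm (r := P.q) (u := fun t => φ (W.path t)) (by positivity) hφM ht
    have a2 := norm_sub_norm_le (ψ (W.path t)) (φ (W.path t))
    rw [norm_sub_rev] at a2
    linarith [hd1 t ht]
  · have a1 := norm_sub_le_of_holderNorm (r := P.q) (u := fun t => φ (W.path t))
      (by positivity) hφM hs ht
    have a2 := norm_sub_le_of_holderNorm (r := P.q) (u := fun t => φ (W.path t) - ψ (W.path t))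
      hε0.le hd hs ht
    have e : ψ (W.path s) - ψ (W.path t) = (φ (W.path s) - φ (W.path t))
      - (φ (W.path s) - ψ (W.path s) - (φ (W.path t) - ψ (W.path t))) := by ring
    simp only [e]
    refine (norm_sub_le _ _).trans ?_
    rw [add_mul]; exact add_le_add a1 a2
  · rw [add_mul, inv_mul_cancel₀ hk0.ne']; nlinarith

end StretchFold

namespace StretchFold

/-! ### Leaves as graphs over the vertical coordinate -/

variable {α : ℕ}

/-- The point at height `z` of the graph `x = c + κ z`. -/
noncomputable def graphPt (c κ z : ℝ) : Torus := (((c + κ * z : ℝ) : UnitAddCircle), (z : UnitAddCircle))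

theorem continuous_graphPt (c κ : ℝ) : Continuous (graphPt c κ) :=
  ((AddCircle.continuous_mk' (1 : ℝ)).comp (by fun_prop)).prodMk (AddCircle.continuous_mk' (1 : ℝ))

/-- The length of the vector `(κ, 1)`. -/
noncomputable def slopeLen (κ : ℝ) : ℝ := Real.sqrt (1 + κ ^ 2)

theorem slopeLen_sq (κ : ℝ) : slopeLen κ ^ 2 = 1 + κ ^ 2 := Real.sq_sqrt (by positivity)

theorem one_le_slopeLen (κ : ℝ) : 1 ≤ slopeLen κ := Real.one_le_sqrt.2 (by nlinarith [sq_nonneg κ])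

theorem slopeLen_pos (κ : ℝ) : 0 < slopeLen κ := one_pos.trans_le (one_le_slopeLen κ)

theorem slopeLen_le {κ : ℝ} (hκ : |κ| ≤ 1) : slopeLen κ ≤ 3 / 2 := by
  refine Real.sqrt_le_iff.2 ⟨by norm_num, ?_⟩
  have := (sq_le_one_iff_abs_le_one κ).2 hκ
  norm_num; linarith

theorem abs_slopeLen_sub_le (κ₁ κ₂ : ℝ) : |slopeLen κ₁ - slopeLen κ₂| ≤ |κ₁ - κ₂| := by
  have h1 := one_le_slopeLen κ₁
  have h2 := one_le_slopeLen κ₂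
  have e : (slopeLen κ₁ - slopeLen κ₂) * (slopeLen κ₁ + slopeLen κ₂) = (κ₁ - κ₂) * (κ₁ + κ₂) := by
    nlinarith [slopeLen_sq κ₁, slopeLen_sq κ₂]
  have b (κ : ℝ) : |κ| ≤ slopeLen κ := Real.abs_le_sqrt (by linarith)
  have h3 : |κ₁ + κ₂| ≤ slopeLen κ₁ + slopeLen κ₂ :=
    (abs_add_le _ _).trans (add_le_add (b κ₁) (b κ₂))
  have h4 := congrArg abs e
  rw [abs_mul, abs_mul, abs_of_pos (show 0 < slopeLen κ₁ + slopeLen κ₂ by linarith)] at h4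
  have h5 : |slopeLen κ₁ - slopeLen κ₂| * (slopeLen κ₁ + slopeLen κ₂)
      ≤ |κ₁ - κ₂| * (slopeLen κ₁ + slopeLen κ₂) := by rw [h4]; gcongr
  exact le_of_mul_le_mul_right h5 (by linarith)

/-- The leaf parametrizing the part over `[a, b]` of the graph `x = c + κ z`. -/
noncomputable def graphLeaf {κ a b : ℝ} (hκ : |κ| ≤ 2 * (α : ℝ)⁻¹) (hκ1 : |κ| ≤ 1) (hab : a < b)
    (hb : b - a ≤ 1 / 2) (c : ℝ) : Leaf α where
  base := graphPt c κ a
  dir := !₂[κ / slopeLen κ, 1 / slopeLen κ]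
  len := (b - a) * slopeLen κ
  norm_dir := by
    rw [EuclideanSpace.norm_eq, Real.sqrt_eq_one]
    have := slopeLen_sq κ
    have := slopeLen_pos κ
    simp [Fin.sum_univ_two]
    field_simp
    linarith
  cone := by
    have := slopeLen_pos κ
    simp only [Matrix.cons_val_zero, Matrix.cons_val_one, abs_div, abs_of_pos this, abs_one]
    rw [← mul_div_assoc, mul_one]
    gcongr
  dir_pos := by simpa using slopeLen_pos κ
  len_pos := mul_pos (by linarith) (slopeLen_pos κ)
  -- Half a unit of height times a slope factor of at most 3/2 is at most 3/4. Such a leaf thus has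
  -- length less than one and never closes up.
  len_le := by nlinarith [slopeLen_le hκ1, slopeLen_pos κ]
  base_eq := fun _ h => by nlinarith [slopeLen_le hκ1, slopeLen_pos κ]

section graphLeaf

variable {κ a b : ℝ} (hκ : |κ| ≤ 2 * (α : ℝ)⁻¹) (hκ1 : |κ| ≤ 1) (hab : a < b)
  (hb : b - a ≤ 1 / 2) (c : ℝ)

theorem graphLeaf_len : (graphLeaf hκ hκ1 hab hb c).len = (b - a) * slopeLen κ := rfl

theorem graphLeaf_path (t : ℝ) :
    (graphLeaf hκ hκ1 hab hb c).path t = graphPt c κ (a + t / slopeLen κ) := by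
  simp only [Leaf.path, graphLeaf, graphPt]
  ext
  · simp only [Matrix.cons_val_zero]
    rw [← AddCircle.coe_add]; congr 1; ring
  · simp only [Matrix.cons_val_one]
    rw [← AddCircle.coe_add]; congr 1; simp [div_eq_mul_inv]

theorem graphLeaf_closes (u : ℝ → ℂ) : (graphLeaf hκ hκ1 hab hb c).Closes u := by
  intro h
  have := slopeLen_pos κ
  simp only [graphLeaf, PiLp.toLp_apply, Matrix.cons_val_one] at h
  simp only [Matrix.cons_val_fin_one] at h
  rw [mul_assoc, mul_one_div_cancel this.ne'] at h
  linarith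

theorem graphLeaf_mapsTo {t : ℝ} (ht : t ∈ Icc 0 (graphLeaf hκ hκ1 hab hb c).len) :
    a + t / slopeLen κ ∈ Icc a b := by
  have h0 := slopeLen_pos κ
  rw [graphLeaf_len] at ht
  have : t / slopeLen κ ≤ b - a := (div_le_iff₀ h0).2 ht.2
  exact ⟨by have := div_nonneg ht.1 h0.le; linarith, by linarith⟩

theorem integral_graphLeaf (f : Torus → C2) (u : ℝ → ℂ) :
    ∫ t in (0 : ℝ)..(graphLeaf hκ hκ1 hab hb c).len,
        u (a + t / slopeLen κ) • f ((graphLeaf hκ hκ1 hab hb c).path t)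
      = slopeLen κ • ∫ z in a..b, u z • f (graphPt c κ z) := by
  simp only [graphLeaf_path]
  rw [intervalIntegral.integral_comp_add_div (fun z => u z • f (graphPt c κ z)) (slopeLen_pos κ).ne',
    graphLeaf_len, zero_div, add_zero, mul_div_cancel_right₀ _ (slopeLen_pos κ).ne',
    add_sub_cancel]

theorem integral_graphLeaf' (f : Torus → C2) (v : ℝ → ℂ) :
    ∫ t in (0 : ℝ)..(graphLeaf hκ hκ1 hab hb c).len,
        v t • f ((graphLeaf hκ hκ1 hab hb c).path t)
      = slopeLen κ • ∫ z in a..b, v ((z - a) * slopeLen κ) • f (graphPt c κ z) := by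
  rw [← integral_graphLeaf hκ hκ1 hab hb c f (fun z => v ((z - a) * slopeLen κ))]
  refine intervalIntegral.integral_congr fun t _ => ?_
  simp only [add_sub_cancel_left, div_mul_cancel₀ _ (slopeLen_pos κ).ne']

theorem graphLeaf_testOn {B Λ : ℝ} (hΛ : 0 ≤ Λ) {u : ℝ → ℂ} (hu : TestOn a b B Λ u) :
    TestOn 0 (graphLeaf hκ hκ1 hab hb c).len B Λ (fun t => u (a + t / slopeLen κ)) := by
  have := hu.comp hΛ (a' := 0) (b' := (graphLeaf hκ hκ1 hab hb c).len) (K := 1)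
    (θ := fun t => a + t / slopeLen κ) (fun t ht => graphLeaf_mapsTo hκ hκ1 hab hb c ht) ?_
  · rwa [mul_one] at this
  · intro s _ t _
    rw [add_sub_add_left_eq_sub, ← sub_div, abs_div, abs_of_pos (slopeLen_pos κ), one_mul]
    exact div_le_self (abs_nonneg _) (one_le_slopeLen κ)

variable {f : Torus → C2} {A : ℝ} {P : Params}

include hκ hκ1 hb in
theorem graph_weak (hA : weakENorm α f ≤ ENNReal.ofReal A) (hA0 : 0 ≤ A) (hab : a ≤ b) {M : ℝ}
    (hM : 0 < M) {u : ℝ → ℂ} (hu : TestOn a b M M u) :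
    ‖∫ z in a..b, u z • f (graphPt c κ z)‖ ≤ 2 * M * A := by
  rcases hab.eq_or_lt with rfl | hab
  · simp; positivity
  have h := weak_use hA hA0 hM (graphLeaf hκ hκ1 hab hb c)
    (graphLeaf_testOn hκ hκ1 hab hb c hM.le hu) (graphLeaf_closes hκ hκ1 hab hb c _)
  rw [integral_graphLeaf, norm_smul, Real.norm_of_nonneg (slopeLen_pos κ).le] at h
  exact (le_mul_of_one_le_left (norm_nonneg _) (one_le_slopeLen κ)).trans h

include hκ hκ1 hb in
theorem graph_stable (hA : stableENorm P α f ≤ ENNReal.ofReal A) (hA0 : 0 ≤ A) (hab : a ≤ b)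
    {M Λ : ℝ} (hM : 0 < M) (hΛ : 0 ≤ Λ) {u : ℝ → ℂ} (hu : TestOn a b M Λ u)
    (hh : ∀ s ∈ Icc a b, ∀ t ∈ Icc a b, ‖u s - u t‖ ≤ M * |s - t| ^ P.q) :
    ‖∫ z in a..b, u z • f (graphPt c κ z)‖ ≤ 2 * M * A * (b - a) ^ P.σ := by
  rcases hab.eq_or_lt with rfl | hab
  · simp [Real.zero_rpow P.σ_pos.ne']
  have hq := P.q_pos
  have h := stable_use hA hA0 hM hΛ (graphLeaf hκ hκ1 hab hb c)
    (graphLeaf_testOn hκ hκ1 hab hb c hΛ hu) (fun s hs t ht => ?_)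
    (graphLeaf_closes hκ hκ1 hab hb c _)
  · rw [integral_graphLeaf, norm_smul, Real.norm_of_nonneg (slopeLen_pos κ).le, graphLeaf_len,
      Real.mul_rpow (by linarith) (slopeLen_pos κ).le] at h
    have h1 : slopeLen κ ^ P.σ ≤ slopeLen κ := by
      conv_rhs => rw [← Real.rpow_one (slopeLen κ)]
      exact Real.rpow_le_rpow_of_exponent_le (one_le_slopeLen κ) P.σ_lt.le
    have h2 : 0 ≤ 2 * M * A * (b - a) ^ P.σ :=
      mul_nonneg (by positivity) (Real.rpow_nonneg (by linarith) _)
    have h3 : slopeLen κ * ‖∫ z in a..b, u z • f (graphPt c κ z)‖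
        ≤ slopeLen κ * (2 * M * A * (b - a) ^ P.σ) := by nlinarith
    exact le_of_mul_le_mul_left h3 (slopeLen_pos κ)
  · refine (hh _ (graphLeaf_mapsTo hκ hκ1 hab hb c hs) _
      (graphLeaf_mapsTo hκ hκ1 hab hb c ht)).trans ?_
    rw [add_sub_add_left_eq_sub, ← sub_div, abs_div, abs_of_pos (slopeLen_pos κ)]
    gcongr
    · exact div_nonneg (abs_nonneg _) (slopeLen_pos κ).le
    · exact div_le_self (abs_nonneg _) (one_le_slopeLen κ)

include hκ hκ1 hb in
theorem graph_stable_interp (hA : stableENorm P α f ≤ ENNReal.ofReal A) (hA0 : 0 ≤ A)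
    (hab : a ≤ b) {B Λ : ℝ} (hB : 0 < B) (hΛ : 0 ≤ Λ) {u : ℝ → ℂ} (hu : TestOn a b B Λ u) :
    ‖∫ z in a..b, u z • f (graphPt c κ z)‖
      ≤ 2 * (B + (2 * B) ^ (1 - P.q) * Λ ^ P.q) * A * (b - a) ^ P.σ := by
  have h0 : 0 ≤ (2 * B) ^ (1 - P.q) * Λ ^ P.q := by positivity
  refine graph_stable hκ hκ1 hb c hA hA0 hab (by positivity) hΛ
    (hu.mono le_rfl le_rfl (by linarith) le_rfl) fun s hs t ht => ?_
  refine (hu.holder hΛ P.q_pos.le P.q_lt.le hs ht).trans ?_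
  gcongr
  linarith

end graphLeaf

theorem graphLeaf_dist_lt {κ₁ κ₂ a b c₁ c₂ ε : ℝ} (hκ₁ : |κ₁| ≤ 2 * (α : ℝ)⁻¹)
    (hκ₁' : |κ₁| ≤ 1) (hκ₂ : |κ₂| ≤ 2 * (α : ℝ)⁻¹) (hκ₂' : |κ₂| ≤ 1) (hab : a < b)
    (hb : b - a ≤ 1 / 2) (hε : 0 < ε) (hc : |c₁ + κ₁ * a - (c₂ + κ₂ * a)| ≤ ε)
    (hκ : |κ₁ - κ₂| ≤ ε) :
    leafDist (graphLeaf hκ₁ hκ₁' hab hb c₁) (graphLeaf hκ₂ hκ₂' hab hb c₂) < 5 * ε := by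
  have h1 := one_le_slopeLen κ₁
  have h2 := one_le_slopeLen κ₂
  have hs := (abs_slopeLen_sub_le κ₁ κ₂).trans hκ
  have hinv : |1 / slopeLen κ₁ - 1 / slopeLen κ₂| ≤ ε := by
    rw [div_sub_div _ _ (by positivity) (by positivity), one_mul, mul_one, abs_div, abs_sub_comm,
      abs_of_pos (by positivity : 0 < slopeLen κ₁ * slopeLen κ₂)]
    exact (div_le_self (abs_nonneg _) (one_le_mul_of_one_le_of_one_le h1 h2)).trans hs
  have hrat : |κ₁ / slopeLen κ₁ - κ₂ / slopeLen κ₂| ≤ 2 * ε := by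
    have e : κ₁ / slopeLen κ₁ - κ₂ / slopeLen κ₂
        = (κ₁ - κ₂) * (1 / slopeLen κ₁) + κ₂ * (1 / slopeLen κ₁ - 1 / slopeLen κ₂) := by ring
    rw [e]
    refine (abs_add_le _ _).trans ?_
    rw [abs_mul, abs_mul, abs_of_pos (by positivity : 0 < 1 / slopeLen κ₁)]
    have : 1 / slopeLen κ₁ ≤ 1 := (div_le_one (by linarith)).2 h1
    nlinarith [abs_nonneg (κ₁ - κ₂), abs_nonneg κ₂, abs_nonneg (1 / slopeLen κ₁ - 1 / slopeLen κ₂)]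
  have hbase : torusDist (graphPt c₁ κ₁ a) (graphPt c₂ κ₂ a) ≤ ε := by
    refine Real.sqrt_le_iff.2 ⟨hε.le, ?_⟩
    have : ‖(graphPt c₁ κ₁ a).1 - (graphPt c₂ κ₂ a).1‖ ≤ ε := by
      rw [graphPt, graphPt, ← AddCircle.coe_sub]
      exact (circle_norm_coe_le _).trans hc
    have e : ‖(graphPt c₁ κ₁ a).2 - (graphPt c₂ κ₂ a).2‖ = 0 := by simp [graphPt]
    rw [e]
    nlinarith [norm_nonneg ((graphPt c₁ κ₁ a).1 - (graphPt c₂ κ₂ a).1)]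
  have hdir : ‖(!₂[κ₁ / slopeLen κ₁, 1 / slopeLen κ₁] : EuclideanSpace ℝ (Fin 2))
      - !₂[κ₂ / slopeLen κ₂, 1 / slopeLen κ₂]‖ ≤ 3 * ε := by
    rw [EuclideanSpace.norm_eq]
    refine Real.sqrt_le_iff.2 ⟨by positivity, ?_⟩
    simp only [Fin.sum_univ_two, PiLp.sub_apply, Matrix.cons_val_zero,
      Matrix.cons_val_one, Matrix.cons_val_fin_one, Real.norm_eq_abs]
    nlinarith [abs_nonneg (κ₁ / slopeLen κ₁ - κ₂ / slopeLen κ₂),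
      abs_nonneg (1 / slopeLen κ₁ - 1 / slopeLen κ₂)]
  have hlen : |(b - a) * slopeLen κ₁ - (b - a) * slopeLen κ₂| ≤ 1 / 2 * ε := by
    rw [← mul_sub, abs_mul, abs_of_pos (by linarith)]
    exact mul_le_mul hb hs (abs_nonneg _) (by norm_num)
  have : leafDist (graphLeaf hκ₁ hκ₁' hab hb c₁) (graphLeaf hκ₂ hκ₂' hab hb c₂)
      ≤ ε + 3 * ε + 1 / 2 * ε := add_le_add (add_le_add hbase hdir) hlen
  linarith

/-- Comparison of the integrals of one test function over two nearby graphs. -/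
theorem graph_unstable {P : Params} {f : Torus → C2} (hf : BddMeas f) {Au As : ℝ}
    (hAu : unstableENorm P α f ≤ ENNReal.ofReal Au) (hAu0 : 0 ≤ Au)
    (hAs : stableENorm P α f ≤ ENNReal.ofReal As) (hAs0 : 0 ≤ As)
    {κ₁ κ₂ a b c₁ c₂ ε Λ : ℝ} (hκ₁ : |κ₁| ≤ 2 * (α : ℝ)⁻¹)
    (hκ₁' : |κ₁| ≤ 1) (hκ₂ : |κ₂| ≤ 2 * (α : ℝ)⁻¹) (hκ₂' : |κ₂| ≤ 1) (hab : a ≤ b)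
    (hb : b - a ≤ 1 / 2) (hε : 0 < ε) (hεα : 5 * ε ≤ 2 / (α : ℝ)) (hε1 : ε ≤ 1)
    (hc : |c₁ + κ₁ * a - (c₂ + κ₂ * a)| ≤ ε)
    (hκ : |κ₁ - κ₂| ≤ ε) {u : ℝ → ℂ} (hΛ : 0 ≤ Λ) (hΛ1 : Λ ≤ 1) (hu : TestOn a b 1 Λ u) :
    ‖(∫ z in a..b, u z • f (graphPt c₁ κ₁ z)) - ∫ z in a..b, u z • f (graphPt c₂ κ₂ z)‖
      ≤ 2 * Au * (5 * ε) ^ P.β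
        + 2 * As * (2 * ε + (4 * ε) ^ (1 - P.q) * (5 * Λ) ^ P.q) := by
  have hq1 := P.q_lt
  rcases hab.eq_or_lt with rfl | hab
  · simp; positivity
  set W₁ := graphLeaf hκ₁ hκ₁' hab hb c₁
  set W₂ := graphLeaf hκ₂ hκ₂' hab hb c₂
  have h1 := one_le_slopeLen κ₁
  have h2 := one_le_slopeLen κ₂
  have hs := (abs_slopeLen_sub_le κ₂ κ₁).trans ((abs_sub_comm _ _).trans_le hκ)
  set ρ₁ := slopeLen κ₁
  set ρ₂ := slopeLen κ₂
  -- One function of height becomes two different functions of arc length when the slopes differ.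
  -- The arc-length version on the first leaf is used on both, truncated at height b in case the
  -- second leaf is longer; the discrepancy on the second leaf goes to the stable norm.
  set v : ℝ → ℂ := fun t => u (min b (a + t / ρ₁))
  have hu1 : TestOn a b 1 1 u := hu.mono le_rfl le_rfl le_rfl hΛ1
  have hv : ∀ S, TestOn 0 S 1 1 v := by
    intro S
    have := hu1.comp zero_le_one (a' := 0) (b' := S) (K := 1)
      (θ := fun t => min b (a + t / ρ₁)) (fun t ht => ⟨le_min hab.le ?_, min_le_left _ _⟩) ?_
    · rwa [mul_one] at this
    · have := div_nonneg ht.1 (by linarith : 0 ≤ ρ₁); linarith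
    · intro s _ t _
      refine (abs_min_sub_min_le_max _ _ _ _).trans ?_
      rw [sub_self, abs_zero, add_sub_add_left_eq_sub, ← sub_div, abs_div, one_mul,
        abs_of_pos (by linarith : 0 < ρ₁)]
      exact max_le (abs_nonneg _) (div_le_self (abs_nonneg _) h1)
  have hU := unstable_use hAu hAu0 one_pos (by positivity) hεα (W₁ := W₁) (W₂ := W₂)
    (graphLeaf_dist_lt hκ₁ hκ₁' hκ₂ hκ₂' hab hb hε hc hκ) (hv _) (hv _) (fun t _ => rfl)
    (graphLeaf_closes hκ₁ hκ₁' hab hb c₁ _) (graphLeaf_closes hκ₂ hκ₂' hab hb c₂ _)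
  rw [integral_graphLeaf', integral_graphLeaf'] at hU
  set lam := ρ₂ / ρ₁ with hlam
  have hlam0 : 0 < lam := by positivity
  have hlam1 : |lam - 1| ≤ ε := by
    rw [hlam, div_sub_one (by positivity), abs_div, abs_of_pos (by linarith : 0 < ρ₁)]
    exact (div_le_self (abs_nonneg _) h1).trans hs
  have hlam2 : lam ≤ 2 := by linarith [le_abs_self (lam - 1)]
  have hθ : ∀ z ∈ Icc a b, min b (a + (z - a) * ρ₂ / ρ₁) ∈ Icc a b := fun z hz =>
    ⟨le_min hab.le (by
      have : 0 ≤ (z - a) * ρ₂ / ρ₁ := div_nonneg (mul_nonneg (by linarith [hz.1]) (by linarith))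
        (by linarith)
      linarith), min_le_left _ _⟩
  -- The supremum is ε from the ratio of the arc-length factors plus ε from the shift of the
  -- argument. The Lipschitz constant is 2 · 2Λ + Λ, since lam ≤ 2 both multiplies the function and
  -- dilates its argument.
  have hG : TestOn a b (2 * ε) (5 * Λ) (fun z => (lam : ℂ) * v ((z - a) * ρ₂) - u z) := by
    constructor
    · intro z hz
      have e : (lam : ℂ) * v ((z - a) * ρ₂) - u z
          = ((lam - 1 : ℝ) : ℂ) * v ((z - a) * ρ₂) + (v ((z - a) * ρ₂) - u z) := by
        push_cast; ring
      rw [e]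
      refine (norm_add_le _ _).trans ?_
      rw [norm_mul, Complex.norm_real, Real.norm_eq_abs]
      have b1 : ‖v ((z - a) * ρ₂)‖ ≤ 1 := hu.bdd _ (hθ z hz)
      have b2 : ‖v ((z - a) * ρ₂) - u z‖ ≤ 1 * ε := by
        refine (hu1.lip _ (hθ z hz) z hz).trans ?_
        gcongr
        have e2 : min b (a + (z - a) * ρ₂ / ρ₁) - z
            = min b (a + (z - a) * ρ₂ / ρ₁) - min b z := by rw [min_eq_right hz.2]
        rw [e2]
        refine (abs_min_sub_min_le_max _ _ _ _).trans ?_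
        rw [sub_self, abs_zero, mul_div_assoc, ← hlam,
          show a + (z - a) * lam - z = (z - a) * (lam - 1) by ring, abs_mul,
          abs_of_nonneg (by linarith [hz.1] : 0 ≤ z - a)]
        refine max_le hε.le ?_
        have := abs_nonneg (lam - 1)
        nlinarith [hz.1, hz.2]
      have := abs_nonneg (lam - 1)
      nlinarith [norm_nonneg (v ((z - a) * ρ₂))]
    · intro s hs t ht
      have e : (lam : ℂ) * v ((s - a) * ρ₂) - u s - ((lam : ℂ) * v ((t - a) * ρ₂) - u t)
          = (lam : ℂ) * (v ((s - a) * ρ₂) - v ((t - a) * ρ₂)) - (u s - u t) := by ring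
      rw [e]
      refine (norm_sub_le _ _).trans ?_
      rw [norm_mul, Complex.norm_real, Real.norm_of_nonneg hlam0.le]
      have b1 : ‖v ((s - a) * ρ₂) - v ((t - a) * ρ₂)‖ ≤ Λ * (2 * |s - t|) := by
        refine (hu.lip _ (hθ s hs) _ (hθ t ht)).trans ?_
        gcongr
        refine (abs_min_sub_min_le_max _ _ _ _).trans ?_
        rw [sub_self, abs_zero, mul_div_assoc, mul_div_assoc, ← hlam,
          show a + (s - a) * lam - (a + (t - a) * lam) = lam * (s - t) by ring, abs_mul,
          abs_of_pos hlam0]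
        exact max_le (by positivity) (by gcongr)
      have b2 := hu.lip s hs t ht
      have b3 : lam * ‖v ((s - a) * ρ₂) - v ((t - a) * ρ₂)‖ ≤ 2 * (Λ * (2 * |s - t|)) := by
        gcongr
      linarith
  have hS := graph_stable_interp hκ₂ hκ₂' hb c₂ hAs hAs0 hab.le (by positivity) (by positivity) hG
  have hba : (b - a) ^ P.σ ≤ 1 := Real.rpow_le_one (by linarith) (by linarith) P.σ_pos.le
  have i1 : IntervalIntegrable (fun z => v ((z - a) * ρ₂) • f (graphPt c₂ κ₂ z)) volume a b := by
    refine hf.intervalIntegrable (continuous_graphPt c₂ κ₂).measurable ?_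
    rw [uIcc_of_le hab.le]
    refine hu.continuousOn.comp (f := fun z => min b (a + (z - a) * ρ₂ / ρ₁)) ?_ hθ
    fun_prop
  have i2 : IntervalIntegrable (fun z => u z • f (graphPt c₂ κ₂ z)) volume a b := by
    refine hf.intervalIntegrable (continuous_graphPt c₂ κ₂).measurable ?_
    rw [uIcc_of_le hab.le]
    exact hu.continuousOn
  have e1 : ∫ z in a..b, v ((z - a) * ρ₁) • f (graphPt c₁ κ₁ z)
      = ∫ z in a..b, u z • f (graphPt c₁ κ₁ z) := by
    refine intervalIntegral.integral_congr fun z hz => ?_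
    rw [uIcc_of_le hab.le] at hz
    simp only [v, mul_div_cancel_right₀ _ (slopeLen_pos κ₁).ne', ρ₁, add_sub_cancel,
      min_eq_right hz.2]
  have e2 : ∫ z in a..b, ((lam : ℂ) * v ((z - a) * ρ₂) - u z) • f (graphPt c₂ κ₂ z)
      = (lam • ∫ z in a..b, v ((z - a) * ρ₂) • f (graphPt c₂ κ₂ z))
        - ∫ z in a..b, u z • f (graphPt c₂ κ₂ z) := by
    have i1' : IntervalIntegrable (fun z => lam • v ((z - a) * ρ₂) • f (graphPt c₂ κ₂ z))
        volume a b := i1.smul lam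
    rw [← intervalIntegral.integral_smul, ← intervalIntegral.integral_sub i1' i2]
    refine intervalIntegral.integral_congr fun z _ => ?_
    simp only [sub_smul, mul_smul, Complex.coe_smul]
  rw [e1] at hU
  rw [e2] at hS
  set I₁ := ∫ z in a..b, u z • f (graphPt c₁ κ₁ z)
  set I₂ := ∫ z in a..b, u z • f (graphPt c₂ κ₂ z)
  set J := ∫ z in a..b, v ((z - a) * ρ₂) • f (graphPt c₂ κ₂ z)
  have e3 : I₁ - I₂ = ρ₁⁻¹ • (ρ₁ • I₁ - ρ₂ • J) + (lam • J - I₂) := by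
    rw [smul_sub, smul_smul, smul_smul, inv_mul_cancel₀ (by positivity), one_smul, hlam,
      div_eq_inv_mul]
    abel
  rw [e3]
  refine (norm_add_le _ _).trans (add_le_add ?_ ?_)
  · rw [norm_smul, norm_inv, Real.norm_of_nonneg (by linarith : 0 ≤ ρ₁)]
    have : ρ₁⁻¹ ≤ 1 := inv_le_one_of_one_le₀ h1
    have hU' : ‖ρ₁ • I₁ - ρ₂ • J‖ ≤ 2 * 1 * Au * (5 * ε) ^ P.β := hU
    nlinarith [norm_nonneg (ρ₁ • I₁ - ρ₂ • J)]
  · refine hS.trans ?_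
    rw [show 2 * (2 * ε) = 4 * ε by ring]
    have h0 : 0 ≤ 2 * As * (2 * ε + (4 * ε) ^ (1 - P.q) * (5 * Λ) ^ P.q) := by positivity
    nlinarith

end StretchFold

namespace StretchFold

/-! ### The half-step operator -/

/-- The projection of `ℂ²` to the first axis. -/
noncomputable def firstProj : C2 →L[ℂ] C2 := LinearMap.toContinuousLinearMap
  { toFun := fun v => !₂[v 0, 0]
    map_add' := fun v w => by ext i; fin_cases i <;> simp
    map_smul' := fun a v => by ext i; fin_cases i <;> simp }

/-- The exchange of the coordinates of `ℂ²`. -/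
noncomputable def swapMap : C2 →L[ℂ] C2 := LinearMap.toContinuousLinearMap
  { toFun := fun v => !₂[v 1, v 0]
    map_add' := fun v w => by ext i; fin_cases i <;> simp
    map_smul' := fun a v => by ext i; fin_cases i <;> simp }

theorem firstProj_apply (v : C2) : firstProj v = !₂[v 0, 0] := rfl

theorem swapMap_apply (v : C2) : swapMap v = !₂[v 1, v 0] := rfl

theorem norm_firstProj_le (v : C2) : ‖firstProj v‖ ≤ ‖v‖ := by
  rw [firstProj_apply, EuclideanSpace.norm_eq, EuclideanSpace.norm_eq]
  refine Real.sqrt_le_sqrt ?_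
  simp [Fin.sum_univ_two]

theorem norm_swapMap_le (v : C2) : ‖swapMap v‖ ≤ ‖v‖ := by
  rw [swapMap_apply, EuclideanSpace.norm_eq, EuclideanSpace.norm_eq]
  refine Real.sqrt_le_sqrt ?_
  simp [Fin.sum_univ_two, add_comm]

/-- The normalized derivative of the shear followed by the exchange of the coordinates. -/
noncomputable def stepMap (α : ℕ) (s : ℝ) : C2 →L[ℂ] C2 :=
  (s : ℂ) • firstProj + (α : ℂ)⁻¹ • swapMap

theorem norm_stepMap_le {α : ℕ} (hα : 1 ≤ α) {s : ℝ} (hs : |s| ≤ 1) (v : C2) :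
    ‖stepMap α s v‖ ≤ 2 * ‖v‖ := by
  have h1 : ‖((α : ℂ))⁻¹‖ ≤ 1 := by
    rw [norm_inv, Complex.norm_natCast]
    exact inv_le_one_of_one_le₀ (by exact_mod_cast hα)
  calc ‖stepMap α s v‖ ≤ ‖(s : ℂ) • firstProj v‖ + ‖(α : ℂ)⁻¹ • swapMap v‖ := norm_add_le _ _
    _ ≤ 1 * ‖v‖ + 1 * ‖v‖ := by
        rw [norm_smul, norm_smul, Complex.norm_real, Real.norm_eq_abs]
        exact add_le_add
          (mul_le_mul hs (norm_firstProj_le v) (norm_nonneg _) zero_le_one)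
          (mul_le_mul h1 (norm_swapMap_le v) (norm_nonneg _) zero_le_one)
    _ = _ := by ring

/-- The inverse of the horizontal shear followed by the exchange of the coordinates. -/
noncomputable def halfInv (α : ℕ) (p : Torus) : Torus :=
  (p.2, p.1 - (halfSign p.2 * (α : ℤ)) • p.2)

/-- The half-step operator, whose square is the transfer operator. -/
noncomputable def halfTransfer (α : ℕ) (f : Torus → C2) (p : Torus) : C2 :=
  stepMap α (halfSign p.2) (f (halfInv α p))

theorem halfInv_halfInv (α : ℕ) (p : Torus) :
    halfInv α (halfInv α p) = (torusMap α).symm p := rfl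

/-- The base maps compose definitionally, by `halfInv_halfInv`. The weights multiply as (s, 1/α;
1/α, 0)(s', 1/α; 1/α, 0), which is α⁻² times the derivative matrix, the sign at the outer point
being the one called s' there. -/
theorem halfTransfer_halfTransfer {α : ℕ} (hα : 1 ≤ α) (f : Torus → C2) :
    halfTransfer α (halfTransfer α f) = transfer α f := by
  have hα0 : (α : ℂ) ≠ 0 := by exact_mod_cast (by omega : α ≠ 0)
  ext p i
  have h1 : (shearV α ((torusMap α).symm p)).2 = p.2 := by
    simp only [torusMap, Equiv.symm_trans_apply, Equiv.apply_symm_apply]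
    rfl
  have h2 : ((torusMap α).symm p).1 = (halfInv α p).2 := rfl
  simp only [halfTransfer, halfInv_halfInv, transfer, derivMatrix, h1, h2, stepMap,
    add_apply, smul_apply, firstProj_apply, swapMap_apply]
  set s := halfSign p.2
  set s' := halfSign (halfInv α p).2
  set v := f ((torusMap α).symm p)
  fin_cases i
  · simp
    field_simp
    ring
  · simp
    field_simp

theorem halfSign_coe (r : ℝ) :
    halfSign (r : UnitAddCircle) = if (1 / 2 : ℝ) ≤ Int.fract r then 1 else -1 := by
  rw [halfSign, AddCircle.coe_equivIco_mk_apply, div_one, mul_one]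

theorem abs_halfSign (x : UnitAddCircle) : |(halfSign x : ℝ)| = 1 := by
  rw [halfSign]; split_ifs <;> simp

/-- The sign on the strand of heights between `k / 2` and `(k + 1) / 2`. -/
noncomputable def strandSign (k : ℕ) : ℝ := if Odd k then 1 else -1

theorem strandSign_eq (k : ℕ) : strandSign k = 1 ∨ strandSign k = -1 := by
  rw [strandSign]; split_ifs <;> simp

theorem abs_strandSign (k : ℕ) : |strandSign k| = 1 := by
  rcases strandSign_eq k with h | h <;> simp [h]

theorem halfSign_strand {k : ℕ} {y : ℝ} (h1 : (k : ℝ) / 2 ≤ y) (h2 : y < ((k : ℝ) + 1) / 2) :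
    (halfSign (y : UnitAddCircle) : ℝ) = strandSign k := by
  rw [halfSign_coe, strandSign]
  rcases Nat.even_or_odd' k with ⟨m, rfl | rfl⟩
  · have hf : Int.fract y = y - m := by
      rw [Int.fract_eq_iff]
      push_cast at h1 h2
      exact ⟨by linarith, by linarith, m, by push_cast; ring⟩
    push_cast at h1 h2
    rw [hf, if_neg (by linarith), if_neg (by simp)]
    simp
  · have hf : Int.fract y = y - m := by
      rw [Int.fract_eq_iff]
      push_cast at h1 h2
      exact ⟨by linarith, by linarith, m, by push_cast; ring⟩
    push_cast at h1 h2
    rw [hf, if_pos (by linarith), if_pos (by simp)]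
    simp

theorem circle_norm_eq_fract (r : ℝ) :
    ‖(r : UnitAddCircle)‖ = min (Int.fract r) (1 - Int.fract r) := by
  rw [UnitAddCircle.norm_eq]; exact abs_sub_round_eq_min r

/-- Modulo one, y in the upper half is minus its distance to zero, and -y in the lower half is as
well. The shear is thus a Lipschitz map with a fold, and only its derivative jumps. This is what
makes `halfInv` continuous. -/
theorem halfSign_smul (y : UnitAddCircle) : halfSign y • y = -((‖y‖ : ℝ) : UnitAddCircle) := by
  induction y using QuotientAddGroup.induction_on with
  | H r =>
    change halfSign (r : UnitAddCircle) • (r : UnitAddCircle) = -((‖(r : UnitAddCircle)‖ : ℝ) : UnitAddCircle)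
    have hr : (r : UnitAddCircle) = ((Int.fract r : ℝ) : UnitAddCircle) := by
      have h1 : r = Int.fract r + ⌊r⌋ := (Int.fract_add_floor r).symm
      have h2 : ((⌊r⌋ : ℝ) : UnitAddCircle) = 0 := by
        rw [AddCircle.coe_eq_zero_iff]; exact ⟨⌊r⌋, by simp⟩
      conv_lhs => rw [h1, AddCircle.coe_add, h2, add_zero]
    rw [halfSign_coe, circle_norm_eq_fract]
    split_ifs with h
    · have : ((1 : ℝ) : UnitAddCircle) = 0 := AddCircle.coe_period 1
      rw [min_eq_right (by linarith), one_smul, AddCircle.coe_sub, neg_sub, this, sub_zero]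
      exact hr
    · rw [min_eq_left (by linarith), hr]; simp

theorem halfInv_eq (α : ℕ) (p : Torus) :
    halfInv α p = (p.2, p.1 + (α : ℤ) • ((‖p.2‖ : ℝ) : UnitAddCircle)) := by
  rw [halfInv, mul_comm, mul_smul, halfSign_smul, smul_neg, sub_neg_eq_add]

theorem continuous_halfInv (α : ℕ) : Continuous (halfInv α) := by
  have : halfInv α = fun p => (p.2, p.1 + (α : ℤ) • ((‖p.2‖ : ℝ) : UnitAddCircle)) :=
    funext (halfInv_eq α)
  rw [this]
  have h : Continuous fun x : ℝ => (x : UnitAddCircle) := AddCircle.continuous_mk' 1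
  exact continuous_snd.prodMk (continuous_fst.add ((h.comp continuous_snd.norm).zsmul _))

theorem measurable_halfSign : Measurable fun x : UnitAddCircle => (halfSign x : ℝ) := by
  have h1 : Measurable fun x : UnitAddCircle => (AddCircle.equivIco (1 : ℝ) 0 x : ℝ) :=
    measurable_subtype_coe.comp (AddCircle.measurableEquivIco (1 : ℝ) 0).measurable
  have : (fun x : UnitAddCircle => (halfSign x : ℝ)) =
      fun x => if (1 / 2 : ℝ) ≤ (AddCircle.equivIco (1 : ℝ) 0 x : ℝ) then 1 else -1 := by
    ext x; rw [halfSign]; split_ifs <;> simp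
  rw [this]
  exact Measurable.ite (measurableSet_le measurable_const h1) measurable_const measurable_const

theorem BddMeas.halfTransfer {α : ℕ} (hα : 1 ≤ α) {f : Torus → C2} (hf : BddMeas f) :
    BddMeas (halfTransfer α f) := by
  obtain ⟨hm, B, hB⟩ := hf
  refine ⟨?_, 2 * B, fun p => ?_⟩
  · have h1 : Measurable fun p : Torus => f (halfInv α p) :=
      hm.comp (continuous_halfInv α).measurable
    have h2 : Measurable fun p : Torus => ((halfSign p.2 : ℝ) : ℂ) :=
      Complex.measurable_ofReal.comp (measurable_halfSign.comp measurable_snd)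
    exact (h2.smul (firstProj.continuous.measurable.comp h1)).add
      ((swapMap.continuous.measurable.comp h1).const_smul ((α : ℂ)⁻¹))
  · refine (norm_stepMap_le hα (abs_halfSign _).le _).trans ?_
    gcongr; exact hB _

/-! ### Cutting integrals into pieces -/

theorem norm_integral_le_of_pieces {F : ℝ → C2} {a b K : ℝ} (hab : a ≤ b) {n : ℕ} (hn : 0 < n)
    (hF : IntervalIntegrable F volume a b)
    (hK : ∀ a' b', a ≤ a' → a' ≤ b' → b' ≤ b → b' - a' = (b - a) / n →
      ‖∫ z in a'..b', F z‖ ≤ K) : ‖∫ z in a..b, F z‖ ≤ n * K := by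
  have hn0 : (0 : ℝ) < n := by exact_mod_cast hn
  set x : ℕ → ℝ := fun k => a + (b - a) / n * k with hx
  have hstep : 0 ≤ (b - a) / n := div_nonneg (by linarith) hn0.le
  have hmem (k : ℕ) (hk : k ≤ n) : a ≤ x k ∧ x k ≤ b := by
    have hk' : (k : ℝ) ≤ n := by exact_mod_cast hk
    refine ⟨by simp only [hx]; nlinarith [(Nat.cast_nonneg k : (0 : ℝ) ≤ k)], ?_⟩
    have : (b - a) / n * k ≤ (b - a) / n * n := by gcongr
    rw [div_mul_cancel₀ _ hn0.ne'] at this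
    simp only [hx]; linarith
  have hle (k : ℕ) : x k ≤ x (k + 1) := by
    simp only [hx]; push_cast; nlinarith
  have hint (k : ℕ) (hk : k < n) : IntervalIntegrable F volume (x k) (x (k + 1)) := by
    refine hF.mono_set ?_
    rw [uIcc_of_le hab, uIcc_of_le (hle k)]
    exact Icc_subset_Icc (hmem k hk.le).1 (hmem (k + 1) hk).2
  have hsum := intervalIntegral.sum_integral_adjacent_intervals hint
  have hx0 : x 0 = a := by simp [hx]
  have hxn : x n = b := by simp only [hx]; rw [div_mul_cancel₀ _ hn0.ne']; ring
  rw [hx0, hxn] at hsum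
  rw [← hsum]
  refine (norm_sum_le_of_le (f := fun k => ∫ z in x k..x (k + 1), F z) (n := fun _ => K) _
    fun k hk => ?_).trans (by simp)
  rw [Finset.mem_range] at hk
  exact hK _ _ (hmem k hk.le).1 (hle k) (hmem (k + 1) hk).2 (by simp only [hx]; push_cast; ring)

/-- Intervals of height at most 1/2 are those over which a graph is an admissible leaf
(`graphLeaf`). -/
theorem norm_integral_le_of_short {F : ℝ → C2} {a b K : ℝ} (hab : a ≤ b)
    (hF : IntervalIntegrable F volume a b)
    (hK : ∀ a' b', a ≤ a' → a' ≤ b' → b' ≤ b → b' - a' ≤ 1 / 2 →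
      ‖∫ z in a'..b', F z‖ ≤ K) : ‖∫ z in a..b, F z‖ ≤ (2 * (b - a) + 2) * K := by
  have hK0 : 0 ≤ K := (norm_nonneg _).trans (hK a a le_rfl le_rfl hab (by norm_num))
  have hceil := Nat.ceil_lt_add_one (a := 2 * (b - a)) (by linarith)
  have hle := Nat.le_ceil (2 * (b - a))
  refine (norm_integral_le_of_pieces hab (n := ⌈2 * (b - a)⌉₊ + 1) (by omega) hF
    fun a' b' h1 h2 h3 h4 => hK a' b' h1 h2 h3 ?_).trans ?_
  · rw [h4, div_le_iff₀ (by positivity)]; push_cast; linarith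
  · push_cast; exact mul_le_mul_of_nonneg_right (by linarith) hK0

/-! ### Integrals over graphs of arbitrary height -/

section long

variable {α : ℕ} {κ a b c : ℝ} {f : Torus → C2} {A w : ℝ} {P : Params}

theorem graph_integrable (hf : BddMeas f) (hab : a ≤ b) {B Λ : ℝ} {u : ℝ → ℂ}
    (hu : TestOn a b B Λ u) :
    IntervalIntegrable (fun z => u z • f (graphPt c κ z)) volume a b :=
  hf.intervalIntegrable (continuous_graphPt c κ).measurable
    (by rw [uIcc_of_le hab]; exact hu.continuousOn)

theorem graph_weak_long (hκ : |κ| ≤ 2 * (α : ℝ)⁻¹) (hκ1 : |κ| ≤ 1) (hf : BddMeas f)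
    (hA : weakENorm α f ≤ ENNReal.ofReal A) (hA0 : 0 ≤ A) (hab : a ≤ b) {M : ℝ}
    (hM : 0 < M) {u : ℝ → ℂ} (hu : TestOn a b M M u) :
    ‖∫ z in a..b, u z • f (graphPt c κ z)‖ ≤ (2 * (b - a) + 2) * (2 * M * A) :=
  norm_integral_le_of_short hab (graph_integrable hf hab hu) fun _ _ h1 h2 h3 h4 =>
    graph_weak hκ hκ1 h4 c hA hA0 h2 hM (hu.mono h1 h3 le_rfl le_rfl)

theorem graph_stable_long (hκ : |κ| ≤ 2 * (α : ℝ)⁻¹) (hκ1 : |κ| ≤ 1) (hf : BddMeas f)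
    (hA : stableENorm P α f ≤ ENNReal.ofReal A) (hA0 : 0 ≤ A) (hab : a ≤ b)
    {M Λ : ℝ} (hM : 0 < M) (hΛ : 0 ≤ Λ) {u : ℝ → ℂ} (hu : TestOn a b M Λ u)
    (hh : ∀ s ∈ Icc a b, ∀ t ∈ Icc a b, ‖u s - u t‖ ≤ M * |s - t| ^ P.q) :
    ‖∫ z in a..b, u z • f (graphPt c κ z)‖
      ≤ (2 * (b - a) + 2) * (2 * M * A * (b - a) ^ P.σ) :=
  norm_integral_le_of_short hab (graph_integrable hf hab hu) fun a' b' h1 h2 h3 h4 =>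
    (graph_stable hκ hκ1 h4 c hA hA0 h2 hM hΛ (hu.mono h1 h3 le_rfl le_rfl) fun s hs t ht =>
      hh s (Icc_subset_Icc h1 h3 hs) t (Icc_subset_Icc h1 h3 ht)).trans (by
        have := P.σ_pos
        have : 0 ≤ b' - a' := by linarith
        gcongr)

theorem graph_interp_long (hκ : |κ| ≤ 2 * (α : ℝ)⁻¹) (hκ1 : |κ| ≤ 1) (hf : BddMeas f)
    (hA : stableENorm P α f ≤ ENNReal.ofReal A) (hA0 : 0 ≤ A) (hab : a ≤ b)
    {B Λ : ℝ} (hB : 0 < B) (hΛ : 0 ≤ Λ) {u : ℝ → ℂ} (hu : TestOn a b B Λ u) :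
    ‖∫ z in a..b, u z • f (graphPt c κ z)‖
      ≤ (2 * (b - a) + 2) * (2 * (B + (2 * B) ^ (1 - P.q) * Λ ^ P.q) * A) :=
  norm_integral_le_of_short hab (graph_integrable hf hab hu) fun a' b' h1 h2 h3 h4 =>
    (graph_stable_interp hκ hκ1 h4 c hA hA0 h2 hB hΛ (hu.mono h1 h3 le_rfl le_rfl)).trans
      (mul_le_of_le_one_right (by positivity)
        (Real.rpow_le_one (by linarith) (by linarith) P.σ_pos.le))

/-- Constant part of the test function against the weak norm, oscillation against the stable
norm. -/
theorem graph_mixed_long (hκ : |κ| ≤ 2 * (α : ℝ)⁻¹) (hκ1 : |κ| ≤ 1) (hf : BddMeas f)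
    (hA : stableENorm P α f ≤ ENNReal.ofReal A) (hA0 : 0 ≤ A)
    (hw : weakENorm α f ≤ ENNReal.ofReal w) (hw0 : 0 ≤ w) (hab : a ≤ b)
    {M H Λ : ℝ} (hM : 0 < M) (hH : 0 < H) (hΛ : 0 ≤ Λ) {u : ℝ → ℂ} (hu : TestOn a b M Λ u)
    (hh : ∀ s ∈ Icc a b, ∀ t ∈ Icc a b, ‖u s - u t‖ ≤ H * |s - t| ^ P.q) :
    ‖∫ z in a..b, u z • f (graphPt c κ z)‖
      ≤ (2 * (b - a) + 2) * (2 * M * w + 2 * H * A) := by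
  refine norm_integral_le_of_short hab (graph_integrable hf hab hu) fun a' b' h1 h2 h3 h4 => ?_
  have ha' : a' ∈ Icc a b := ⟨h1, h2.trans h3⟩
  have hc1 : TestOn a' b' M M (fun _ => u a') :=
    ⟨fun _ _ => hu.bdd _ ha', fun s _ t _ => by
      rw [sub_self, norm_zero]; exact mul_nonneg hM.le (abs_nonneg _)⟩
  have hc2 : TestOn a' b' H Λ (fun z => u z - u a') := by
    refine ⟨fun t ht => ?_, fun s hs t ht => ?_⟩
    · refine (hh t (Icc_subset_Icc h1 h3 ht) a' ha').trans (mul_le_of_le_one_right hH.le ?_)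
      refine Real.rpow_le_one (abs_nonneg _) ?_ P.q_pos.le
      rw [abs_of_nonneg (by linarith [ht.1])]; linarith [ht.2]
    · rw [sub_sub_sub_cancel_right]
      exact hu.lip s (Icc_subset_Icc h1 h3 hs) t (Icc_subset_Icc h1 h3 ht)
  have e : ∫ z in a'..b', u z • f (graphPt c κ z)
      = (∫ z in a'..b', u a' • f (graphPt c κ z))
        + ∫ z in a'..b', (u z - u a') • f (graphPt c κ z) := by
    rw [← intervalIntegral.integral_add (graph_integrable hf h2 hc1) (graph_integrable hf h2 hc2)]
    refine intervalIntegral.integral_congr fun z _ => ?_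
    simp only [← add_smul, add_sub_cancel]
  rw [e]
  refine (norm_add_le _ _).trans (add_le_add (graph_weak hκ hκ1 h4 c hw hw0 h2 hM hc1) ?_)
  refine (graph_stable hκ hκ1 h4 c hA hA0 h2 hH hΛ hc2 fun s hs t ht => ?_).trans
    (mul_le_of_le_one_right (by positivity)
      (Real.rpow_le_one (by linarith) (by linarith) P.σ_pos.le))
  rw [sub_sub_sub_cancel_right]
  exact hh s (Icc_subset_Icc h1 h3 hs) t (Icc_subset_Icc h1 h3 ht)

end long

/-! ### Images of strands -/

/-- The image of a strand may be traversed downwards, whence the minimum and the maximum; after this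
change of variables only the absolute value of the speed remains. -/
theorem integral_strand (f : Torus → C2) (u : ℝ → ℂ) {n : ℝ} (hn : n ≠ 0) (Z c κ : ℝ) {s t : ℝ}
    (hst : s ≤ t) :
    ∫ r in s..t, u r • f (graphPt c κ (Z + n * r)) =
      |n|⁻¹ • ∫ z in min (Z + n * s) (Z + n * t)..max (Z + n * s) (Z + n * t),
        u ((z - Z) / n) • f (graphPt c κ z) := by
  have h := intervalIntegral.integral_comp_add_mul
    (fun z => u ((z - Z) / n) • f (graphPt c κ z)) (a := s) (b := t) hn Z
  simp only [add_sub_cancel_left, mul_div_cancel_left₀ _ hn] at h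
  rw [h]
  rcases lt_or_gt_of_ne hn with hneg | hpos
  · have : n * t ≤ n * s := mul_le_mul_of_nonpos_left hst hneg.le
    rw [min_eq_right (by linarith), max_eq_left (by linarith), abs_of_neg hneg,
      intervalIntegral.integral_symm, inv_neg, neg_smul, smul_neg]
  · have : n * s ≤ n * t := mul_le_mul_of_nonneg_left hst hpos.le
    rw [min_eq_left (by linarith), max_eq_right (by linarith), abs_of_pos hpos]

end StretchFold

namespace StretchFold

/-! ### The image of a leaf under the half step -/

variable {α : ℕ}

theorem Leaf.abs_dir_zero_le_half (W : Leaf α) (hα : 4 ≤ α) : |W.dir 0| ≤ W.dir 1 / 2 := by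
  have hα' : (4 : ℝ) ≤ α := by exact_mod_cast hα
  have h := W.cone
  rw [abs_of_pos W.dir_pos] at h
  refine h.trans ?_
  have : (α : ℝ)⁻¹ ≤ 4⁻¹ := inv_anti₀ (by norm_num) hα'
  nlinarith [W.dir_pos]

theorem Leaf.dir_one_ge (W : Leaf α) (hα : 4 ≤ α) : 4 / 5 ≤ W.dir 1 := by
  have h1 := W.abs_dir_zero_le_half hα
  have h2 := W.dir_sq
  have h3 := W.dir_pos
  have h4 : W.dir 0 ^ 2 ≤ (W.dir 1 / 2) ^ 2 := by
    rw [← sq_abs (W.dir 0)]; gcongr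
  nlinarith

/-- The vertical velocity of the image of a leaf. -/
noncomputable def Leaf.rate (W : Leaf α) (k : ℕ) : ℝ := W.dir 0 - strandSign k * α * W.dir 1

/-- The slope of the image of a leaf. -/
noncomputable def Leaf.slope (W : Leaf α) (k : ℕ) : ℝ := W.dir 1 / W.rate k

/-- The height at which the image of a leaf based at `(x, y)` starts. -/
noncomputable def strandBase (α : ℕ) (x y : ℝ) (k : ℕ) : ℝ := x - strandSign k * α * y

/-- The intercept of the image of a leaf based at `(x, y)`. -/
noncomputable def Leaf.icept (W : Leaf α) (x y : ℝ) (k : ℕ) : ℝ :=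
  y - W.slope k * strandBase α x y k

/-- The parameter at which a leaf starting at height `y` leaves the strands below height `k / 2`. -/
noncomputable def Leaf.cut (W : Leaf α) (y : ℝ) (k : ℕ) : ℝ :=
  max 0 (min W.len (((k : ℝ) / 2 - y) / W.dir 1))

/-- The leaf is nearly vertical, so its image moves with vertical speed close to α: the horizontal
component disturbs α times the vertical one by a small fraction only. -/
theorem Leaf.rate_bounds (W : Leaf α) (hα : 4 ≤ α) (k : ℕ) :
    (α : ℝ) / 2 ≤ |W.rate k| ∧ |W.rate k| ≤ 2 * α ∧ (α : ℝ) / 2 * W.dir 1 ≤ |W.rate k| := by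
  have hα' : (4 : ℝ) ≤ α := by exact_mod_cast hα
  have h1 := W.abs_dir_zero_le_half hα
  have h2 := W.dir_one_ge hα
  have h3 := W.dir_one_le
  have e : |strandSign k * α * W.dir 1| = α * W.dir 1 := by
    rw [abs_mul, abs_mul, abs_strandSign, Nat.abs_cast, abs_of_pos W.dir_pos, one_mul]
  have h4 : |W.rate k| ≤ |W.dir 0| + α * W.dir 1 := by rw [← e]; exact abs_sub _ _
  have h5 : α * W.dir 1 - |W.dir 0| ≤ |W.rate k| := by
    rw [← e, Leaf.rate, abs_sub_comm]; exact abs_sub_abs_le_abs_sub _ _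
  refine ⟨?_, ?_, ?_⟩ <;> nlinarith

theorem Leaf.rate_ne_zero (W : Leaf α) (hα : 4 ≤ α) (k : ℕ) : W.rate k ≠ 0 := by
  have hα' : (4 : ℝ) ≤ α := by exact_mod_cast hα
  exact abs_pos.1 (by linarith [(W.rate_bounds hα k).1])

theorem Leaf.rate_inv_le (W : Leaf α) (hα : 4 ≤ α) (k : ℕ) : |W.rate k|⁻¹ ≤ 2 * (α : ℝ)⁻¹ := by
  have hα' : (4 : ℝ) ≤ α := by exact_mod_cast hα
  refine (inv_anti₀ (by positivity) (W.rate_bounds hα k).1).trans (le_of_eq ?_)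
  field_simp

/-- Invariance of the stable cone. The direction (v₁, v₂) is mapped to (v₂, v₁ ∓ α v₂), and the
third bound of `Leaf.rate_bounds` compares the two components. -/
theorem Leaf.abs_slope_le (W : Leaf α) (hα : 4 ≤ α) (k : ℕ) : |W.slope k| ≤ 2 * (α : ℝ)⁻¹ := by
  have hα' : (4 : ℝ) ≤ α := by exact_mod_cast hα
  have h := W.rate_bounds hα k
  rw [Leaf.slope, abs_div, abs_of_pos W.dir_pos, div_le_iff₀ (by linarith)]
  have : 2 * (α : ℝ)⁻¹ * ((α : ℝ) / 2 * W.dir 1) = W.dir 1 := by field_simp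
  rw [← this]
  gcongr
  exact h.2.2

theorem two_inv_le_half (hα : 4 ≤ α) : 2 * (α : ℝ)⁻¹ ≤ 1 / 2 := by
  have hα' : (4 : ℝ) ≤ α := by exact_mod_cast hα
  have : (α : ℝ)⁻¹ ≤ 4⁻¹ := inv_anti₀ (by norm_num) hα'
  linarith

theorem Leaf.abs_slope_le_one (W : Leaf α) (hα : 4 ≤ α) (k : ℕ) : |W.slope k| ≤ 1 :=
  (W.abs_slope_le hα k).trans ((two_inv_le_half hα).trans (by norm_num))

theorem Leaf.cut_mem (W : Leaf α) (y : ℝ) (k : ℕ) : W.cut y k ∈ Icc 0 W.len :=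
  ⟨le_max_left _ _, max_le W.len_pos.le (min_le_left _ _)⟩

theorem Leaf.cut_le_succ (W : Leaf α) (y : ℝ) (k : ℕ) : W.cut y k ≤ W.cut y (k + 1) := by
  have := W.dir_pos
  unfold Leaf.cut
  gcongr
  linarith

theorem Leaf.cut_zero (W : Leaf α) {y : ℝ} (hy : 0 ≤ y) : W.cut y 0 = 0 := by
  have : ((0 : ℕ) / 2 - y) / W.dir 1 ≤ 0 :=
    div_nonpos_of_nonpos_of_nonneg (by push_cast; linarith) W.dir_pos.le
  exact max_eq_left ((min_le_right _ _).trans this)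

/-- A leaf rises by at most one, hence stays below height 4 = 8/2. This is why eight strands are
enough, most of them degenerate. -/
theorem Leaf.cut_eight (W : Leaf α) {y : ℝ} (hy : y ≤ 3) : W.cut y 8 = W.len := by
  have : W.len ≤ ((8 : ℕ) / 2 - y) / W.dir 1 := by
    rw [le_div_iff₀ W.dir_pos]
    norm_num
    linarith [W.len_mul_dir_le]
  rw [Leaf.cut, min_eq_left this, max_eq_right W.len_pos.le]

theorem Leaf.halfTransfer_path (W : Leaf α) {x y : ℝ} (hα : 4 ≤ α)
    (hxy : W.base = ((x : UnitAddCircle), (y : UnitAddCircle))) (f : Torus → C2) {k : ℕ} {t : ℝ}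
    (h1 : W.cut y k < t) (h2 : t < W.cut y (k + 1)) :
    halfTransfer α f (W.path t) = stepMap α (strandSign k)
      (f (graphPt (W.icept x y k) (W.slope k) (strandBase α x y k + W.rate k * t))) := by
  have hd := W.dir_pos
  have ht0 : 0 < t := (W.cut_mem y k).1.trans_lt h1
  have htS : t < W.len := h2.trans_le (W.cut_mem y (k + 1)).2
  have h1' : ((k : ℝ) / 2 - y) / W.dir 1 < t := by
    have h3 : min W.len (((k : ℝ) / 2 - y) / W.dir 1) < t := (le_max_right _ _).trans_lt h1
    rcases min_lt_iff.1 h3 with h | h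
    · linarith
    · exact h
  have h2' : t < (((k + 1 : ℕ) : ℝ) / 2 - y) / W.dir 1 := by
    rcases lt_max_iff.1 h2 with h | h
    · linarith
    · exact h.trans_le (min_le_right _ _)
  rw [div_lt_iff₀ hd] at h1'
  rw [lt_div_iff₀ hd] at h2'
  push_cast at h2'
  have hsnd : (W.path t).2 = ((y + t * W.dir 1 : ℝ) : UnitAddCircle) := by
    rw [Leaf.path, hxy, AddCircle.coe_add]
  have hfst : (W.path t).1 = ((x + t * W.dir 0 : ℝ) : UnitAddCircle) := by
    rw [Leaf.path, hxy, AddCircle.coe_add]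
  have hsgn : (halfSign (W.path t).2 : ℝ) = strandSign k := by
    rw [hsnd]; exact halfSign_strand (by linarith) (by linarith)
  rw [halfTransfer, hsgn]
  congr 2
  have hr := W.rate_ne_zero hα k
  rw [halfInv, graphPt]
  refine Prod.ext ?_ ?_
  · change (W.path t).2 = _
    rw [hsnd]
    congr 1
    simp only [Leaf.icept, Leaf.slope]
    field_simp
    ring
  · have hz : ((halfSign (W.path t).2 * (α : ℤ)) • (W.path t).2 : UnitAddCircle)
        = ((strandSign k * α * (y + t * W.dir 1) : ℝ) : UnitAddCircle) := by
      rw [hsnd, ← AddCircle.coe_zsmul, ← hsgn, hsnd, zsmul_eq_mul]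
      push_cast; rfl
    change (W.path t).1 - _ = _
    rw [hz, hfst, ← AddCircle.coe_sub]
    congr 1
    simp only [strandBase, Leaf.rate]
    ring

/-- The contribution of the `k`-th strand. -/
noncomputable def Leaf.strandInt (W : Leaf α) (x y : ℝ) (f : Torus → C2) (u : ℝ → ℂ) (k : ℕ) : C2 :=
  ∫ t in W.cut y k..W.cut y (k + 1), u t •
    f (graphPt (W.icept x y k) (W.slope k) (strandBase α x y k + W.rate k * t))

theorem Leaf.integral_halfTransfer (W : Leaf α) {x y : ℝ} (hα : 4 ≤ α)
    (hxy : W.base = ((x : UnitAddCircle), (y : UnitAddCircle))) (hy0 : 0 ≤ y) (hy3 : y ≤ 3)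
    {f : Torus → C2} (hf : BddMeas f) {u : ℝ → ℂ} {B Λ : ℝ} (hu : TestOn 0 W.len B Λ u) :
    ∫ t in (0 : ℝ)..W.len, u t • halfTransfer α f (W.path t) =
      ∑ k ∈ Finset.range 8, stepMap α (strandSign k) (W.strandInt x y f u k) := by
  have hcont (k : ℕ) : ContinuousOn u (uIcc (W.cut y k) (W.cut y (k + 1))) := by
    rw [uIcc_of_le (W.cut_le_succ y k)]
    exact hu.continuousOn.mono (Icc_subset_Icc (W.cut_mem y k).1 (W.cut_mem y (k + 1)).2)
  have hint (k : ℕ) (_ : k < 8) : IntervalIntegrable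
      (fun t => u t • halfTransfer α f (W.path t)) volume (W.cut y k) (W.cut y (k + 1)) :=
    (hf.halfTransfer (by omega)).intervalIntegrable W.continuous_path.measurable (hcont k)
  have hsum := intervalIntegral.sum_integral_adjacent_intervals hint
  rw [W.cut_zero hy0, W.cut_eight hy3] at hsum
  rw [← hsum]
  refine Finset.sum_congr rfl fun k _ => ?_
  rw [Leaf.strandInt, ← ContinuousLinearMap.intervalIntegral_comp_comm]
  · refine intervalIntegral.integral_congr_ae ?_
    -- At the upper end of a strand the sign may already be the next one, so this parameter is
    -- discarded.
    have hne : ∀ᵐ t : ℝ, t ≠ W.cut y (k + 1) := by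
      simp [ae_iff, measure_singleton]
    filter_upwards [hne] with t ht hmem
    rw [uIoc_of_le (W.cut_le_succ y k)] at hmem
    rw [W.halfTransfer_path hα hxy f hmem.1 (lt_of_le_of_ne hmem.2 ht), map_smul]
  · exact hf.intervalIntegrable (γ := fun t => graphPt _ _ _)
      ((continuous_graphPt _ _).comp (by fun_prop)).measurable (hcont k)

/-- The ends of the image of the `k`-th strand. -/
noncomputable def Leaf.lo (W : Leaf α) (x y : ℝ) (k : ℕ) : ℝ :=
  min (strandBase α x y k + W.rate k * W.cut y k) (strandBase α x y k + W.rate k * W.cut y (k + 1))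

noncomputable def Leaf.hi (W : Leaf α) (x y : ℝ) (k : ℕ) : ℝ :=
  max (strandBase α x y k + W.rate k * W.cut y k) (strandBase α x y k + W.rate k * W.cut y (k + 1))

theorem Leaf.lo_le_hi (W : Leaf α) (x y : ℝ) (k : ℕ) : W.lo x y k ≤ W.hi x y k := min_le_max

theorem Leaf.hi_sub_lo_le (W : Leaf α) (hα : 4 ≤ α) (x y : ℝ) (k : ℕ) :
    W.hi x y k - W.lo x y k ≤ 2 * α * W.len := by
  rw [Leaf.hi, Leaf.lo, max_sub_min_eq_abs, add_sub_add_left_eq_sub, ← mul_sub, abs_mul,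
    abs_of_nonneg (sub_nonneg.2 (W.cut_le_succ y k))]
  have h1 := (W.cut_mem y k).1
  have h2 := (W.cut_mem y (k + 1)).2
  have h3 := W.cut_le_succ y k
  exact mul_le_mul (W.rate_bounds hα k).2.1 (by linarith) (by linarith) (by positivity)

theorem Leaf.strandInt_eq (W : Leaf α) (hα : 4 ≤ α) (x y : ℝ) (f : Torus → C2) (u : ℝ → ℂ)
    (k : ℕ) : W.strandInt x y f u k = |W.rate k|⁻¹ • ∫ z in W.lo x y k..W.hi x y k,
      u ((z - strandBase α x y k) / W.rate k) • f (graphPt (W.icept x y k) (W.slope k) z) :=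
  integral_strand f u (W.rate_ne_zero hα k) _ _ _ (W.cut_le_succ y k)

theorem Leaf.strand_mapsTo (W : Leaf α) (hα : 4 ≤ α) {x y z : ℝ} {k : ℕ}
    (hz : z ∈ Icc (W.lo x y k) (W.hi x y k)) :
    (z - strandBase α x y k) / W.rate k ∈ Icc 0 W.len := by
  have hr := W.rate_ne_zero hα k
  have h1 := W.cut_mem y k
  have h2 := W.cut_mem y (k + 1)
  have h3 := W.cut_le_succ y k
  rw [Leaf.lo, Leaf.hi] at hz
  rcases lt_or_gt_of_ne hr with hneg | hpos
  · have : W.rate k * W.cut y (k + 1) ≤ W.rate k * W.cut y k :=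
      mul_le_mul_of_nonpos_left h3 hneg.le
    rw [min_eq_right (by linarith), max_eq_left (by linarith)] at hz
    constructor
    · refine h1.1.trans ?_
      rw [le_div_iff_of_neg hneg]; linarith [hz.2]
    · refine le_trans ?_ h2.2
      rw [div_le_iff_of_neg hneg]; linarith [hz.1]
  · have : W.rate k * W.cut y k ≤ W.rate k * W.cut y (k + 1) :=
      mul_le_mul_of_nonneg_left h3 hpos.le
    rw [min_eq_left (by linarith), max_eq_right (by linarith)] at hz
    constructor
    · refine h1.1.trans ?_
      rw [le_div_iff₀ hpos]; linarith [hz.1]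
    · refine le_trans ?_ h2.2
      rw [div_le_iff₀ hpos]; linarith [hz.2]

theorem Leaf.strand_abs_sub (W : Leaf α) (hα : 4 ≤ α) (Z s t : ℝ) (k : ℕ) :
    |(s - Z) / W.rate k - (t - Z) / W.rate k| ≤ 2 * (α : ℝ)⁻¹ * |s - t| := by
  rw [← sub_div, sub_sub_sub_cancel_right, abs_div, div_eq_inv_mul]
  gcongr
  exact W.rate_inv_le hα k

theorem Leaf.strand_testOn (W : Leaf α) (hα : 4 ≤ α) (x y : ℝ) (k : ℕ) {B Λ : ℝ} (hΛ : 0 ≤ Λ)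
    {u : ℝ → ℂ} (hu : TestOn 0 W.len B Λ u) :
    TestOn (W.lo x y k) (W.hi x y k) B (Λ * (2 * (α : ℝ)⁻¹))
      (fun z => u ((z - strandBase α x y k) / W.rate k)) :=
  hu.comp hΛ (fun _ hz => W.strand_mapsTo hα hz) fun s _ t _ => W.strand_abs_sub hα _ s t k

/-- The lift is taken one unit above the fundamental interval, to leave room for a nearby leaf whose
compatible lift starts slightly lower and must still be nonnegative. -/
theorem Leaf.exists_rep (W : Leaf α) : ∃ x y : ℝ,
    W.base = ((x : UnitAddCircle), (y : UnitAddCircle)) ∧ 1 ≤ y ∧ y ≤ 2 := by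
  obtain ⟨x, hx⟩ := QuotientAddGroup.mk_surjective W.base.1
  obtain ⟨y, hy⟩ := QuotientAddGroup.mk_surjective W.base.2
  refine ⟨x, Int.fract y + 1, ?_, by linarith [Int.fract_nonneg y], by linarith [Int.fract_lt_one y]⟩
  ext
  · exact hx.symm
  · refine hy.symm.trans ?_
    change ((y : ℝ) : UnitAddCircle) = ((Int.fract y + 1 : ℝ) : UnitAddCircle)
    rw [← sub_eq_zero, ← AddCircle.coe_sub, AddCircle.coe_eq_zero_iff]
    refine ⟨⌊y⌋ - 1, ?_⟩
    have := Int.floor_add_fract y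
    simp only [zsmul_eq_mul, mul_one]; push_cast; linarith

/-- The constant is the product of eight strands, the norm 2 of the weight, and the Jacobian 2/α. -/
theorem Leaf.norm_integral_halfTransfer_le (W : Leaf α) {x y : ℝ} (hα : 4 ≤ α)
    (hxy : W.base = ((x : UnitAddCircle), (y : UnitAddCircle))) (hy0 : 0 ≤ y) (hy3 : y ≤ 3)
    {f : Torus → C2} (hf : BddMeas f) {u : ℝ → ℂ} {B Λ : ℝ} (hu : TestOn 0 W.len B Λ u) {K : ℝ}
    (hK : ∀ k, ‖∫ z in W.lo x y k..W.hi x y k, u ((z - strandBase α x y k) / W.rate k) •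
      f (graphPt (W.icept x y k) (W.slope k) z)‖ ≤ K) :
    ‖∫ t in (0 : ℝ)..W.len, u t • halfTransfer α f (W.path t)‖ ≤ 32 * (α : ℝ)⁻¹ * K := by
  rw [W.integral_halfTransfer hα hxy hy0 hy3 hf hu]
  have hK0 : 0 ≤ K := (norm_nonneg _).trans (hK 0)
  refine (norm_sum_le_of_le _ (n := fun _ => 2 * (2 * (α : ℝ)⁻¹ * K)) fun k _ => ?_).trans
    (le_of_eq ?_)
  · refine (norm_stepMap_le (by omega) (abs_strandSign k).le _).trans ?_
    rw [W.strandInt_eq hα, norm_smul, Real.norm_of_nonneg (by positivity)]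
    gcongr
    · exact W.rate_inv_le hα k
    · exact hK k
  · rw [Finset.sum_const, Finset.card_range]; simp only [nsmul_eq_mul]; push_cast; ring

/-! ### Weak and stable estimates of the half step -/

/-- Each strand has an image of height at most 2α, covered by about 4α admissible pieces; the
Jacobian 1/α cancels this number. -/
theorem weak_halfTransfer (hα : 4 ≤ α) {f : Torus → C2} (hf : BddMeas f) {w : ℝ} (hw0 : 0 ≤ w)
    (hw : weakENorm α f ≤ ENNReal.ofReal w) :
    weakENorm α (halfTransfer α f) ≤ ENNReal.ofReal (400 * w) := by
  have hα' : (4 : ℝ) ≤ α := by exact_mod_cast hα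
  refine weak_intro fun W u hu _ => ?_
  obtain ⟨x, y, hxy, hy1, hy2⟩ := W.exists_rep
  refine (W.norm_integral_halfTransfer_le hα hxy (by linarith) (by linarith) hf hu
    (K := (2 * (2 * α) + 2) * (2 * 1 * w)) fun k => ?_).trans ?_
  · have hg := (W.strand_testOn hα x y k zero_le_one hu).mono le_rfl le_rfl le_rfl
      (show _ ≤ (1 : ℝ) by have := two_inv_le_half hα; linarith)
    refine (graph_weak_long (W.abs_slope_le hα k) (W.abs_slope_le_one hα k) hf hw hw0
      (W.lo_le_hi x y k) one_pos hg).trans ?_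
    gcongr
    refine (W.hi_sub_lo_le hα x y k).trans ?_
    have := W.len_le
    nlinarith
  · have e : 32 * (α : ℝ)⁻¹ * ((2 * (2 * α) + 2) * (2 * 1 * w)) = 256 * w + 128 * (α : ℝ)⁻¹ * w := by
      field_simp; ring
    rw [e]
    have := two_inv_le_half hα
    nlinarith

/-- The two rates come from two regimes. If the image is long, the test function is nearly constant
on pieces of height 1/2. If the image is short, the leaf itself is short and the weight of the norm
gains. -/
theorem stable_halfTransfer {P : Params} (hα : 4 ≤ α) {f : Torus → C2} (hf : BddMeas f) {w s : ℝ}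
    (hw0 : 0 ≤ w) (hw : weakENorm α f ≤ ENNReal.ofReal w) (hs0 : 0 ≤ s)
    (hs : stableENorm P α f ≤ ENNReal.ofReal s) :
    stableENorm P α (halfTransfer α f) ≤ ENNReal.ofReal
      (1000 * ((α : ℝ) ^ (-P.q) + (α : ℝ) ^ (P.σ - 1)) * s + 1000 * w) := by
  have hα' : (4 : ℝ) ≤ α := by exact_mod_cast hα
  have hα0 : (0 : ℝ) < α := by linarith
  have hq := P.q_pos
  have hσ := P.σ_pos
  have hσ1 := P.σ_lt
  refine stable_intro (hf.halfTransfer (by omega)) (by positivity) fun W u M Λ hM hΛ hu hh _ _ => ?_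
  obtain ⟨x, y, hxy, hy1, hy2⟩ := W.exists_rep
  have hS0 := W.len_pos
  have hS1 := W.len_le
  set S := W.len
  have hSσ : S ≤ S ^ P.σ := by
    conv_lhs => rw [← Real.rpow_one S]
    exact Real.rpow_le_rpow_of_exponent_ge hS0 hS1 hσ1.le
  have hSσ0 : 0 < S ^ P.σ := Real.rpow_pos_of_pos hS0 _
  have hαq : 0 < (α : ℝ) ^ (-P.q) := Real.rpow_pos_of_pos hα0 _
  have hασ : 0 < (α : ℝ) ^ (P.σ - 1) := Real.rpow_pos_of_pos hα0 _
  have hhol (k : ℕ) : ∀ s ∈ Icc (W.lo x y k) (W.hi x y k), ∀ t ∈ Icc (W.lo x y k) (W.hi x y k),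
      ‖u ((s - strandBase α x y k) / W.rate k) - u ((t - strandBase α x y k) / W.rate k)‖
        ≤ M * (2 * (α : ℝ)⁻¹) ^ P.q * |s - t| ^ P.q := by
    intro s hs t ht
    refine (hh _ (W.strand_mapsTo hα hs) _ (W.strand_mapsTo hα ht)).trans ?_
    rw [mul_assoc, ← Real.mul_rpow (by positivity) (abs_nonneg _)]
    gcongr
    exact W.strand_abs_sub hα _ s t k
  have h2q : (2 * (α : ℝ)⁻¹) ^ P.q ≤ 2 * (α : ℝ) ^ (-P.q) := by
    rw [Real.mul_rpow (by norm_num) (by positivity), Real.inv_rpow hα0.le, ← Real.rpow_neg hα0.le]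
    gcongr
    conv_rhs => rw [← Real.rpow_one 2]
    exact Real.rpow_le_rpow_of_exponent_le (by norm_num) P.q_lt.le
  have hcut (k : ℕ) : TestOn (W.lo x y k) (W.hi x y k) M Λ
      (fun z => u ((z - strandBase α x y k) / W.rate k)) :=
    (W.strand_testOn hα x y k hΛ hu).mono le_rfl le_rfl le_rfl
      (by have := two_inv_le_half hα; nlinarith)
  -- Long case: of order α S pieces times 1/α leaves S ≤ S^σ. On each piece the value at one point
  -- is tested in the weak norm and the oscillation, smaller by α^(-q), in the stable norm.
  rcases le_or_gt (α : ℝ)⁻¹ S with hcase | hcase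
  · have hαS : 1 ≤ α * S := by
      rwa [inv_le_iff_one_le_mul₀ hα0, mul_comm] at hcase
    refine (W.norm_integral_halfTransfer_le hα hxy (by linarith) (by linarith) hf hu
      (K := (6 * (α * S)) * (2 * M * w + 2 * (M * (2 * (α : ℝ) ^ (-P.q))) * s)) fun k => ?_).trans ?_
    · refine (graph_mixed_long (W.abs_slope_le hα k) (W.abs_slope_le_one hα k) hf hs hs0 hw hw0
        (W.lo_le_hi x y k) hM (H := M * (2 * (α : ℝ)⁻¹) ^ P.q) (by positivity) hΛ (hcut k)
        (hhol k)).trans ?_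
      have h1 := W.hi_sub_lo_le hα x y k
      gcongr
      nlinarith
    · have e : 32 * (α : ℝ)⁻¹ * (6 * (α * S) * (2 * M * w + 2 * (M * (2 * (α : ℝ) ^ (-P.q))) * s))
          = (384 * w + 768 * (α : ℝ) ^ (-P.q) * s) * (M * S) := by field_simp; ring
      rw [e]
      have h1 : 0 ≤ (α : ℝ) ^ (-P.q) * s := by positivity
      have h2 : 0 ≤ (α : ℝ) ^ (P.σ - 1) * s := by positivity
      gcongr ?_ * (M * ?_)
      nlinarith
  -- Short case: a bounded number of pieces of height at most 2αS, so the stable norm yields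
  -- α⁻¹(αS)^σ = α^(σ-1) S^σ.
  · have hαS : α * S ≤ 1 := by
      rw [lt_inv_comm₀ hS0 hα0] at hcase
      have := mul_le_mul_of_nonneg_right hcase.le hS0.le
      rwa [inv_mul_cancel₀ hS0.ne'] at this
    refine (W.norm_integral_halfTransfer_le hα hxy (by linarith) (by linarith) hf hu
      (K := 6 * (2 * M * s * (2 * (α * S)) ^ P.σ)) fun k => ?_).trans ?_
    · have h1 := W.hi_sub_lo_le hα x y k
      have h0 := W.lo_le_hi x y k
      refine (graph_stable_long (W.abs_slope_le hα k) (W.abs_slope_le_one hα k) hf hs hs0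
        (W.lo_le_hi x y k) hM hΛ (hcut k) fun s hs t ht => ?_).trans ?_
      · refine (hhol k s hs t ht).trans ?_
        gcongr
        refine mul_le_of_le_one_right hM.le (Real.rpow_le_one (by positivity) ?_ hq.le)
        linarith [two_inv_le_half hα]
      · have h2 : 0 ≤ W.hi x y k - W.lo x y k := by linarith
        gcongr
        · nlinarith
        · linarith
    · have e2 : (2 * (α * S)) ^ P.σ ≤ 2 * ((α : ℝ) ^ P.σ * S ^ P.σ) := by
        rw [Real.mul_rpow (by norm_num) (by positivity), Real.mul_rpow hα0.le hS0.le]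
        gcongr
        conv_rhs => rw [← Real.rpow_one 2]
        exact Real.rpow_le_rpow_of_exponent_le (by norm_num) hσ1.le
      have e3 : (α : ℝ)⁻¹ * (α : ℝ) ^ P.σ = (α : ℝ) ^ (P.σ - 1) := by
        rw [Real.rpow_sub_one hα0.ne']; ring
      calc 32 * (α : ℝ)⁻¹ * (6 * (2 * M * s * (2 * (α * S)) ^ P.σ))
          ≤ 32 * (α : ℝ)⁻¹ * (6 * (2 * M * s * (2 * ((α : ℝ) ^ P.σ * S ^ P.σ)))) := by gcongr
        _ = 768 * ((α : ℝ)⁻¹ * (α : ℝ) ^ P.σ) * s * (M * S ^ P.σ) := by ring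
        _ = 768 * (α : ℝ) ^ (P.σ - 1) * s * (M * S ^ P.σ) := by rw [e3]
        _ ≤ _ := by
          gcongr
          have h1 : 0 ≤ (α : ℝ) ^ (-P.q) * s := by positivity
          have h2 : 0 ≤ (α : ℝ) ^ (P.σ - 1) * s := by positivity
          nlinarith

end StretchFold

namespace StretchFold

/-! ### Images of nearby leaves -/

variable {α : ℕ}

/-- Two leaves with `δ`-close bases, directions and lengths, in real coordinates. -/
structure CloseLeaves (W₁ W₂ : Leaf α) (x₁ y₁ x₂ y₂ δ : ℝ) : Prop where
  dx : |x₁ - x₂| ≤ δ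
  dy : |y₁ - y₂| ≤ δ
  d0 : |W₁.dir 0 - W₂.dir 0| ≤ δ
  d1 : |W₁.dir 1 - W₂.dir 1| ≤ δ
  dS : |W₁.len - W₂.len| ≤ δ

theorem exists_coe_norm_eq (x : UnitAddCircle) : ∃ d : ℝ, (d : UnitAddCircle) = x ∧ |d| = ‖x‖ := by
  obtain ⟨r, rfl⟩ := QuotientAddGroup.mk_surjective x
  refine ⟨r - round r, ?_, (UnitAddCircle.norm_eq).symm⟩
  rw [← sub_eq_zero, ← AddCircle.coe_sub, AddCircle.coe_eq_zero_iff]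
  exact ⟨-round r, by simp⟩

theorem exists_closeLeaves {W₁ W₂ : Leaf α} {δ : ℝ} (h : leafDist W₁ W₂ < δ) :
    ∃ x₁ y₁ x₂ y₂ : ℝ, W₁.base = ((x₁ : UnitAddCircle), (y₁ : UnitAddCircle)) ∧
      W₂.base = ((x₂ : UnitAddCircle), (y₂ : UnitAddCircle)) ∧ 1 ≤ y₁ ∧ y₁ ≤ 2 ∧
      CloseLeaves W₁ W₂ x₁ y₁ x₂ y₂ δ := by
  obtain ⟨x₁, y₁, h₁, hy1, hy2⟩ := W₁.exists_rep
  obtain ⟨a, ha, ha'⟩ := exists_coe_norm_eq (W₁.base.1 - W₂.base.1)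
  obtain ⟨b, hb, hb'⟩ := exists_coe_norm_eq (W₁.base.2 - W₂.base.2)
  unfold leafDist at h
  have t0 : 0 ≤ torusDist W₁.base W₂.base := Real.sqrt_nonneg _
  have n0 := norm_nonneg (W₁.dir - W₂.dir)
  have s0 := abs_nonneg (W₁.len - W₂.len)
  have hd := dist_le_torusDist W₁.base W₂.base
  rw [Prod.dist_eq, max_le_iff, dist_eq_norm, dist_eq_norm] at hd
  have hdir (i : Fin 2) : |W₁.dir i - W₂.dir i| ≤ ‖W₁.dir - W₂.dir‖ := by
    simpa using PiLp.norm_apply_le (W₁.dir - W₂.dir) i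
  refine ⟨x₁, y₁, x₁ - a, y₁ - b, h₁, ?_, hy1, hy2, ?_, ?_, ?_, ?_, ?_⟩
  · rw [AddCircle.coe_sub, AddCircle.coe_sub, ha, hb, h₁]; simp
  · rw [sub_sub_cancel, ha']; linarith [hd.1]
  · rw [sub_sub_cancel, hb']; linarith [hd.2]
  · linarith [hdir 0]
  · linarith [hdir 1]
  · linarith

theorem abs_mul_sub_mul_le {a b s t A T ε η : ℝ} (ha : |a| ≤ A) (ht : |t| ≤ T)
    (hab : |a - b| ≤ ε) (hst : |s - t| ≤ η) : |a * s - b * t| ≤ A * η + T * ε := by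
  have e : a * s - b * t = a * (s - t) + t * (a - b) := by ring
  rw [e]
  refine (abs_add_le _ _).trans ?_
  rw [abs_mul, abs_mul]
  exact add_le_add (mul_le_mul ha hst (abs_nonneg _) ((abs_nonneg _).trans ha))
    (mul_le_mul ht hab (abs_nonneg _) ((abs_nonneg _).trans ht))

/-! ### Distances between the images of close leaves -/

namespace CloseLeaves

variable {W₁ W₂ : Leaf α} {x₁ y₁ x₂ y₂ δ : ℝ} (h : CloseLeaves W₁ W₂ x₁ y₁ x₂ y₂ δ)

include h

theorem nonneg : 0 ≤ δ := (abs_nonneg _).trans h.dx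

theorem cut_close (hα : 4 ≤ α) (hy0 : 0 ≤ y₂) (hy3 : y₂ ≤ 3) {k : ℕ} (hk : k ≤ 8) :
    |W₁.cut y₁ k - W₂.cut y₂ k| ≤ 8 * δ := by
  have hδ := h.nonneg
  have hk' : (k : ℝ) ≤ 8 := by exact_mod_cast hk
  have hk0 : (0 : ℝ) ≤ k := Nat.cast_nonneg k
  have p₁ := W₁.dir_pos
  have p₂ := W₂.dir_pos
  have g₁ := W₁.dir_one_ge hα
  have g₂ := W₂.dir_one_ge hα
  have hq : |((k : ℝ) / 2 - y₁) / W₁.dir 1 - ((k : ℝ) / 2 - y₂) / W₂.dir 1| ≤ 8 * δ := by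
    have e : ((k : ℝ) / 2 - y₁) / W₁.dir 1 - ((k : ℝ) / 2 - y₂) / W₂.dir 1
        = (-((y₁ - y₂) * W₂.dir 1) - ((k : ℝ) / 2 - y₂) * (W₁.dir 1 - W₂.dir 1))
          / (W₁.dir 1 * W₂.dir 1) := by
      field_simp; ring
    rw [e, abs_div, abs_of_pos (mul_pos p₁ p₂), div_le_iff₀ (mul_pos p₁ p₂)]
    have h1 : |((k : ℝ) / 2 - y₂) * (W₁.dir 1 - W₂.dir 1)| ≤ 4 * δ := by
      rw [abs_mul]
      exact mul_le_mul (abs_le.2 ⟨by linarith, by linarith⟩) h.d1 (abs_nonneg _) (by norm_num)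
    have h2 : |(y₁ - y₂) * W₂.dir 1| ≤ δ * 1 := by
      rw [abs_mul, abs_of_pos p₂]
      exact mul_le_mul h.dy W₂.dir_one_le p₂.le hδ
    have h3 : 16 / 25 ≤ W₁.dir 1 * W₂.dir 1 := by nlinarith
    have h4 := abs_sub (-((y₁ - y₂) * W₂.dir 1)) (((k : ℝ) / 2 - y₂) * (W₁.dir 1 - W₂.dir 1))
    rw [abs_neg] at h4
    nlinarith
  unfold Leaf.cut
  refine (abs_max_sub_max_le_max _ _ _ _).trans (max_le (by simpa using hδ) ?_)
  exact (abs_min_sub_min_le_max _ _ _ _).trans (max_le (by linarith [h.dS]) hq)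

theorem base_close (k : ℕ) : |strandBase α x₁ y₁ k - strandBase α x₂ y₂ k| ≤ (1 + α) * δ := by
  have e : strandBase α x₁ y₁ k - strandBase α x₂ y₂ k
      = (x₁ - x₂) - strandSign k * α * (y₁ - y₂) := by unfold strandBase; ring
  rw [e]
  refine (abs_sub _ _).trans ?_
  rw [abs_mul, abs_mul, abs_strandSign, Nat.abs_cast]
  have := mul_le_mul_of_nonneg_left h.dy (Nat.cast_nonneg α : (0 : ℝ) ≤ α)
  linarith [h.dx]

theorem rate_close (k : ℕ) : |W₁.rate k - W₂.rate k| ≤ (1 + α) * δ := by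
  have e : W₁.rate k - W₂.rate k
      = (W₁.dir 0 - W₂.dir 0) - strandSign k * α * (W₁.dir 1 - W₂.dir 1) := by
    unfold Leaf.rate; ring
  rw [e]
  refine (abs_sub _ _).trans ?_
  rw [abs_mul, abs_mul, abs_strandSign, Nat.abs_cast]
  have := mul_le_mul_of_nonneg_left h.d1 (Nat.cast_nonneg α : (0 : ℝ) ≤ α)
  linarith [h.d0]

theorem end_close (hα : 4 ≤ α) (hy0 : 0 ≤ y₂) (hy3 : y₂ ≤ 3) {k j : ℕ} (hj : j ≤ 8) :
    |strandBase α x₁ y₁ k + W₁.rate k * W₁.cut y₁ j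
      - (strandBase α x₂ y₂ k + W₂.rate k * W₂.cut y₂ j)| ≤ 23 * (α * δ) := by
  have hα' : (4 : ℝ) ≤ α := by exact_mod_cast hα
  have hδ := h.nonneg
  rw [add_sub_add_comm]
  refine (abs_add_le _ _).trans ?_
  have h1 := h.base_close k
  have h2 := abs_mul_sub_mul_le (W₁.rate_bounds hα k).2.1
    (T := 1) (by rw [abs_of_nonneg (W₂.cut_mem y₂ j).1]; exact (W₂.cut_mem y₂ j).2.trans W₂.len_le)
    (h.rate_close k) (h.cut_close hα hy0 hy3 hj)
  nlinarith

theorem lo_close (hα : 4 ≤ α) (hy0 : 0 ≤ y₂) (hy3 : y₂ ≤ 3) {k : ℕ} (hk : k < 8) :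
    |W₁.lo x₁ y₁ k - W₂.lo x₂ y₂ k| ≤ 23 * (α * δ) :=
  (abs_min_sub_min_le_max _ _ _ _).trans
    (max_le (h.end_close hα hy0 hy3 hk.le) (h.end_close hα hy0 hy3 hk))

theorem hi_close (hα : 4 ≤ α) (hy0 : 0 ≤ y₂) (hy3 : y₂ ≤ 3) {k : ℕ} (hk : k < 8) :
    |W₁.hi x₁ y₁ k - W₂.hi x₂ y₂ k| ≤ 23 * (α * δ) :=
  (abs_max_sub_max_le_max _ _ _ _).trans
    (max_le (h.end_close hα hy0 hy3 hk.le) (h.end_close hα hy0 hy3 hk))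

/-- Positions and speeds of the images differ by as much as αδ, but division by a speed of order α
turns this into δ for the parameters of points at the same height. -/
theorem param_close (hα : 4 ≤ α) {k : ℕ} {z : ℝ} (hz : z ∈ Icc (W₂.lo x₂ y₂ k) (W₂.hi x₂ y₂ k)) :
    |(z - strandBase α x₁ y₁ k) / W₁.rate k - (z - strandBase α x₂ y₂ k) / W₂.rate k|
      ≤ 8 * δ := by
  have hα' : (4 : ℝ) ≤ α := by exact_mod_cast hα
  have hδ := h.nonneg
  have r₁ := W₁.rate_ne_zero hα k
  have r₂ := W₂.rate_ne_zero hα k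
  have ht := W₂.strand_mapsTo hα hz
  set t := (z - strandBase α x₂ y₂ k) / W₂.rate k with htd
  have hzt : z = strandBase α x₂ y₂ k + W₂.rate k * t := by rw [htd]; field_simp; ring
  have e : (z - strandBase α x₁ y₁ k) / W₁.rate k - t
      = (strandBase α x₂ y₂ k - strandBase α x₁ y₁ k - t * (W₁.rate k - W₂.rate k))
        / W₁.rate k := by
    rw [hzt]; field_simp; ring
  rw [e, abs_div, div_le_iff₀ (abs_pos.2 r₁)]
  have h1 := h.base_close k
  rw [abs_sub_comm] at h1
  have h2 : |t * (W₁.rate k - W₂.rate k)| ≤ 1 * ((1 + α) * δ) := by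
    rw [abs_mul, abs_of_nonneg ht.1]
    exact mul_le_mul (ht.2.trans W₂.len_le) (h.rate_close k) (abs_nonneg _) zero_le_one
  have h3 := (W₁.rate_bounds hα k).1
  have h4 := abs_sub (strandBase α x₂ y₂ k - strandBase α x₁ y₁ k) (t * (W₁.rate k - W₂.rate k))
  nlinarith

omit h in
-- The horizontal coordinate of the image is the vertical coordinate of the leaf. The second
-- identity recovers it from the horizontal coordinate of the leaf through the shear relation, with
-- a factor α on the left. Comparing two leaves in this form at the same height z is what contracts
-- their distance to δ/α in `graph_close`.
theorem graph_height (hα : 4 ≤ α) (W : Leaf α) (x y z : ℝ) (k : ℕ) :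
    W.icept x y k + W.slope k * z = y + (z - strandBase α x y k) / W.rate k * W.dir 1 ∧
    strandSign k * α * (W.icept x y k + W.slope k * z)
      = x + (z - strandBase α x y k) / W.rate k * W.dir 0 - z := by
  have r := W.rate_ne_zero hα k
  have e1 : W.icept x y k + W.slope k * z
      = y + (z - strandBase α x y k) / W.rate k * W.dir 1 := by
    unfold Leaf.icept Leaf.slope; field_simp; ring
  refine ⟨e1, ?_⟩
  set t := (z - strandBase α x y k) / W.rate k with ht
  have hz : z = strandBase α x y k + W.rate k * t := by rw [ht]; field_simp; ring
  rw [e1]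
  rw [hz, strandBase, Leaf.rate]
  ring

theorem graph_close (hα : 4 ≤ α) {k : ℕ} {z : ℝ} (hz : z ∈ Icc (W₂.lo x₂ y₂ k) (W₂.hi x₂ y₂ k)) :
    |W₁.icept x₁ y₁ k + W₁.slope k * z - (W₂.icept x₂ y₂ k + W₂.slope k * z)|
      ≤ 10 * (δ * (α : ℝ)⁻¹) := by
  have hα' : (4 : ℝ) ≤ α := by exact_mod_cast hα
  have hp := h.param_close hα hz
  have ht := W₂.strand_mapsTo hα hz
  have e₁ := (graph_height hα W₁ x₁ y₁ z k).2
  have e₂ := (graph_height hα W₂ x₂ y₂ z k).2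
  set t₁ := (z - strandBase α x₁ y₁ k) / W₁.rate k
  set t₂ := (z - strandBase α x₂ y₂ k) / W₂.rate k
  set Y₁ := W₁.icept x₁ y₁ k + W₁.slope k * z
  set Y₂ := W₂.icept x₂ y₂ k + W₂.slope k * z
  have e : strandSign k * α * (Y₁ - Y₂) = (x₁ - x₂) + (W₁.dir 0 * t₁ - W₂.dir 0 * t₂) := by
    linear_combination e₁ - e₂
  have h1 := congrArg abs e
  rw [abs_mul, abs_mul, abs_strandSign, Nat.abs_cast, one_mul] at h1
  have h2 := abs_mul_sub_mul_le W₁.abs_dir_zero_le (T := 1)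
    (by rw [abs_of_nonneg ht.1]; exact ht.2.trans W₂.len_le) h.d0 hp
  have h3 := abs_add_le (x₁ - x₂) (W₁.dir 0 * t₁ - W₂.dir 0 * t₂)
  have h4 : α * |Y₁ - Y₂| ≤ 10 * δ := by linarith [h.dx]
  rw [← mul_assoc, ← div_eq_mul_inv, le_div_iff₀ (by linarith)]
  linarith

/-- The shear cancels in the numerator, which is the determinant of the two directions and of order
δ, whereas the denominator is of order α². The weaker bound δ/α is all that is needed. -/
theorem slope_close (hα : 4 ≤ α) (k : ℕ) :
    |W₁.slope k - W₂.slope k| ≤ 10 * (δ * (α : ℝ)⁻¹) := by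
  have hα' : (4 : ℝ) ≤ α := by exact_mod_cast hα
  have hδ := h.nonneg
  have r₁ := W₁.rate_ne_zero hα k
  have r₂ := W₂.rate_ne_zero hα k
  have e : W₁.slope k - W₂.slope k
      = (W₁.dir 1 * W₂.dir 0 - W₂.dir 1 * W₁.dir 0) / (W₁.rate k * W₂.rate k) := by
    rw [Leaf.slope, Leaf.slope, div_sub_div _ _ r₁ r₂]
    congr 1
    unfold Leaf.rate; ring
  have hd := h.d0
  rw [abs_sub_comm] at hd
  have h1 := abs_mul_sub_mul_le (A := 1) (by rw [abs_of_pos W₁.dir_pos]; exact W₁.dir_one_le)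
    W₁.abs_dir_zero_le h.d1 hd
  have h2 : (α : ℝ) / 2 * (α / 2) ≤ |W₁.rate k| * |W₂.rate k| :=
    mul_le_mul (W₁.rate_bounds hα k).1 (W₂.rate_bounds hα k).1 (by positivity) (abs_nonneg _)
  rw [e, abs_div, abs_mul, div_le_iff₀ (by positivity)]
  refine h1.trans ?_
  have h3 : 10 * (δ * (α : ℝ)⁻¹) * ((α : ℝ) / 2 * (α / 2)) = 5 / 2 * (α * δ) := by
    field_simp; ring
  calc 1 * δ + 1 * δ ≤ 5 / 2 * (α * δ) := by nlinarith
    _ ≤ _ := by rw [← h3]; gcongr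

theorem rate_inv_close (hα : 4 ≤ α) (k : ℕ) :
    |(|W₁.rate k|⁻¹ - |W₂.rate k|⁻¹)| ≤ 8 * (δ * (α : ℝ)⁻¹) := by
  have hα' : (4 : ℝ) ≤ α := by exact_mod_cast hα
  have hδ := h.nonneg
  have r₁ := abs_pos.2 (W₁.rate_ne_zero hα k)
  have r₂ := abs_pos.2 (W₂.rate_ne_zero hα k)
  have e : |W₁.rate k|⁻¹ - |W₂.rate k|⁻¹
      = |W₁.rate k|⁻¹ * |W₂.rate k|⁻¹ * (|W₂.rate k| - |W₁.rate k|) := by field_simp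
  rw [e, abs_mul, abs_of_pos (by positivity)]
  have h1 : |(|W₂.rate k| - |W₁.rate k|)| ≤ 2 * (α * δ) := by
    rw [abs_sub_comm]
    refine (abs_abs_sub_abs_le_abs_sub _ _).trans ((h.rate_close k).trans ?_)
    nlinarith
  calc _ ≤ 2 * (α : ℝ)⁻¹ * (2 * (α : ℝ)⁻¹) * (2 * (α * δ)) := by
        gcongr
        · exact W₁.rate_inv_le hα k
        · exact W₂.rate_inv_le hα k
    _ = _ := by field_simp; ring

theorem test_close (hα : 4 ≤ α) {k : ℕ} {u₁ u₂ : ℝ → ℂ} (hu₁ : TestOn 0 W₁.len 1 1 u₁)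
    (hu₂ : TestOn 0 W₂.len 1 1 u₂) (hu : ∀ t ∈ Icc 0 (min W₁.len W₂.len), ‖u₁ t - u₂ t‖ ≤ δ)
    {z : ℝ} (hz₁ : z ∈ Icc (W₁.lo x₁ y₁ k) (W₁.hi x₁ y₁ k))
    (hz₂ : z ∈ Icc (W₂.lo x₂ y₂ k) (W₂.hi x₂ y₂ k)) :
    ‖u₁ ((z - strandBase α x₁ y₁ k) / W₁.rate k) - u₂ ((z - strandBase α x₂ y₂ k) / W₂.rate k)‖
      ≤ 9 * δ := by
  have hp := h.param_close hα hz₂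
  have ht₁ := W₁.strand_mapsTo hα hz₁
  have ht₂ := W₂.strand_mapsTo hα hz₂
  set t₁ := (z - strandBase α x₁ y₁ k) / W₁.rate k
  set t₂ := (z - strandBase α x₂ y₂ k) / W₂.rate k
  -- The smaller of the two parameters belongs to both leaves, so there the two test functions can
  -- be compared directly.
  rcases le_total t₁ t₂ with hle | hle
  · have hm : t₁ ∈ Icc 0 W₂.len := ⟨ht₁.1, hle.trans ht₂.2⟩
    have a1 := hu t₁ ⟨ht₁.1, le_min ht₁.2 hm.2⟩
    have a2 := hu₂.lip t₁ hm t₂ ht₂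
    have a3 := norm_sub_le_norm_sub_add_norm_sub (u₁ t₁) (u₂ t₁) (u₂ t₂)
    linarith
  · have hm : t₂ ∈ Icc 0 W₁.len := ⟨ht₂.1, hle.trans ht₁.2⟩
    have a1 := hu t₂ ⟨ht₂.1, le_min hm.2 ht₂.2⟩
    have a2 := hu₁.lip t₁ ht₁ t₂ hm
    have a3 := norm_sub_le_norm_sub_add_norm_sub (u₁ t₁) (u₁ t₂) (u₂ t₂)
    linarith

end CloseLeaves

end StretchFold

namespace StretchFold

/-! ### The unstable estimate of the half step -/

variable {α : ℕ}

/-- Comparison of two integrals on their common interval, the remainders being estimated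
separately. -/
theorem norm_integral_sub_le_common {F₁ F₂ : ℝ → C2} {a₁ b₁ a₂ b₂ D R K : ℝ} (h₁ : a₁ ≤ b₁)
    (h₂ : a₂ ≤ b₂) (i₁ : IntervalIntegrable F₁ volume a₁ b₁)
    (i₂ : IntervalIntegrable F₂ volume a₂ b₂) (ha : |a₁ - a₂| ≤ D) (hb : |b₁ - b₂| ≤ D)
    (hR₁ : ∀ a b, a₁ ≤ a → a ≤ b → b ≤ b₁ → b - a ≤ D → ‖∫ z in a..b, F₁ z‖ ≤ R)
    (hR₂ : ∀ a b, a₂ ≤ a → a ≤ b → b ≤ b₂ → b - a ≤ D → ‖∫ z in a..b, F₂ z‖ ≤ R)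
    (hK0 : 0 ≤ K) (hK : ∀ a b, a₁ ≤ a → a₂ ≤ a → a ≤ b → b ≤ b₁ → b ≤ b₂ →
      ‖(∫ z in a..b, F₁ z) - ∫ z in a..b, F₂ z‖ ≤ K) :
    ‖(∫ z in a₁..b₁, F₁ z) - ∫ z in a₂..b₂, F₂ z‖ ≤ 4 * R + K := by
  have hD0 : 0 ≤ D := (abs_nonneg _).trans ha
  have hR0 : 0 ≤ R := (norm_nonneg _).trans (hR₁ a₁ a₁ le_rfl le_rfl h₁ (by simpa using hD0))
  rw [abs_le] at ha hb
  rcases le_or_gt (max a₁ a₂) (min b₁ b₂) with hle | hlt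
  · set a := max a₁ a₂ with had
    set b := min b₁ b₂ with hbd
    have l₁ : a₁ ≤ a := le_max_left _ _
    have l₂ : a₂ ≤ a := le_max_right _ _
    have m₁ : b ≤ b₁ := min_le_left _ _
    have m₂ : b ≤ b₂ := min_le_right _ _
    have da₁ : a - a₁ ≤ D := by
      rw [had]; rcases max_cases a₁ a₂ with h | h <;> rw [h.1] <;> linarith
    have da₂ : a - a₂ ≤ D := by
      rw [had]; rcases max_cases a₁ a₂ with h | h <;> rw [h.1] <;> linarith
    have db₁ : b₁ - b ≤ D := by
      rw [hbd]; rcases min_cases b₁ b₂ with h | h <;> rw [h.1] <;> linarith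
    have db₂ : b₂ - b ≤ D := by
      rw [hbd]; rcases min_cases b₁ b₂ with h | h <;> rw [h.1] <;> linarith
    have split {F : ℝ → C2} {c d : ℝ} (hi : IntervalIntegrable F volume c d) (hca : c ≤ a)
        (hbd : b ≤ d) : ∫ z in c..d, F z
          = (∫ z in c..a, F z) + (∫ z in a..b, F z) + ∫ z in b..d, F z := by
      have s (x y : ℝ) (h1 : c ≤ x) (h2 : x ≤ y) (h3 : y ≤ d) :
          IntervalIntegrable F volume x y := by
        refine hi.mono_set ?_
        rw [uIcc_of_le h2, uIcc_of_le (by linarith)]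
        exact Icc_subset_Icc h1 h3
      rw [intervalIntegral.integral_add_adjacent_intervals (s c a le_rfl hca (by linarith))
          (s a b hca hle hbd),
        intervalIntegral.integral_add_adjacent_intervals (s c b le_rfl (by linarith) hbd)
          (s b d (by linarith) hbd le_rfl)]
    rw [split i₁ l₁ m₁, split i₂ l₂ m₂]
    have r₁ := hR₁ a₁ a le_rfl l₁ (hle.trans m₁) da₁
    have r₂ := hR₁ b b₁ (l₁.trans hle) m₁ le_rfl db₁
    have r₃ := hR₂ a₂ a le_rfl l₂ (hle.trans m₂) da₂
    have r₄ := hR₂ b b₂ (l₂.trans hle) m₂ le_rfl db₂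
    have k := hK a b l₁ l₂ hle m₁ m₂
    set A₁ := ∫ z in a₁..a, F₁ z
    set A₂ := ∫ z in a₂..a, F₂ z
    set M₁ := ∫ z in a..b, F₁ z
    set M₂ := ∫ z in a..b, F₂ z
    set B₁ := ∫ z in b..b₁, F₁ z
    set B₂ := ∫ z in b..b₂, F₂ z
    have e : A₁ + M₁ + B₁ - (A₂ + M₂ + B₂) = (A₁ - A₂) + (B₁ - B₂) + (M₁ - M₂) := by abel
    rw [e]
    refine (norm_add_le _ _).trans ?_
    have n₁ := norm_add_le (A₁ - A₂) (B₁ - B₂)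
    have n₂ := norm_sub_le A₁ A₂
    have n₃ := norm_sub_le B₁ B₂
    linarith
  -- Without a common part, closeness of the endpoints forces both intervals to be shorter than D.
  · have hd₁ : b₁ - a₁ ≤ D := by
      rcases max_cases a₁ a₂ with h | h <;> rcases min_cases b₁ b₂ with h' | h' <;>
        rw [h.1, h'.1] at hlt <;> linarith
    have hd₂ : b₂ - a₂ ≤ D := by
      rcases max_cases a₁ a₂ with h | h <;> rcases min_cases b₁ b₂ with h' | h' <;>
        rw [h.1, h'.1] at hlt <;> linarith
    have r₁ := hR₁ a₁ b₁ le_rfl h₁ le_rfl hd₁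
    have r₂ := hR₂ a₂ b₂ le_rfl h₂ le_rfl hd₂
    have n := norm_sub_le (∫ z in a₁..b₁, F₁ z) (∫ z in a₂..b₂, F₂ z)
    linarith

/-- Powers of a small distance. -/
theorem rpow_dist_le {δ β x : ℝ} (hα : 1 ≤ α) (hδ : 0 < δ) (hδα : δ ≤ 2 / (α : ℝ))
    (h1 : β ≤ x) (h2 : x ≤ β + 1) : δ ^ x ≤ 2 * (α : ℝ) ^ (β - x) * δ ^ β := by
  have hα0 : (0 : ℝ) < α := by exact_mod_cast hα
  calc δ ^ x = δ ^ (x - β) * δ ^ β := by rw [← Real.rpow_add hδ]; simp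
    _ ≤ (2 / (α : ℝ)) ^ (x - β) * δ ^ β := by
        gcongr
    _ = (2 : ℝ) ^ (x - β) * (α : ℝ) ^ (β - x) * δ ^ β := by
        rw [Real.div_rpow (by norm_num) hα0.le, div_eq_mul_inv, ← Real.rpow_neg hα0.le, neg_sub]
    _ ≤ _ := by
        gcongr
        conv_rhs => rw [← Real.rpow_one 2]
        exact Real.rpow_le_rpow_of_exponent_le (by norm_num) (by linarith)

set_option maxHeartbeats 3000000 in
-- Three contributions, up to constants. The unmatched ends have height αδ, and the stable norm
-- gives α⁻¹(αδ)^σ. One test function on two graphs at distance δ/α gives (δ/α)^β in the unstable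
-- norm, plus a smaller stable term from the unequal arc-length factors. The change of test function
-- on the second graph has supremum δ/α and Lipschitz constant α⁻², so over about α pieces
-- interpolation gives α^(-q) δ^(1-q). As δ ≤ 2/α, the conditions β < σ and β < 1 - q turn the
-- stable terms into α^(β-1) δ^β.
theorem unstable_strand {P : Params} (hα : 100 ≤ α) {f : Torus → C2} (hf : BddMeas f) {s v : ℝ}
    (hs0 : 0 ≤ s) (hs : stableENorm P α f ≤ ENNReal.ofReal s) (hv0 : 0 ≤ v)
    (hv : unstableENorm P α f ≤ ENNReal.ofReal v) {W₁ W₂ : Leaf α} {x₁ y₁ x₂ y₂ δ : ℝ}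
    (h : CloseLeaves W₁ W₂ x₁ y₁ x₂ y₂ δ) (hδ : 0 < δ) (hδα : δ ≤ 2 / (α : ℝ))
    (hy0 : 0 ≤ y₂) (hy3 : y₂ ≤ 3)
    {u₁ u₂ : ℝ → ℂ} (hu₁ : TestOn 0 W₁.len 1 1 u₁) (hu₂ : TestOn 0 W₂.len 1 1 u₂)
    (hu : ∀ t ∈ Icc 0 (min W₁.len W₂.len), ‖u₁ t - u₂ t‖ ≤ δ) {k : ℕ} (hk : k < 8) :
    ‖W₁.strandInt x₁ y₁ f u₁ k - W₂.strandInt x₂ y₂ f u₂ k‖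
      ≤ 200000 * ((α : ℝ) ^ (P.β - 1) * s + (α : ℝ) ^ (-P.β) * v) * δ ^ P.β := by
  have hα4 : 4 ≤ α := by omega
  have hα1 : 1 ≤ α := by omega
  have hα' : (100 : ℝ) ≤ α := by exact_mod_cast hα
  have hα0 : (0 : ℝ) < α := by linarith
  have hq := P.q_pos
  have hq1 := P.q_lt
  have hσ := P.σ_pos
  have hσ1 := P.σ_lt
  have hβ := P.β_pos
  have hβ1 := P.β_lt
  have hβσ := P.β_lt_σ
  have hβq := P.β_lt_q
  have hαδ : α * δ ≤ 2 := by
    have := mul_le_mul_of_nonneg_left hδα hα0.le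
    rwa [mul_div_cancel₀ _ hα0.ne'] at this
  have hδ1 : δ ≤ 1 / 50 := by nlinarith
  have hinv : 0 < (α : ℝ)⁻¹ := by positivity
  have hinv100 : (α : ℝ)⁻¹ ≤ 100⁻¹ := inv_anti₀ (by norm_num) hα'
  -- The bound of `graph_close` and `slope_close`; α ≥ 100 makes 5ε admissible in the unstable norm.
  set ε := 10 * (δ * (α : ℝ)⁻¹) with hε
  have hε0 : 0 < ε := by positivity
  have hεα : 5 * ε ≤ 2 / (α : ℝ) := by
    rw [div_eq_mul_inv, hε]
    nlinarith
  have hε1 : ε ≤ 1 := by nlinarith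
  rw [W₁.strandInt_eq hα4, W₂.strandInt_eq hα4, ← intervalIntegral.integral_smul,
    ← intervalIntegral.integral_smul]
  have sl₁ := W₁.abs_slope_le hα4 k
  have sl₂ := W₂.abs_slope_le hα4 k
  have so₁ := W₁.abs_slope_le_one hα4 k
  have so₂ := W₂.abs_slope_le_one hα4 k
  have ri₁ := W₁.rate_inv_le hα4 k
  have ri₂ := W₂.rate_inv_le hα4 k
  have rn₁ : 0 ≤ |W₁.rate k|⁻¹ := by positivity
  have rn₂ : 0 ≤ |W₂.rate k|⁻¹ := by positivity
  have hg₁ := W₁.strand_testOn hα4 x₁ y₁ k zero_le_one hu₁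
  have hg₂ := W₂.strand_testOn hα4 x₂ y₂ k zero_le_one hu₂
  rw [one_mul] at hg₁ hg₂
  have hclose := fun z (hz₁ : z ∈ Icc (W₁.lo x₁ y₁ k) (W₁.hi x₁ y₁ k))
    (hz₂ : z ∈ Icc (W₂.lo x₂ y₂ k) (W₂.hi x₂ y₂ k)) => h.test_close hα4 hu₁ hu₂ hu hz₁ hz₂
  have hgraph := fun z (hz₂ : z ∈ Icc (W₂.lo x₂ y₂ k) (W₂.hi x₂ y₂ k)) => h.graph_close hα4 hz₂
  set g₁ : ℝ → ℂ := fun z => u₁ ((z - strandBase α x₁ y₁ k) / W₁.rate k) with hg₁d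
  set g₂ : ℝ → ℂ := fun z => u₂ ((z - strandBase α x₂ y₂ k) / W₂.rate k) with hg₂d
  have hslope := h.slope_close hα4 k
  have hrinv := h.rate_inv_close hα4 k
  have hlen := W₁.hi_sub_lo_le hα4 x₁ y₁ k
  have hS1 := W₁.len_le
  have hS0 := W₁.len_pos
  -- remainders
  have hrem (W : Leaf α) (x y : ℝ) (g : ℝ → ℂ)
      (hg : TestOn (W.lo x y k) (W.hi x y k) 1 (2 * (α : ℝ)⁻¹) g) (a b : ℝ)
      (ha : W.lo x y k ≤ a) (hab : a ≤ b) (hb : b ≤ W.hi x y k) (hd : b - a ≤ 23 * (α * δ)) :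
      ‖∫ z in a..b, |W.rate k|⁻¹ • g z • f (graphPt (W.icept x y k) (W.slope k) z)‖
        ≤ 35328 * (α : ℝ) ^ (P.β - 1) * s * δ ^ P.β := by
    have hg' := hg.mono ha hb (show (1 : ℝ) ≤ 2 by norm_num) (show 2 * (α : ℝ)⁻¹ ≤ 1 by linarith)
    have hR := graph_stable_long (c := W.icept x y k) (W.abs_slope_le hα4 k)
      (W.abs_slope_le_one hα4 k) hf hs hs0 hab
      two_pos zero_le_one hg' fun z hz z' hz' => ?_
    · rw [intervalIntegral.integral_smul, norm_smul, Real.norm_of_nonneg (by positivity)]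
      have hba : 0 ≤ b - a := by linarith
      have h23 : (23 * (α * δ)) ^ P.σ ≤ 23 * ((α : ℝ) ^ P.σ * δ ^ P.σ) := by
        rw [Real.mul_rpow (by norm_num) (by positivity), Real.mul_rpow hα0.le hδ.le]
        gcongr
        conv_rhs => rw [← Real.rpow_one 23]
        exact Real.rpow_le_rpow_of_exponent_le (by norm_num) hσ1.le
      have hpow : (α : ℝ)⁻¹ * ((α : ℝ) ^ P.σ * (α : ℝ) ^ (P.β - P.σ)) = (α : ℝ) ^ (P.β - 1) := by
        rw [← Real.rpow_add hα0, Real.rpow_sub_one hα0.ne', add_sub_cancel]; ring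
      calc |W.rate k|⁻¹ * ‖∫ z in a..b, g z • f (graphPt (W.icept x y k) (W.slope k) z)‖
          ≤ 2 * (α : ℝ)⁻¹ * ((2 * (46) + 2) * (2 * 2 * s * (23 * (α * δ)) ^ P.σ)) := by
            refine mul_le_mul (W.rate_inv_le hα4 k) (hR.trans ?_) (norm_nonneg _) (by positivity)
            gcongr
            linarith
        _ ≤ 2 * (α : ℝ)⁻¹ * ((2 * (46) + 2) * (2 * 2 * s * (23 * ((α : ℝ) ^ P.σ *
              (2 * (α : ℝ) ^ (P.β - P.σ) * δ ^ P.β))))) := by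
            gcongr
            refine h23.trans ?_
            gcongr
            exact rpow_dist_le hα1 hδ hδα hβσ.le (by linarith)
        _ = 34592 * ((α : ℝ)⁻¹ * ((α : ℝ) ^ P.σ * (α : ℝ) ^ (P.β - P.σ))) * s * δ ^ P.β := by ring
        _ ≤ _ := by
            rw [hpow]
            gcongr
            norm_num
    · have l1 := hg'.lip z hz z' hz'
      have l2 := norm_sub_le (g z) (g z')
      have l3 := hg.bdd z ⟨ha.trans hz.1, hz.2.trans hb⟩
      have l4 := hg.bdd z' ⟨ha.trans hz'.1, hz'.2.trans hb⟩
      -- The Hölder constant 2 comes from the Lipschitz bound at distances up to one and from the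
      -- supremum beyond.
      rcases le_or_gt |z - z'| 1 with hc | hc
      · have : |z - z'| ≤ |z - z'| ^ P.q := by
          conv_lhs => rw [← Real.rpow_one |z - z'|]
          rcases (abs_nonneg (z - z')).eq_or_lt with h0 | h0
          · rw [← h0, Real.rpow_one]; exact Real.rpow_nonneg le_rfl _
          · exact Real.rpow_le_rpow_of_exponent_ge h0 hc hq1.le
        linarith [abs_nonneg (z - z')]
      · have : 1 ≤ |z - z'| ^ P.q := Real.one_le_rpow hc.le hq.le
        linarith
  have hint (W : Leaf α) (x y : ℝ) (g : ℝ → ℂ)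
      (hg : TestOn (W.lo x y k) (W.hi x y k) 1 (2 * (α : ℝ)⁻¹) g) : IntervalIntegrable
      (fun z => |W.rate k|⁻¹ • g z • f (graphPt (W.icept x y k) (W.slope k) z)) volume
      (W.lo x y k) (W.hi x y k) :=
    (graph_integrable hf (W.lo_le_hi x y k) hg).smul |W.rate k|⁻¹
  -- The single scale to which every error charged to the stable norm is reduced.
  set D₁ := (α : ℝ) ^ (P.β - 1) * δ ^ P.β with hD₁
  have hD₁0 : 0 ≤ D₁ := by positivity
  have hN2 : δ ≤ 2 * D₁ := by
    have := rpow_dist_le hα1 hδ hδα hβ1.le (show (1 : ℝ) ≤ P.β + 1 by linarith)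
    rw [Real.rpow_one] at this
    linarith
  have hN4 : (α : ℝ) ^ (-P.q) * δ ^ (1 - P.q) ≤ 2 * D₁ := by
    have h1 := rpow_dist_le hα1 hδ hδα hβq.le (show 1 - P.q ≤ P.β + 1 by linarith)
    have h2 : (α : ℝ) ^ (-P.q) * (α : ℝ) ^ (P.β - (1 - P.q)) = (α : ℝ) ^ (P.β - 1) := by
      rw [← Real.rpow_add hα0]; congr 1; ring
    calc (α : ℝ) ^ (-P.q) * δ ^ (1 - P.q)
        ≤ (α : ℝ) ^ (-P.q) * (2 * (α : ℝ) ^ (P.β - (1 - P.q)) * δ ^ P.β) := by gcongr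
      _ = 2 * ((α : ℝ) ^ (-P.q) * (α : ℝ) ^ (P.β - (1 - P.q))) * δ ^ P.β := by ring
      _ = _ := by rw [h2, hD₁]; ring
  have hN3 : (α : ℝ)⁻¹ * δ ^ (1 - P.q) ≤ 2 * D₁ := by
    refine le_trans ?_ hN4
    gcongr
    rw [← Real.rpow_neg_one]
    exact Real.rpow_le_rpow_of_exponent_le (by linarith) (by linarith)
  have hbase_pow {c : ℝ} (hc : 1 ≤ c) {r : ℝ} (hr : r ≤ 1) : c ^ r ≤ c := by
    conv_rhs => rw [← Real.rpow_one c]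
    exact Real.rpow_le_rpow_of_exponent_le hc hr
  -- the common part
  have hcommon (a b : ℝ) (ha₁ : W₁.lo x₁ y₁ k ≤ a) (ha₂ : W₂.lo x₂ y₂ k ≤ a) (hab : a ≤ b)
      (hb₁ : b ≤ W₁.hi x₁ y₁ k) (hb₂ : b ≤ W₂.hi x₂ y₂ k) :
      ‖(∫ z in a..b, |W₁.rate k|⁻¹ • g₁ z • f (graphPt (W₁.icept x₁ y₁ k) (W₁.slope k) z))
        - ∫ z in a..b, |W₂.rate k|⁻¹ • g₂ z • f (graphPt (W₂.icept x₂ y₂ k) (W₂.slope k) z)‖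
        ≤ 50000 * D₁ * s + 1200 * (α : ℝ) ^ (-P.β) * δ ^ P.β * v := by
    have hsub₁ {z} (hz : z ∈ Icc a b) : z ∈ Icc (W₁.lo x₁ y₁ k) (W₁.hi x₁ y₁ k) :=
      Icc_subset_Icc ha₁ hb₁ hz
    have hsub₂ {z} (hz : z ∈ Icc a b) : z ∈ Icc (W₂.lo x₂ y₂ k) (W₂.hi x₂ y₂ k) :=
      Icc_subset_Icc ha₂ hb₂ hz
    have t₁ := hg₁.mono ha₁ hb₁ le_rfl le_rfl
    have t₂ := hg₂.mono ha₂ hb₂ le_rfl le_rfl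
    have hba : 2 * (b - a) + 2 ≤ 6 * α := by nlinarith
    have hba0 : 0 ≤ 2 * (b - a) + 2 := by linarith
    -- the same test function on both graphs
    have p1 : ‖∫ z in a..b, (g₁ z • f (graphPt (W₁.icept x₁ y₁ k) (W₁.slope k) z)
        - g₁ z • f (graphPt (W₂.icept x₂ y₂ k) (W₂.slope k) z))‖
        ≤ 6 * α * (2 * v * (5 * ε) ^ P.β
          + 2 * s * (2 * ε + (4 * ε) ^ (1 - P.q) * (5 * (2 * (α : ℝ)⁻¹)) ^ P.q)) := by
      refine (norm_integral_le_of_short hab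
        ((graph_integrable hf hab t₁).sub (graph_integrable hf hab t₁))
        fun a' b' q1 q2 q3 q4 => ?_).trans (mul_le_mul_of_nonneg_right hba (by positivity))
      have t := t₁.mono q1 q3 le_rfl le_rfl
      rw [intervalIntegral.integral_sub (graph_integrable hf q2 t) (graph_integrable hf q2 t)]
      exact graph_unstable hf hv hv0 hs hs0 sl₁ so₁ sl₂ so₂ q2 q4 hε0 hεα hε1
        (hgraph a' (hsub₂ ⟨q1, q2.trans q3⟩)) hslope (by positivity) (by linarith) t
    -- different test functions on the second graph
    set G : ℝ → ℂ := fun z => ((|W₁.rate k|⁻¹ : ℝ) : ℂ) * g₁ z - ((|W₂.rate k|⁻¹ : ℝ) : ℂ) * g₂ z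
    -- 26 = 8 + 2 · 9: the difference of the Jacobians, and one Jacobian times the difference of the
    -- test functions. The Lipschitz constant is two terms (2/α)(2/α).
    have hG : TestOn a b (26 * (δ * (α : ℝ)⁻¹)) (8 * ((α : ℝ)⁻¹ * (α : ℝ)⁻¹)) G := by
      constructor
      · intro z hz
        have e : G z = ((|W₁.rate k|⁻¹ - |W₂.rate k|⁻¹ : ℝ) : ℂ) * g₁ z
            + ((|W₂.rate k|⁻¹ : ℝ) : ℂ) * (g₁ z - g₂ z) := by
          simp only [G]; push_cast; ring
        rw [e]
        refine (norm_add_le _ _).trans ?_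
        rw [norm_mul, norm_mul, Complex.norm_real, Complex.norm_real, Real.norm_eq_abs,
          Real.norm_of_nonneg rn₂]
        have b1 := t₁.bdd z hz
        have b2 := hclose z (hsub₁ hz) (hsub₂ hz)
        have b3 : |W₂.rate k|⁻¹ * ‖g₁ z - g₂ z‖ ≤ 2 * (α : ℝ)⁻¹ * (9 * δ) :=
          mul_le_mul ri₂ b2 (norm_nonneg _) (by positivity)
        have b4 : |(|W₁.rate k|⁻¹ - |W₂.rate k|⁻¹)| * ‖g₁ z‖ ≤ 8 * (δ * (α : ℝ)⁻¹) * 1 :=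
          mul_le_mul hrinv b1 (norm_nonneg _) (by positivity)
        linarith
      · have c₁ := t₁.const_mul ((|W₁.rate k|⁻¹ : ℝ) : ℂ)
        have c₂ := t₂.const_mul ((|W₂.rate k|⁻¹ : ℝ) : ℂ)
        rw [Complex.norm_real, Real.norm_of_nonneg (by positivity)] at c₁ c₂
        intro z hz z' hz'
        refine ((c₁.sub c₂).lip z hz z' hz').trans ?_
        refine mul_le_mul_of_nonneg_right ?_ (abs_nonneg _)
        have d₁ : |W₁.rate k|⁻¹ * (2 * (α : ℝ)⁻¹) ≤ 2 * (α : ℝ)⁻¹ * (2 * (α : ℝ)⁻¹) :=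
          mul_le_mul_of_nonneg_right ri₁ (by positivity)
        have d₂ : |W₂.rate k|⁻¹ * (2 * (α : ℝ)⁻¹) ≤ 2 * (α : ℝ)⁻¹ * (2 * (α : ℝ)⁻¹) :=
          mul_le_mul_of_nonneg_right ri₂ (by positivity)
        linarith
    have p2 := graph_interp_long (c := W₂.icept x₂ y₂ k) sl₂ so₂ hf hs hs0 hab (by positivity)
      (by positivity) hG
    have eq : (∫ z in a..b, |W₁.rate k|⁻¹ • g₁ z • f (graphPt (W₁.icept x₁ y₁ k) (W₁.slope k) z))
        - ∫ z in a..b, |W₂.rate k|⁻¹ • g₂ z • f (graphPt (W₂.icept x₂ y₂ k) (W₂.slope k) z)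
        = |W₁.rate k|⁻¹ • (∫ z in a..b, (g₁ z • f (graphPt (W₁.icept x₁ y₁ k) (W₁.slope k) z)
        - g₁ z • f (graphPt (W₂.icept x₂ y₂ k) (W₂.slope k) z)))
        + ∫ z in a..b, G z • f (graphPt (W₂.icept x₂ y₂ k) (W₂.slope k) z) := by
      have j1 := graph_integrable (c := W₁.icept x₁ y₁ k) (κ := W₁.slope k) hf hab t₁
      have j2 := graph_integrable (c := W₂.icept x₂ y₂ k) (κ := W₂.slope k) hf hab t₁
      have j3 := graph_integrable (c := W₂.icept x₂ y₂ k) (κ := W₂.slope k) hf hab t₂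
      have j4 := graph_integrable (c := W₂.icept x₂ y₂ k) (κ := W₂.slope k) hf hab hG
      have e4 : ∫ z in a..b, G z • f (graphPt (W₂.icept x₂ y₂ k) (W₂.slope k) z)
          = (|W₁.rate k|⁻¹ • ∫ z in a..b, g₁ z • f (graphPt (W₂.icept x₂ y₂ k) (W₂.slope k) z))
          - |W₂.rate k|⁻¹ • ∫ z in a..b, g₂ z • f (graphPt (W₂.icept x₂ y₂ k) (W₂.slope k) z) := by
        have j2' : IntervalIntegrable (fun z => |W₁.rate k|⁻¹ •
          g₁ z • f (graphPt (W₂.icept x₂ y₂ k) (W₂.slope k) z)) volume a b :=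
          j2.smul |W₁.rate k|⁻¹
        have j3' : IntervalIntegrable (fun z => |W₂.rate k|⁻¹ •
          g₂ z • f (graphPt (W₂.icept x₂ y₂ k) (W₂.slope k) z)) volume a b :=
          j3.smul |W₂.rate k|⁻¹
        rw [← intervalIntegral.integral_smul, ← intervalIntegral.integral_smul,
          ← intervalIntegral.integral_sub j2' j3']
        refine intervalIntegral.integral_congr fun z _ => ?_
        simp only [G, sub_smul, mul_smul, Complex.coe_smul]
      rw [e4, intervalIntegral.integral_sub j1 j2, intervalIntegral.integral_smul,
        intervalIntegral.integral_smul, smul_sub]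
      abel
    rw [eq]
    refine (norm_add_le _ _).trans ?_
    rw [norm_smul, Real.norm_of_nonneg rn₁]
    -- numerical estimates
    have z1 : (5 * ε) ^ P.β ≤ 50 * ((α : ℝ) ^ (-P.β) * δ ^ P.β) := by
      rw [hε, show 5 * (10 * (δ * (α : ℝ)⁻¹)) = 50 * (α : ℝ)⁻¹ * δ by ring,
        Real.mul_rpow (by positivity) hδ.le, Real.mul_rpow (by norm_num) hinv.le,
        Real.inv_rpow hα0.le, ← Real.rpow_neg hα0.le, mul_assoc]
      gcongr
      exact hbase_pow (by norm_num) hβ1.le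
    have z2 : (4 * ε) ^ (1 - P.q) * (5 * (2 * (α : ℝ)⁻¹)) ^ P.q
        ≤ 400 * ((α : ℝ)⁻¹ * δ ^ (1 - P.q)) := by
      rw [hε, show 4 * (10 * (δ * (α : ℝ)⁻¹)) = 40 * (α : ℝ)⁻¹ * δ by ring,
        show 5 * (2 * (α : ℝ)⁻¹) = 10 * (α : ℝ)⁻¹ by ring,
        Real.mul_rpow (by positivity) hδ.le, Real.mul_rpow (by norm_num) hinv.le,
        Real.mul_rpow (by norm_num) hinv.le]
      have e : (α : ℝ)⁻¹ ^ (1 - P.q) * (α : ℝ)⁻¹ ^ P.q = (α : ℝ)⁻¹ := by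
        rw [← Real.rpow_add hinv]; simp
      calc (40 : ℝ) ^ (1 - P.q) * (α : ℝ)⁻¹ ^ (1 - P.q) * δ ^ (1 - P.q)
            * ((10 : ℝ) ^ P.q * (α : ℝ)⁻¹ ^ P.q)
          = (40 : ℝ) ^ (1 - P.q) * (10 : ℝ) ^ P.q
            * ((α : ℝ)⁻¹ ^ (1 - P.q) * (α : ℝ)⁻¹ ^ P.q) * δ ^ (1 - P.q) := by ring
        _ ≤ 40 * 10 * ((α : ℝ)⁻¹ ^ (1 - P.q) * (α : ℝ)⁻¹ ^ P.q) * δ ^ (1 - P.q) := by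
            gcongr
            · exact hbase_pow (by norm_num) (by linarith)
            · exact hbase_pow (by norm_num) hq1.le
        _ = _ := by rw [e]; ring
    have z3 : α * ((2 * (26 * (δ * (α : ℝ)⁻¹))) ^ (1 - P.q)
        * (8 * ((α : ℝ)⁻¹ * (α : ℝ)⁻¹)) ^ P.q)
        ≤ 416 * ((α : ℝ) ^ (-P.q) * δ ^ (1 - P.q)) := by
      rw [show 2 * (26 * (δ * (α : ℝ)⁻¹)) = 52 * (α : ℝ)⁻¹ * δ by ring,
        Real.mul_rpow (by positivity) hδ.le, Real.mul_rpow (by norm_num) hinv.le,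
        Real.mul_rpow (by norm_num) (by positivity), Real.mul_rpow hinv.le hinv.le]
      have e : (α : ℝ) * ((α : ℝ)⁻¹ ^ (1 - P.q) * ((α : ℝ)⁻¹ ^ P.q * (α : ℝ)⁻¹ ^ P.q))
          = (α : ℝ) ^ (-P.q) := by
        rw [← mul_assoc (_ ^ (1 - P.q)), ← Real.rpow_add hinv, sub_add_cancel, Real.rpow_one,
          ← mul_assoc, mul_inv_cancel₀ hα0.ne', one_mul, Real.inv_rpow hα0.le,
          Real.rpow_neg hα0.le]
      calc (α : ℝ) * ((52 : ℝ) ^ (1 - P.q) * (α : ℝ)⁻¹ ^ (1 - P.q) * δ ^ (1 - P.q)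
            * ((8 : ℝ) ^ P.q * ((α : ℝ)⁻¹ ^ P.q * (α : ℝ)⁻¹ ^ P.q)))
          = (52 : ℝ) ^ (1 - P.q) * (8 : ℝ) ^ P.q * ((α : ℝ) * ((α : ℝ)⁻¹ ^ (1 - P.q)
            * ((α : ℝ)⁻¹ ^ P.q * (α : ℝ)⁻¹ ^ P.q))) * δ ^ (1 - P.q) := by ring
        _ ≤ 52 * 8 * ((α : ℝ) * ((α : ℝ)⁻¹ ^ (1 - P.q)
            * ((α : ℝ)⁻¹ ^ P.q * (α : ℝ)⁻¹ ^ P.q))) * δ ^ (1 - P.q) := by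
            gcongr
            · exact hbase_pow (by norm_num) (by linarith)
            · exact hbase_pow (by norm_num) hq1.le
        _ = _ := by rw [e]; ring
    have z4 : 2 * ε ≤ 20 * δ * (α : ℝ)⁻¹ := by rw [hε]; linarith
    have w1 : |W₁.rate k|⁻¹ * ‖∫ z in a..b, (g₁ z • f (graphPt (W₁.icept x₁ y₁ k) (W₁.slope k) z)
        - g₁ z • f (graphPt (W₂.icept x₂ y₂ k) (W₂.slope k) z))‖
        ≤ 1200 * (α : ℝ) ^ (-P.β) * δ ^ P.β * v + 24 * s * (20 * δ * (α : ℝ)⁻¹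
          + 400 * ((α : ℝ)⁻¹ * δ ^ (1 - P.q))) := by
      calc _ ≤ 2 * (α : ℝ)⁻¹ * (6 * α * (2 * v * (50 * ((α : ℝ) ^ (-P.β) * δ ^ P.β))
          + 2 * s * (20 * δ * (α : ℝ)⁻¹ + 400 * ((α : ℝ)⁻¹ * δ ^ (1 - P.q))))) := by
            refine mul_le_mul ri₁ (p1.trans ?_) (norm_nonneg _) (by positivity)
            gcongr
        _ = _ := by field_simp; ring
    have w2 : ‖∫ z in a..b, G z • f (graphPt (W₂.icept x₂ y₂ k) (W₂.slope k) z)‖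
        ≤ 12 * s * (26 * δ + 416 * ((α : ℝ) ^ (-P.q) * δ ^ (1 - P.q))) := by
      refine p2.trans ?_
      calc _ ≤ 6 * α * (2 * (26 * (δ * (α : ℝ)⁻¹) + (2 * (26 * (δ * (α : ℝ)⁻¹))) ^ (1 - P.q)
            * (8 * ((α : ℝ)⁻¹ * (α : ℝ)⁻¹)) ^ P.q) * s) :=
            mul_le_mul_of_nonneg_right hba (by positivity)
        _ = 12 * s * (26 * δ + α * ((2 * (26 * (δ * (α : ℝ)⁻¹))) ^ (1 - P.q)
            * (8 * ((α : ℝ)⁻¹ * (α : ℝ)⁻¹)) ^ P.q)) := by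
            have : (α : ℝ) * (α : ℝ)⁻¹ = 1 := mul_inv_cancel₀ hα0.ne'
            linear_combination (12 * 26 * s * δ) * this
        _ ≤ _ := by gcongr
    have y1 : 20 * δ * (α : ℝ)⁻¹ ≤ δ := by nlinarith
    have y2 : s * (20 * δ * (α : ℝ)⁻¹ + 400 * ((α : ℝ)⁻¹ * δ ^ (1 - P.q)))
        ≤ s * (2 * D₁ + 400 * (2 * D₁)) :=
      mul_le_mul_of_nonneg_left (by linarith) hs0
    have y3 : s * (26 * δ + 416 * ((α : ℝ) ^ (-P.q) * δ ^ (1 - P.q)))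
        ≤ s * (26 * (2 * D₁) + 416 * (2 * D₁)) := by gcongr
    have y4 : 0 ≤ D₁ * s := by positivity
    linarith
  have hfinal := norm_integral_sub_le_common (W₁.lo_le_hi x₁ y₁ k) (W₂.lo_le_hi x₂ y₂ k)
    (hint W₁ x₁ y₁ g₁ hg₁) (hint W₂ x₂ y₂ g₂ hg₂) (h.lo_close hα4 hy0 hy3 hk)
    (h.hi_close hα4 hy0 hy3 hk) (hrem W₁ x₁ y₁ g₁ hg₁) (hrem W₂ x₂ y₂ g₂ hg₂) (by positivity)
    hcommon
  refine hfinal.trans ?_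
  have y1 : 0 ≤ D₁ * s := by positivity
  have y2 : 0 ≤ (α : ℝ) ^ (-P.β) * δ ^ P.β * v := by positivity
  rw [hD₁] at y1 ⊢
  linarith

theorem unstable_halfTransfer {P : Params} (hα : 100 ≤ α) {f : Torus → C2} (hf : BddMeas f)
    {s v : ℝ} (hs0 : 0 ≤ s) (hs : stableENorm P α f ≤ ENNReal.ofReal s) (hv0 : 0 ≤ v)
    (hv : unstableENorm P α f ≤ ENNReal.ofReal v) :
    unstableENorm P α (halfTransfer α f) ≤ ENNReal.ofReal
      (3200000 * ((α : ℝ) ^ (P.β - 1) * s + (α : ℝ) ^ (-P.β) * v)) := by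
  have hα4 : 4 ≤ α := by omega
  have hα' : (100 : ℝ) ≤ α := by exact_mod_cast hα
  have hα0 : (0 : ℝ) < α := by linarith
  refine unstable_intro (by positivity) fun δ W₁ W₂ u₁ u₂ hδ hδα hd hu₁ hu₂ _ _ hu => ?_
  obtain ⟨x₁, y₁, x₂, y₂, e₁, e₂, hy1, hy2, hc⟩ := exists_closeLeaves hd
  have hδ1 : δ ≤ 1 := hδα.trans ((div_le_one hα0).2 (by linarith))
  have hdy := abs_le.1 hc.dy
  rw [W₁.integral_halfTransfer hα4 e₁ (by linarith) (by linarith) hf hu₁,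
    W₂.integral_halfTransfer hα4 e₂ (by linarith) (by linarith) hf hu₂, ← Finset.sum_sub_distrib]
  refine (norm_sum_le_of_le _ (n := fun _ => 2 * (200000 * ((α : ℝ) ^ (P.β - 1) * s
    + (α : ℝ) ^ (-P.β) * v) * δ ^ P.β)) fun k hk => ?_).trans (le_of_eq ?_)
  · rw [← map_sub]
    refine (norm_stepMap_le (by omega) (abs_strandSign k).le _).trans ?_
    gcongr
    exact unstable_strand hα hf hs0 hs hv0 hv hc hδ hδα (by linarith) (by linarith) hu₁ hu₂ hu
      (Finset.mem_range.1 hk)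
  · rw [Finset.sum_const, Finset.card_range]; simp only [nsmul_eq_mul]; push_cast; ring

end StretchFold

namespace StretchFold

/-! ### The norms of bounded measurable functions -/

variable {α : ℕ}

theorem BddMeas.leafIntegral_add {f g : Torus → C2} (hf : BddMeas f) (hg : BddMeas g) {r : ℝ}
    (hr : 0 < r) {W : Leaf α} {φ : Torus → ℂ} (hφ : leafNorm r W φ ≠ ⊤) :
    leafIntegral W (f + g) φ = leafIntegral W f φ + leafIntegral W g φ := by
  have hc : ContinuousOn (fun t => φ (W.path t)) (uIcc 0 W.len) := by
    rw [uIcc_of_le W.len_pos.le]; exact holder_continuousOn hr hφ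
  unfold leafIntegral
  rw [← intervalIntegral.integral_add (hf.intervalIntegrable W.continuous_path.measurable hc)
    (hg.intervalIntegrable W.continuous_path.measurable hc)]
  simp only [Pi.add_apply, smul_add]

theorem BddMeas.weakENorm_add {f g : Torus → C2} (hf : BddMeas f) (hg : BddMeas g) :
    weakENorm α (f + g) ≤ weakENorm α f + weakENorm α g := by
  refine iSup_le fun W => iSup_le fun φ => iSup_le fun h => ?_
  rw [hf.leafIntegral_add hg one_pos (ne_top_of_le_ne_top ENNReal.one_ne_top h.2)]
  refine (enorm_add_le _ _).trans (add_le_add ?_ ?_)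
  · exact le_iSup_of_le W (le_iSup_of_le φ (le_iSup_of_le h le_rfl))
  · exact le_iSup_of_le W (le_iSup_of_le φ (le_iSup_of_le h le_rfl))

theorem BddMeas.stableENorm_add (P : Params) {f g : Torus → C2} (hf : BddMeas f)
    (hg : BddMeas g) : stableENorm P α (f + g) ≤ stableENorm P α f + stableENorm P α g := by
  refine iSup_le fun W => iSup_le fun φ => iSup_le fun h => ?_
  rw [hf.leafIntegral_add hg P.q_pos (stable_test_ne_top P h.2)]
  refine (enorm_add_le _ _).trans (add_le_add ?_ ?_)
  · exact le_iSup_of_le W (le_iSup_of_le φ (le_iSup_of_le h le_rfl))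
  · exact le_iSup_of_le W (le_iSup_of_le φ (le_iSup_of_le h le_rfl))

theorem BddMeas.unstableENorm_add (P : Params) {f g : Torus → C2} (hf : BddMeas f)
    (hg : BddMeas g) :
    unstableENorm P α (f + g) ≤ unstableENorm P α f + unstableENorm P α g := by
  refine iSup_le fun δ => iSup_le fun W₁ => iSup_le fun W₂ => iSup_le fun φ₁ => iSup_le fun φ₂ =>
    iSup_le fun h => ?_
  rw [hf.leafIntegral_add hg one_pos (ne_top_of_le_ne_top ENNReal.one_ne_top h.norm₁),
    hf.leafIntegral_add hg one_pos (ne_top_of_le_ne_top ENNReal.one_ne_top h.norm₂),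
    add_sub_add_comm]
  have hle (k : Torus → C2) : ‖leafIntegral W₁ k φ₁ - leafIntegral W₂ k φ₂‖ₑ
      / ENNReal.ofReal (δ ^ P.β) ≤ unstableENorm P α k :=
    le_iSup_of_le δ <| le_iSup_of_le W₁ <| le_iSup_of_le W₂ <| le_iSup_of_le φ₁ <|
      le_iSup_of_le φ₂ <| le_iSup_of_le h le_rfl
  refine le_trans ?_ (add_le_add (hle f) (hle g))
  rw [← ENNReal.add_div]
  gcongr
  exact enorm_add_le _ _

theorem BddMeas.strongENorm_add (P : Params) {f g : Torus → C2} (hf : BddMeas f)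
    (hg : BddMeas g) : strongENorm P α (f + g) ≤ strongENorm P α f + strongENorm P α g := by
  refine (add_le_add (hf.stableENorm_add P hg) (hf.unstableENorm_add P hg)).trans (le_of_eq ?_)
  unfold strongENorm; ring

theorem strongENorm_smul (P : Params) (α : ℕ) (c : ℂ) (f : Torus → C2) :
    strongENorm P α (c • f) = ‖c‖ₑ * strongENorm P α f := by
  rw [strongENorm, stableENorm_smul, unstableENorm_smul, strongENorm, mul_add]

theorem stableENorm_le_strongENorm (P : Params) (α : ℕ) (f : Torus → C2) :
    stableENorm P α f ≤ strongENorm P α f := le_self_add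

theorem unstableENorm_le_strongENorm (P : Params) (α : ℕ) (f : Torus → C2) :
    unstableENorm P α f ≤ strongENorm P α f := le_add_self

/-! ### Test functions that are only close to each other -/

theorem leafDist_comm (W₁ W₂ : Leaf α) : leafDist W₁ W₂ = leafDist W₂ W₁ := by
  unfold leafDist torusDist
  rw [norm_sub_rev W₁.dir, abs_sub_comm W₁.len, norm_sub_rev W₁.base.1, norm_sub_rev W₁.base.2]

theorem abs_len_sub_le_leafDist (W₁ W₂ : Leaf α) : |W₁.len - W₂.len| ≤ leafDist W₁ W₂ := by
  have h1 : 0 ≤ torusDist W₁.base W₂.base := Real.sqrt_nonneg _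
  have h2 := norm_nonneg (W₁.dir - W₂.dir)
  unfold leafDist; linarith

theorem dist_path_le_leafDist (W₁ W₂ : Leaf α) {t : ℝ} (ht : t ∈ Icc 0 (min W₁.len W₂.len)) :
    dist (W₁.path t) (W₂.path t) ≤ leafDist W₁ W₂ := by
  have ht1 : |t| ≤ 1 := by
    rw [abs_of_nonneg ht.1]; exact ht.2.trans ((min_le_left _ _).trans W₁.len_le)
  have := dist_path_le W₁ W₂ ht1
  unfold leafDist; linarith [abs_nonneg (W₁.len - W₂.len)]

theorem Leaf.dist_path_le (W : Leaf α) (s t : ℝ) : dist (W.path s) (W.path t) ≤ |s - t| := by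
  have h (i : Fin 2) (b : UnitAddCircle) (hi : |W.dir i| ≤ 1) :
      dist (b + ((s * W.dir i : ℝ) : UnitAddCircle)) (b + ((t * W.dir i : ℝ) : UnitAddCircle))
        ≤ |s - t| := by
    rw [dist_eq_norm, add_sub_add_left_eq_sub, ← AddCircle.coe_sub, ← sub_mul]
    refine (circle_norm_coe_le _).trans ?_
    rw [abs_mul]
    exact mul_le_of_le_one_right (abs_nonneg _) hi
  refine max_le (h 0 _ W.abs_dir_zero_le) (h 1 _ ?_)
  rw [abs_of_pos W.dir_pos]; exact W.dir_one_le

section compare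

variable {P : Params} {f : Torus → C2} {s v M δ : ℝ}

/-- The first test function is transplanted to the second leaf, where the unstable norm compares
like with like. Its difference from the second test function has supremum 2Mδ and Lipschitz constant
2M, hence C^q size of order M δ^(1-q); the stable norm absorbs it because β < 1 - q. -/
theorem unstable_compare_aux (hf : BddMeas f) (hs : stableENorm P α f ≤ ENNReal.ofReal s)
    (hs0 : 0 ≤ s) (hv : unstableENorm P α f ≤ ENNReal.ofReal v) (hv0 : 0 ≤ v) (hM : 0 < M)
    (hδ : 0 < δ) (hδ1 : δ ≤ 1) (hδα : δ ≤ 2 / (α : ℝ)) {W₁ W₂ : Leaf α}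
    (hd : leafDist W₁ W₂ < δ) {u₁ u₂ : ℝ → ℂ} (hu₁ : TestOn 0 W₁.len M M u₁)
    (hu₂ : TestOn 0 W₂.len M M u₂)
    (hu : ∀ t ∈ Icc 0 (min W₁.len W₂.len), ‖u₁ t - u₂ t‖ ≤ M * δ) (hc₁ : W₁.Closes u₁)
    (hc₂ : W₂.Closes u₂) (hW : W₂.len * W₂.dir 1 = 1 → W₁.len * W₁.dir 1 = 1) :
    ‖(∫ t in (0 : ℝ)..W₁.len, u₁ t • f (W₁.path t))
      - ∫ t in (0 : ℝ)..W₂.len, u₂ t • f (W₂.path t)‖ ≤ (2 * M * v + 8 * M * s) * δ ^ P.β := by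
  have hq := P.q_pos
  have hq1 := P.q_lt
  have l₁ := W₁.len_pos
  have l₂ := W₂.len_pos
  have hlen := abs_le.1 ((abs_len_sub_le_leafDist W₁ W₂).trans hd.le)
  set w : ℝ → ℂ := fun t => u₁ (min t W₁.len) with hw
  have hwt : TestOn 0 W₂.len M M w := by
    have := hu₁.comp hM.le (a' := 0) (b' := W₂.len) (K := 1) (θ := fun t => min t W₁.len)
      (fun t ht => ⟨le_min ht.1 l₁.le, min_le_right _ _⟩) (fun s _ t _ => by
        rw [one_mul]
        exact abs_min_sub_min_le_max s W₁.len t W₁.len |>.trans (by simp))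
    rwa [mul_one] at this
  -- On a closed second leaf the transplanted function must be periodic. This is why `hW` asks the
  -- first leaf to be closed too.
  have hwc : W₂.Closes w := by
    intro h
    have h1 := hc₁ (hW h)
    have h2 := (W₁.len_eq_one_of_closed (hW h)).1
    have h3 := (W₂.len_eq_one_of_closed h).1
    simp only [hw]
    rw [min_eq_left l₁.le, h1, h3, h2, min_self]
  have hdiff : TestOn 0 W₂.len (2 * M * δ) (M + M) (fun t => w t - u₂ t) := by
    refine ⟨fun t ht => ?_, (hwt.sub hu₂).lip⟩
    rcases le_or_gt t W₁.len with hle | hlt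
    · simp only [hw, min_eq_left hle]
      exact (hu t ⟨ht.1, le_min hle ht.2⟩).trans (by nlinarith)
    · simp only [hw, min_eq_right hlt.le]
      have h1 := hu W₁.len ⟨l₁.le, le_min le_rfl (hlt.le.trans ht.2)⟩
      have h2 := hu₂.lip W₁.len ⟨l₁.le, hlt.le.trans ht.2⟩ t ht
      have h3 : |W₁.len - t| ≤ δ := by rw [abs_le]; constructor <;> linarith [ht.2]
      have h4 := norm_sub_le_norm_sub_add_norm_sub (u₁ W₁.len) (u₂ W₁.len) (u₂ t)
      have h5 : M * |W₁.len - t| ≤ M * δ := mul_le_mul_of_nonneg_left h3 hM.le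
      linarith
  have key := unstable_use hv hv0 hM hδ hδα hd hu₁ hwt
    (fun t ht => by simp only [hw]; rw [min_eq_left (ht.2.trans (min_le_left _ _))]) hc₁ hwc
  have hpow : δ ≤ δ ^ (1 - P.q) := by
    conv_lhs => rw [← Real.rpow_one δ]
    exact Real.rpow_le_rpow_of_exponent_ge hδ hδ1 (by linarith)
  -- The interpolated Hölder constant is (4Mδ)^(1-q) (2M)^q ≤ 4M δ^(1-q).
  have hst := stable_use (M := 4 * M * δ ^ (1 - P.q)) hs hs0 (by positivity)
    (by positivity : 0 ≤ M + M) W₂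
    (hdiff.mono le_rfl le_rfl (by nlinarith [mul_pos hM hδ]) le_rfl) (fun a ha b hb => by
      refine (hdiff.holder (by positivity) hq.le hq1.le ha hb).trans ?_
      refine mul_le_mul_of_nonneg_right ?_ (by positivity)
      rw [show 2 * (2 * M * δ) = (4 * M) * δ by ring, Real.mul_rpow (by positivity) hδ.le]
      have e : (4 * M) ^ (1 - P.q) * (4 * M) ^ P.q = 4 * M := by
        rw [← Real.rpow_add (by positivity)]; simp
      calc (4 * M) ^ (1 - P.q) * δ ^ (1 - P.q) * (M + M) ^ P.q
          ≤ (4 * M) ^ (1 - P.q) * δ ^ (1 - P.q) * (4 * M) ^ P.q := by gcongr; linarith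
        _ = (4 * M) ^ (1 - P.q) * (4 * M) ^ P.q * δ ^ (1 - P.q) := by ring
        _ = _ := by rw [e])
    (fun h => by rw [hwc h, hc₂ h])
  have hint {u : ℝ → ℂ} (h : TestOn 0 W₂.len M M u) :
      IntervalIntegrable (fun t => u t • f (W₂.path t)) volume 0 W₂.len :=
    hf.intervalIntegrable W₂.continuous_path.measurable
      (by rw [uIcc_of_le l₂.le]; exact h.continuousOn)
  have esub : ∫ t in (0 : ℝ)..W₂.len, (w t - u₂ t) • f (W₂.path t)
      = (∫ t in (0 : ℝ)..W₂.len, w t • f (W₂.path t))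
        - ∫ t in (0 : ℝ)..W₂.len, u₂ t • f (W₂.path t) := by
    rw [← intervalIntegral.integral_sub (hint hwt) (hint hu₂)]
    simp only [sub_smul]
  rw [esub] at hst
  have hlσ : W₂.len ^ P.σ ≤ 1 := Real.rpow_le_one l₂.le W₂.len_le P.σ_pos.le
  have hδβ : δ ^ (1 - P.q) ≤ δ ^ P.β :=
    Real.rpow_le_rpow_of_exponent_ge hδ hδ1 P.β_lt_q.le
  refine (norm_sub_le_norm_sub_add_norm_sub _ _ _).trans ((add_le_add key hst).trans ?_)
  calc 2 * M * v * δ ^ P.β + 2 * (4 * M * δ ^ (1 - P.q)) * s * W₂.len ^ P.σ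
      ≤ 2 * M * v * δ ^ P.β + 2 * (4 * M * δ ^ P.β) * s * 1 := by gcongr
    _ = _ := by ring

/-- The unstable estimate for test functions that are close in the supremum norm only. -/
theorem unstable_compare (hf : BddMeas f) (hs : stableENorm P α f ≤ ENNReal.ofReal s)
    (hs0 : 0 ≤ s) (hv : unstableENorm P α f ≤ ENNReal.ofReal v) (hv0 : 0 ≤ v) (hM : 0 < M)
    (hδ : 0 < δ) (hδ1 : δ ≤ 1) (hδα : δ ≤ 2 / (α : ℝ)) {W₁ W₂ : Leaf α}
    (hd : leafDist W₁ W₂ < δ) {u₁ u₂ : ℝ → ℂ} (hu₁ : TestOn 0 W₁.len M M u₁)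
    (hu₂ : TestOn 0 W₂.len M M u₂)
    (hu : ∀ t ∈ Icc 0 (min W₁.len W₂.len), ‖u₁ t - u₂ t‖ ≤ M * δ) (hc₁ : W₁.Closes u₁)
    (hc₂ : W₂.Closes u₂) :
    ‖(∫ t in (0 : ℝ)..W₁.len, u₁ t • f (W₁.path t))
      - ∫ t in (0 : ℝ)..W₂.len, u₂ t • f (W₂.path t)‖ ≤ (2 * M * v + 8 * M * s) * δ ^ P.β := by
  -- If only the second leaf is closed, the roles are exchanged and the transplant goes to the leaf
  -- without a periodicity condition.
  by_cases hW : W₂.len * W₂.dir 1 = 1 → W₁.len * W₁.dir 1 = 1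
  · exact unstable_compare_aux hf hs hs0 hv hv0 hM hδ hδ1 hδα hd hu₁ hu₂ hu hc₁ hc₂ hW
  · rw [norm_sub_rev]
    push Not at hW
    refine unstable_compare_aux hf hs hs0 hv hv0 hM hδ hδ1 hδα ((leafDist_comm _ _).trans_lt hd)
      hu₂ hu₁ (fun t ht => ?_) hc₂ hc₁ fun h => absurd h hW.2
    rw [norm_sub_rev]
    exact hu t (by rwa [min_comm])

end compare

/-! ### Multiplication by Lipschitz functions of modulus at most one -/

section multiplier

variable {e : Torus → ℂ} {K : ℝ≥0} {f : Torus → C2}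

theorem lip_smul_mem (he : LipschitzWith K e) (he1 : ∀ p, ‖e p‖ ≤ 1) (hf : f ∈ lipFun) :
    e • f ∈ lipFun := by
  obtain ⟨B, hB0, hB⟩ := lipFun_bound hf
  obtain ⟨L, hL⟩ := hf
  refine ⟨K * B.toNNReal + L, LipschitzWith.of_dist_le_mul fun x y => ?_⟩
  have h1 := he.dist_le_mul x y
  have h2 := hL.dist_le_mul x y
  rw [dist_eq_norm] at h1 h2 ⊢
  have e1 : (e • f) x - (e • f) y = (e x - e y) • f x + e y • (f x - f y) := by
    simp only [Pi.smul_apply', sub_smul, smul_sub]; abel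
  rw [e1]
  refine (norm_add_le _ _).trans ?_
  rw [norm_smul, norm_smul, NNReal.coe_add, NNReal.coe_mul, Real.coe_toNNReal _ hB0]
  have h3 : ‖e x - e y‖ * ‖f x‖ ≤ K * dist x y * B :=
    mul_le_mul h1 (hB x) (norm_nonneg _) (by positivity)
  have h4 : ‖e y‖ * ‖f x - f y‖ ≤ 1 * (L * dist x y) :=
    mul_le_mul (he1 y) h2 (norm_nonneg _) zero_le_one
  linarith

theorem BddMeas.smul_fun (hf : BddMeas f) (he : Measurable e) (he1 : ∀ p, ‖e p‖ ≤ 1) :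
    BddMeas (e • f) := by
  obtain ⟨hf, B, hB⟩ := hf
  refine ⟨he.smul hf, B, fun p => ?_⟩
  rw [Pi.smul_apply', norm_smul]
  exact (mul_le_of_le_one_left (norm_nonneg _) (he1 p)).trans (hB p)

theorem TestOn.mul_path (he : LipschitzWith K e) (he1 : ∀ p, ‖e p‖ ≤ 1) (W : Leaf α)
    {B Λ : ℝ} {u : ℝ → ℂ} (hu : TestOn 0 W.len B Λ u) :
    TestOn 0 W.len B (Λ + K * B) (fun t => e (W.path t) * u t) where
  bdd t ht := by
    rw [norm_mul]
    exact (mul_le_of_le_one_left (norm_nonneg _) (he1 _)).trans (hu.bdd t ht)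
  lip a ha b hb := by
    have e1 : e (W.path a) * u a - e (W.path b) * u b
        = e (W.path a) * (u a - u b) + (e (W.path a) - e (W.path b)) * u b := by ring
    rw [e1]
    refine (norm_add_le _ _).trans ?_
    rw [norm_mul, norm_mul]
    have h1 : ‖e (W.path a) - e (W.path b)‖ ≤ K * |a - b| := by
      rw [← dist_eq_norm]
      exact (he.dist_le_mul _ _).trans (by gcongr; exact W.dist_path_le a b)
    have h2 : ‖e (W.path a) - e (W.path b)‖ * ‖u b‖ ≤ K * |a - b| * B :=
      mul_le_mul h1 (hu.bdd b hb) (norm_nonneg _) (by positivity)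
    have h3 : ‖e (W.path a)‖ * ‖u a - u b‖ ≤ Λ * |a - b| :=
      (mul_le_of_le_one_left (norm_nonneg _) (he1 _)).trans (hu.lip a ha b hb)
    linarith

theorem Leaf.Closes.mul_path (W : Leaf α) {u : ℝ → ℂ} (hc : W.Closes u) (e : Torus → ℂ) :
    W.Closes (fun t => e (W.path t) * u t) := fun h => by
  have := W.closes_comp_path e h
  simp only at this ⊢
  rw [this, hc h]

theorem smul_smul_path (W : Leaf α) (u : ℝ → ℂ) :
    ∫ t in (0 : ℝ)..W.len, u t • (e • f) (W.path t)
      = ∫ t in (0 : ℝ)..W.len, (e (W.path t) * u t) • f (W.path t) := by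
  refine intervalIntegral.integral_congr fun t _ => ?_
  simp only [Pi.smul_apply', smul_smul, mul_comm]

theorem weak_multiplier (he : LipschitzWith K e) (he1 : ∀ p, ‖e p‖ ≤ 1) {w : ℝ} (hw0 : 0 ≤ w)
    (hw : weakENorm α f ≤ ENNReal.ofReal w) :
    weakENorm α (e • f) ≤ ENNReal.ofReal (2 * (1 + K) * w) := by
  refine weak_intro fun W u hu hc => ?_
  rw [smul_smul_path]
  have hK := K.2
  refine weak_use hw hw0 (M := 1 + K) (by positivity) W
    ((hu.mul_path he he1 W).mono le_rfl le_rfl (by simp) (by simp)) (hc.mul_path W e)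

theorem stable_multiplier {P : Params} (hf : BddMeas f) (he : LipschitzWith K e)
    (he1 : ∀ p, ‖e p‖ ≤ 1) {s : ℝ} (hs0 : 0 ≤ s) (hs : stableENorm P α f ≤ ENNReal.ofReal s) :
    stableENorm P α (e • f) ≤ ENNReal.ofReal (2 * (1 + K) * s) := by
  have hK := K.2
  refine stable_intro (hf.smul_fun he.continuous.measurable he1) (by positivity)
    fun W u M Λ hM hΛ hu hh hc _ => ?_
  rw [smul_smul_path]
  have hM' : M ≤ (1 + K) * M := by nlinarith
  refine (stable_use hs hs0 (M := (1 + K) * M) (by positivity) (Λ := Λ + K * M) (by positivity) W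
    ((hu.mul_path he he1 W).mono le_rfl le_rfl hM' le_rfl) (fun a ha b hb => ?_)
    (hc.mul_path W e)).trans (le_of_eq (by ring))
  have e1 : e (W.path a) * u a - e (W.path b) * u b
      = e (W.path a) * (u a - u b) + (e (W.path a) - e (W.path b)) * u b := by ring
  rw [e1]
  refine (norm_add_le _ _).trans ?_
  rw [norm_mul, norm_mul]
  have hab : |a - b| ≤ |a - b| ^ P.q := by
    have h1 : |a - b| ≤ 1 := by
      have := W.len_le
      rw [abs_le]; constructor <;> linarith [ha.1, ha.2, hb.1, hb.2]
    rcases (abs_nonneg (a - b)).eq_or_lt with h0 | h0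
    · rw [← h0]; exact Real.rpow_nonneg le_rfl _
    · conv_lhs => rw [← Real.rpow_one |a - b|]
      exact Real.rpow_le_rpow_of_exponent_ge h0 h1 P.q_lt.le
  have h1 : ‖e (W.path a) - e (W.path b)‖ ≤ K * |a - b| ^ P.q := by
    rw [← dist_eq_norm]
    exact (he.dist_le_mul _ _).trans (by gcongr; exact (W.dist_path_le a b).trans hab)
  have h2 : ‖e (W.path a) - e (W.path b)‖ * ‖u b‖ ≤ K * |a - b| ^ P.q * M :=
    mul_le_mul h1 (hu.bdd b hb) (norm_nonneg _) (by positivity)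
  have h3 : ‖e (W.path a)‖ * ‖u a - u b‖ ≤ M * |a - b| ^ P.q :=
    (mul_le_of_le_one_left (norm_nonneg _) (he1 _)).trans (hh a ha b hb)
  linarith

/-- The multiplier is absorbed into the test functions, whose products on the two leaves are close
only in the supremum norm. Hence `unstable_compare` is applied, and the stable norm appears in the
bound. -/
theorem unstable_multiplier {P : Params} (hα : 2 ≤ α) (hf : BddMeas f) (he : LipschitzWith K e)
    (he1 : ∀ p, ‖e p‖ ≤ 1) {s v : ℝ} (hs0 : 0 ≤ s) (hs : stableENorm P α f ≤ ENNReal.ofReal s)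
    (hv0 : 0 ≤ v) (hv : unstableENorm P α f ≤ ENNReal.ofReal v) :
    unstableENorm P α (e • f) ≤ ENNReal.ofReal ((1 + K) * (2 * v + 8 * s)) := by
  have hK := K.2
  have hα' : (2 : ℝ) ≤ α := by exact_mod_cast hα
  refine unstable_intro (by positivity) fun δ W₁ W₂ u₁ u₂ hδ hδα hd hu₁ hu₂ hc₁ hc₂ hu => ?_
  have hδ1 : δ ≤ 1 := hδα.trans ((div_le_one (by linarith)).2 hα')
  rw [smul_smul_path, smul_smul_path]
  refine (unstable_compare hf hs hs0 hv hv0 (M := 1 + K) (by positivity) hδ hδ1 hδα hd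
    ((hu₁.mul_path he he1 W₁).mono le_rfl le_rfl (by simp) (by simp))
    ((hu₂.mul_path he he1 W₂).mono le_rfl le_rfl (by simp) (by simp)) (fun t ht => ?_)
    (hc₁.mul_path W₁ e) (hc₂.mul_path W₂ e)).trans (le_of_eq (by ring))
  have e1 : e (W₁.path t) * u₁ t - e (W₂.path t) * u₂ t
      = (e (W₁.path t) - e (W₂.path t)) * u₁ t + e (W₂.path t) * (u₁ t - u₂ t) := by ring
  rw [e1]
  refine (norm_add_le _ _).trans ?_
  rw [norm_mul, norm_mul]
  have h1 : ‖e (W₁.path t) - e (W₂.path t)‖ ≤ K * δ := by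
    rw [← dist_eq_norm]
    exact (he.dist_le_mul _ _).trans (by
      gcongr; exact (dist_path_le_leafDist W₁ W₂ ht).trans hd.le)
  have h2 : ‖e (W₁.path t) - e (W₂.path t)‖ * ‖u₁ t‖ ≤ K * δ * 1 :=
    mul_le_mul h1 (hu₁.bdd t ⟨ht.1, ht.2.trans (min_le_left _ _)⟩) (norm_nonneg _) (by positivity)
  have h3 : ‖e (W₂.path t)‖ * ‖u₁ t - u₂ t‖ ≤ δ :=
    (mul_le_of_le_one_left (norm_nonneg _) (he1 _)).trans (hu t ht)
  linarith

end multiplier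

end StretchFold

namespace StretchFold

/-! ### Lipschitz approximations of the sign -/

/-- A Lipschitz function on the circle whose sign is `halfSign`. -/
noncomputable def sawtooth (y : UnitAddCircle) : ℝ :=
  ‖y - ((1 / 4 : ℝ) : UnitAddCircle)‖ - ‖y + ((1 / 4 : ℝ) : UnitAddCircle)‖

theorem abs_sawtooth_sub_le (y y' : UnitAddCircle) :
    |sawtooth y - sawtooth y'| ≤ 2 * dist y y' := by
  have h1 := abs_norm_sub_norm_le (y - ((1 / 4 : ℝ) : UnitAddCircle))
    (y' - ((1 / 4 : ℝ) : UnitAddCircle))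
  have h2 := abs_norm_sub_norm_le (y + ((1 / 4 : ℝ) : UnitAddCircle))
    (y' + ((1 / 4 : ℝ) : UnitAddCircle))
  rw [sub_sub_sub_cancel_right, ← dist_eq_norm y y'] at h1
  rw [add_sub_add_right_eq_sub, ← dist_eq_norm y y'] at h2
  unfold sawtooth
  rw [abs_le] at h1 h2 ⊢
  constructor <;> linarith

theorem continuous_sawtooth : Continuous sawtooth := by
  unfold sawtooth; fun_prop

theorem circle_norm_of_abs_le {x : ℝ} (h : |x| ≤ 1 / 2) : ‖(x : UnitAddCircle)‖ = |x| :=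
  (AddCircle.norm_coe_eq_abs_iff (1 : ℝ) one_ne_zero).2 (by simpa using h)

theorem circle_norm_sub_one (x : ℝ) : ‖((x - 1 : ℝ) : UnitAddCircle)‖ = ‖(x : UnitAddCircle)‖ := by
  rw [AddCircle.coe_sub, AddCircle.coe_period, sub_zero]

theorem sawtooth_coe {r : ℝ} (h0 : 0 ≤ r) (h1 : r < 1) :
    (r < 1 / 2 → sawtooth (r : UnitAddCircle) = -2 * min r (1 / 2 - r)) ∧
      (1 / 2 ≤ r → sawtooth (r : UnitAddCircle) = 2 * min (r - 1 / 2) (1 - r)) := by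
  unfold sawtooth
  rw [← AddCircle.coe_sub, ← AddCircle.coe_add]
  have a {x : ℝ} (l : -(1 / 2) ≤ x) (u : x ≤ 1 / 2) : ‖(x : UnitAddCircle)‖ = |x| :=
    circle_norm_of_abs_le (abs_le.2 ⟨l, u⟩)
  constructor <;> intro h
  · rw [a (by linarith) (by linarith)]
    rcases le_or_gt r (1 / 4) with h4 | h4
    · rw [a (by linarith) (by linarith), abs_of_nonpos (by linarith), abs_of_nonneg (by linarith),
        min_eq_left (by linarith)]
      ring
    · rw [← circle_norm_sub_one, a (by linarith) (by linarith), abs_of_nonneg (by linarith),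
        abs_of_nonpos (by linarith), min_eq_right (by linarith)]
      ring
  · rw [← circle_norm_sub_one (r + 1 / 4), a (x := r + 1 / 4 - 1) (by linarith) (by linarith)]
    rcases le_or_gt r (3 / 4) with h4 | h4
    · rw [a (by linarith) (by linarith), abs_of_nonneg (by linarith), abs_of_nonpos (by linarith),
        min_eq_left (by linarith)]
      ring
    · rw [← circle_norm_sub_one, a (by linarith) (by linarith), abs_of_nonpos (by linarith),
        abs_of_nonneg (by linarith), min_eq_right (by linarith)]
      ring

theorem coe_fract (y : ℝ) : ((Int.fract y : ℝ) : UnitAddCircle) = (y : UnitAddCircle) := by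
  rw [← sub_eq_zero, ← AddCircle.coe_sub, AddCircle.coe_eq_zero_iff]
  exact ⟨-⌊y⌋, by rw [Int.fract]; simp⟩

theorem halfSign_mul_sawtooth (y : UnitAddCircle) : 0 ≤ (halfSign y : ℝ) * sawtooth y := by
  obtain ⟨r, rfl⟩ := QuotientAddGroup.mk_surjective y
  have h0 := Int.fract_nonneg r
  have h1 := Int.fract_lt_one r
  obtain ⟨l, u⟩ := sawtooth_coe h0 h1
  rw [coe_fract] at l u
  rw [halfSign_coe]
  split_ifs with h
  · rw [u h]
    have := le_min (sub_nonneg.2 h) (sub_nonneg.2 h1.le)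
    push_cast; linarith
  · rw [l (not_le.1 h)]
    have := le_min h0 (sub_nonneg.2 (not_le.1 h).le)
    push_cast; linarith

/-- The sawtooth vanishes exactly at half-integers and has slope ±2, so values below ρ occur within
ρ/2 of them. The indices are the half-integers from 1 to 4. -/
theorem exists_near_of_sawtooth_lt {y ρ : ℝ} (h : |sawtooth (y : UnitAddCircle)| < ρ)
    (h1 : 1 ≤ y) (h3 : y < 4) : ∃ k ∈ Finset.Icc 2 8, |y - (k : ℕ) / 2| ≤ ρ / 2 := by
  have f0 := Int.fract_nonneg y
  have f1 := Int.fract_lt_one y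
  obtain ⟨n, hn⟩ : ∃ n : ℕ, (n : ℤ) = ⌊y⌋ := Int.eq_ofNat_of_zero_le (Int.floor_nonneg.2 (by linarith)) |>.imp fun _ h => h.symm
  have hf : Int.fract y = y - n := by
    rw [Int.fract, ← hn]; simp
  have n1 : 1 ≤ n := by
    have : (1 : ℤ) ≤ ⌊y⌋ := Int.le_floor.2 (by exact_mod_cast h1)
    omega
  have n3 : n < 4 := by
    have : ⌊y⌋ < (4 : ℤ) := Int.floor_lt.2 (by exact_mod_cast h3)
    omega
  obtain ⟨l, u⟩ := sawtooth_coe f0 f1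
  rw [coe_fract] at l u
  rw [hf] at l u f0 f1
  rw [abs_lt] at h
  rcases lt_or_ge (y - n) (1 / 2) with hh | hh
  · have := l hh
    rcases min_cases (y - n) (1 / 2 - (y - n)) with hc | hc <;> rw [hc.1] at this
    · refine ⟨2 * n, by simp; omega, ?_⟩
      push_cast; rw [abs_le]; constructor <;> linarith
    · refine ⟨2 * n + 1, by simp; omega, ?_⟩
      push_cast; rw [abs_le]; constructor <;> linarith
  · have := u hh
    rcases min_cases (y - n - 1 / 2) (1 - (y - n)) with hc | hc <;> rw [hc.1] at this
    · refine ⟨2 * n + 1, by simp; omega, ?_⟩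
      push_cast; rw [abs_le]; constructor <;> linarith
    · refine ⟨2 * n + 2, by simp; omega, ?_⟩
      push_cast; rw [abs_le]; constructor <;> linarith

/-- A Lipschitz approximation of the sign. -/
noncomputable def softSign (ε : ℝ) (y : UnitAddCircle) : ℝ := max (-1) (min 1 (sawtooth y / ε))

theorem abs_softSign_le (ε : ℝ) (y : UnitAddCircle) : |softSign ε y| ≤ 1 :=
  abs_le.2 ⟨le_max_left _ _, max_le (by norm_num) (min_le_left _ _)⟩

theorem abs_softSign_sub_le {ε d : ℝ} (hε : 0 < ε) {y y' : UnitAddCircle}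
    (h : |sawtooth y - sawtooth y'| ≤ d) : |softSign ε y - softSign ε y'| ≤ d / ε := by
  unfold softSign
  have h1 := abs_max_sub_max_le_abs (min 1 (sawtooth y / ε)) (min 1 (sawtooth y' / ε)) (-1)
  rw [max_comm, max_comm (min 1 (sawtooth y' / ε))] at h1
  have h2 := abs_min_sub_min_le_max 1 (sawtooth y / ε) 1 (sawtooth y' / ε)
  rw [sub_self, abs_zero, max_eq_right (abs_nonneg _), ← sub_div, abs_div, abs_of_pos hε] at h2
  refine (h1.trans h2).trans ?_
  gcongr

theorem softSign_eq {ε : ℝ} (hε : 0 < ε) {y : UnitAddCircle} (h : ε ≤ |sawtooth y|) :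
    softSign ε y = halfSign y := by
  have hs := halfSign_mul_sawtooth y
  unfold softSign
  rcases abs_cases (halfSign y : ℝ) with hc | hc <;> rw [abs_halfSign] at hc
  · rw [← hc.1, one_mul] at hs
    rw [abs_of_nonneg hs] at h
    rw [← hc.1, min_eq_left ((one_le_div hε).2 h)]; norm_num
  · have e : (halfSign y : ℝ) = -1 := by linarith
    rw [e] at hs ⊢
    have hs' : sawtooth y ≤ 0 := by linarith
    rw [abs_of_nonpos hs'] at h
    have : sawtooth y / ε ≤ -1 := by rw [div_le_iff₀ hε]; linarith
    rw [min_eq_right (by linarith), max_eq_left this]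

/-- The error of the approximation. -/
noncomputable def signError (ε : ℝ) (y : UnitAddCircle) : ℝ := halfSign y - softSign ε y

theorem abs_signError_le {ε : ℝ} (hε : 0 < ε) (y : UnitAddCircle) : |signError ε y| ≤ 1 := by
  have hs := halfSign_mul_sawtooth y
  unfold signError
  have hb := abs_le.1 (abs_softSign_le ε y)
  rcases abs_cases (halfSign y : ℝ) with hc | hc <;> rw [abs_halfSign] at hc
  · rw [← hc.1, one_mul] at hs
    have : 0 ≤ softSign ε y := (le_min zero_le_one (by positivity)).trans (le_max_right _ _)
    rw [← hc.1, abs_le]; constructor <;> linarith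
  · have e : (halfSign y : ℝ) = -1 := by linarith
    rw [e] at hs ⊢
    have : softSign ε y ≤ 0 := max_le (by norm_num)
      ((min_le_right _ _).trans (div_nonpos_of_nonpos_of_nonneg (by linarith) hε.le))
    rw [abs_le]; constructor <;> linarith

theorem signError_eq_zero {ε : ℝ} (hε : 0 < ε) {y : UnitAddCircle} (h : ε ≤ |sawtooth y|) :
    signError ε y = 0 := by rw [signError, softSign_eq hε h, sub_self]

/-- If the signs agree, only the ramp varies, with slope 1/ε and near its support. If they differ,
the sawtooth changes sign between values that are d-close, so both are near zero. The difference is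
not uniformly small, but it lives on narrow strips, and this is what integration along a leaf
exploits. -/
theorem abs_signError_sub_le {ε d : ℝ} (hε : 0 < ε) (hd : 0 < d) {y y' : UnitAddCircle}
    (h : |sawtooth y - sawtooth y'| ≤ d) : |signError ε y - signError ε y'|
      ≤ d / ε * (if |sawtooth y| < ε + d then 1 else 0)
        + 2 * (if |sawtooth y| < 2 * d then 1 else 0) := by
  have hdε : 0 < d / ε := by positivity
  by_cases hsgn : halfSign y = halfSign y'
  · have h2 : (0 : ℝ) ≤ 2 * (if |sawtooth y| < 2 * d then 1 else 0) := by split_ifs <;> norm_num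
    refine le_trans ?_ (le_add_of_nonneg_right h2)
    by_cases hc : |sawtooth y| < ε + d
    · have e : signError ε y - signError ε y' = -(softSign ε y - softSign ε y') := by
        rw [signError, signError, hsgn]; ring
      rw [if_pos hc, e, abs_neg, mul_one]
      exact abs_softSign_sub_le hε h
    · have h4 : ε ≤ |sawtooth y'| := by
        have := abs_sub_abs_le_abs_sub (sawtooth y) (sawtooth y'); linarith
      rw [signError_eq_zero hε (by linarith), signError_eq_zero hε h4]
      simp [hc]
  · have hs := halfSign_mul_sawtooth y
    have hs' := halfSign_mul_sawtooth y'
    have hlt : |sawtooth y| < 2 * d := by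
      rw [abs_le] at h
      have c1 := abs_cases (halfSign y : ℝ)
      have c2 := abs_cases (halfSign y' : ℝ)
      rw [abs_halfSign] at c1 c2
      have hne : (halfSign y : ℝ) ≠ halfSign y' := by exact_mod_cast hsgn
      rw [abs_lt]
      rcases c1 with c1 | c1 <;> rcases c2 with c2 | c2
      · exact absurd (c1.1.symm.trans c2.1) hne
      · have e : (halfSign y' : ℝ) = -1 := by linarith
        rw [← c1.1] at hs; rw [e] at hs'; constructor <;> linarith
      · have e : (halfSign y : ℝ) = -1 := by linarith
        rw [← c2.1] at hs'; rw [e] at hs; constructor <;> linarith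
      · exact absurd (by linarith) hne
    rw [if_pos hlt]
    have a1 := abs_le.1 (abs_signError_le hε y)
    have a2 := abs_le.1 (abs_signError_le hε y')
    have a3 : (0 : ℝ) ≤ d / ε * (if |sawtooth y| < ε + d then 1 else 0) := by
      split_ifs <;> simp [hdε.le]
    refine le_trans ?_ (le_add_of_nonneg_left a3)
    rw [abs_le]; constructor <;> linarith

/-! ### The time that a leaf spends near the lines of discontinuity -/

variable {α : ℕ}

/-- The indicator of the parameters at which the leaf is near the discontinuities of the sign. -/
noncomputable def Leaf.strip (W : Leaf α) (ρ t : ℝ) : ℝ :=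
  if |sawtooth (W.path t).2| < ρ then 1 else 0

theorem Leaf.strip_eq (W : Leaf α) (ρ : ℝ) :
    W.strip ρ = {t | |sawtooth (W.path t).2| < ρ}.indicator 1 := by
  ext t; simp [Leaf.strip, indicator_apply]

theorem Leaf.isOpen_strip (W : Leaf α) (ρ : ℝ) : IsOpen {t | |sawtooth (W.path t).2| < ρ} :=
  isOpen_lt (continuous_sawtooth.comp (continuous_snd.comp W.continuous_path)).abs
    continuous_const

theorem Leaf.strip_integrable (W : Leaf α) (ρ a b : ℝ) :
    IntervalIntegrable (W.strip ρ) volume a b := by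
  rw [W.strip_eq, intervalIntegrable_iff]
  exact (integrableOn_const (C := (1 : ℝ)) (by rw [uIoc]; exact measure_Ioc_lt_top.ne)).indicator
    (W.isOpen_strip ρ).measurableSet

/-- Leaves cross the horizontal discontinuity lines with vertical speed at least 4/5, so each of the
seven relevant half-integers costs a time of at most 5ρ/4, and 35/4 ≤ 10. -/
theorem Leaf.integral_strip_le (W : Leaf α) (hα : 4 ≤ α) {ρ a b : ℝ} (hρ : 0 ≤ ρ) (ha : 0 ≤ a)
    (hab : a ≤ b) (hb : b ≤ 1) : ∫ t in a..b, W.strip ρ t ≤ 10 * ρ := by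
  obtain ⟨x, y, hxy, hy1, hy2⟩ := W.exists_rep
  have hd := W.dir_one_ge hα
  have hd1 := W.dir_one_le
  set d := W.dir 1 with hdd
  have hd0 : 0 < d := by linarith
  rw [intervalIntegral.integral_of_le hab, W.strip_eq,
    integral_indicator_one (W.isOpen_strip ρ).measurableSet,
    measureReal_restrict_apply (W.isOpen_strip ρ).measurableSet]
  have hsub : {t | |sawtooth (W.path t).2| < ρ} ∩ Ioc a b ⊆ ⋃ k ∈ Finset.Icc 2 8,
      Icc (((k : ℕ) / 2 - ρ / 2 - y) / d) (((k : ℕ) / 2 + ρ / 2 - y) / d) := by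
    rintro t ⟨ht, hta, htb⟩
    have hp : (W.path t).2 = ((y + t * d : ℝ) : UnitAddCircle) := by
      simp only [Leaf.path, hxy, AddCircle.coe_add, hdd]
    rw [mem_ofPred_eq, hp] at ht
    have ht1 : t * d ≤ 1 := mul_le_one₀ (by linarith) hd0.le hd1
    have ht0 : 0 ≤ t * d := mul_nonneg (by linarith) hd0.le
    obtain ⟨k, hk, hky⟩ := exists_near_of_sawtooth_lt ht (by linarith) (by linarith)
    rw [abs_le] at hky
    refine mem_biUnion hk ⟨?_, ?_⟩
    · rw [div_le_iff₀ hd0]; linarith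
    · rw [le_div_iff₀ hd0]; linarith
  have hvol : volume ({t | |sawtooth (W.path t).2| < ρ} ∩ Ioc a b) ≤ ENNReal.ofReal (10 * ρ) := by
    refine (measure_mono hsub).trans ((measure_biUnion_finset_le _ _).trans ?_)
    have e (k : ℕ) : volume (Icc (((k : ℕ) / 2 - ρ / 2 - y) / d) (((k : ℕ) / 2 + ρ / 2 - y) / d))
        ≤ ENNReal.ofReal (5 / 4 * ρ) := by
      rw [Real.volume_Icc]
      refine ENNReal.ofReal_le_ofReal ?_
      rw [← sub_div, div_le_iff₀ hd0]
      nlinarith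
    refine (Finset.sum_le_sum fun k _ => e k).trans ?_
    rw [Finset.sum_const, nsmul_eq_mul, Nat.card_Icc, ← ENNReal.ofReal_natCast,
      ← ENNReal.ofReal_mul (by positivity)]
    refine ENNReal.ofReal_le_ofReal ?_
    norm_num; linarith
  rw [Measure.real]
  exact ENNReal.toReal_le_of_le_ofReal (by positivity) hvol

/-! ### The norms of the approximation error -/

section error

variable {P : Params} {F : Torus → C2} {B ε : ℝ}

/-- A function multiplied by the error in the approximation of the sign of the second coordinate. -/
noncomputable def errorMul (ε : ℝ) (F : Torus → C2) (p : Torus) : C2 :=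
  ((signError ε p.2 : ℝ) : ℂ) • F p

theorem norm_errorMul_le (hε : 0 < ε) (hB : ∀ p, ‖F p‖ ≤ B) (p : Torus) :
    ‖errorMul ε F p‖ ≤ B * (if |sawtooth p.2| < ε then 1 else 0) := by
  rw [errorMul, norm_smul, Complex.norm_real, Real.norm_eq_abs]
  split_ifs with h
  · rw [mul_one]
    exact (mul_le_of_le_one_left (norm_nonneg _) (abs_signError_le hε _)).trans (hB p)
  · rw [signError_eq_zero hε (not_lt.1 h)]; simp

theorem norm_errorMul_le' (hε : 0 < ε) (hB : ∀ p, ‖F p‖ ≤ B) (p : Torus) :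
    ‖errorMul ε F p‖ ≤ B := by
  refine (norm_errorMul_le hε hB p).trans ?_
  have := (norm_nonneg _).trans (hB p)
  split_ifs <;> simp [this]

theorem measurable_signError (ε : ℝ) : Measurable (signError ε) := by
  unfold signError softSign
  exact measurable_halfSign.sub
    (continuous_const.max (continuous_const.min (continuous_sawtooth.div_const ε))).measurable

theorem bddMeas_errorMul (hε : 0 < ε) (hF : BddMeas F) : BddMeas (errorMul ε F) := by
  obtain ⟨hm, B, hB⟩ := hF
  exact ⟨(Complex.measurable_ofReal.comp ((measurable_signError ε).comp measurable_snd)).smul hm,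
    B, norm_errorMul_le' hε hB⟩

theorem norm_integral_errorMul_le (hα : 4 ≤ α) (hε : 0 < ε) (hB0 : 0 ≤ B) (hB : ∀ p, ‖F p‖ ≤ B)
    (W : Leaf α) {u : ℝ → ℂ} {M a b : ℝ} (hM : 0 ≤ M) (ha : 0 ≤ a) (hab : a ≤ b)
    (hb : b ≤ W.len) (hu : ∀ t ∈ Icc 0 W.len, ‖u t‖ ≤ M) :
    ‖∫ t in a..b, u t • errorMul ε F (W.path t)‖ ≤ M * B * min (10 * ε) (b - a) := by
  have hub (t) (ht : t ∈ Ioc a b) : ‖u t‖ ≤ M := hu t ⟨by linarith [ht.1], ht.2.trans hb⟩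
  rw [mul_min_of_nonneg _ _ (by positivity)]
  refine le_min ?_ ?_
  · have h := intervalIntegral.norm_integral_le_of_norm_le (μ := volume) hab
      (f := fun t => u t • errorMul ε F (W.path t)) (g := fun t => M * B * W.strip ε t)
      (Eventually.of_forall fun t ht => by
        rw [norm_smul, mul_assoc]
        exact mul_le_mul (hub t ht) (norm_errorMul_le hε hB _) (norm_nonneg _) hM)
      ((W.strip_integrable ε a b).const_mul _)
    refine h.trans ?_
    rw [intervalIntegral.integral_const_mul]
    gcongr
    exact W.integral_strip_le hα hε.le ha hab (hb.trans W.len_le)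
  · have h := intervalIntegral.norm_integral_le_of_norm_le_const (a := a) (b := b) (C := M * B)
      (f := fun t => u t • errorMul ε F (W.path t)) fun t ht => by
        rw [uIoc_of_le hab] at ht
        rw [norm_smul]
        exact mul_le_mul (hub t ht) (norm_errorMul_le' hε hB _) (norm_nonneg _) hM
    rwa [abs_of_nonneg (sub_nonneg.2 hab)] at h

theorem stable_errorMul (hα : 4 ≤ α) (hε : 0 < ε) (hF : BddMeas F) (hB0 : 0 ≤ B)
    (hB : ∀ p, ‖F p‖ ≤ B) :
    stableENorm P α (errorMul ε F) ≤ ENNReal.ofReal (10 * B * ε ^ (1 - P.σ)) := by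
  have hσ := P.σ_pos
  have hσ1 := P.σ_lt
  refine stable_intro (bddMeas_errorMul hε hF) (by positivity) fun W u M Λ hM _ hu _ _ _ => ?_
  have hl := W.len_pos
  refine (norm_integral_errorMul_le hα hε hB0 hB W hM.le le_rfl hl.le le_rfl hu.bdd).trans ?_
  rw [sub_zero]
  -- The weight of the stable norm is obtained by interpolating between the time spent in the strip
  -- and the whole length.
  have hmin : min (10 * ε) W.len ≤ 10 * (ε ^ (1 - P.σ) * W.len ^ P.σ) := by
    have hm0 : 0 < min ε W.len := lt_min hε hl
    calc min (10 * ε) W.len ≤ 10 * min ε W.len := by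
          rw [mul_min_of_nonneg _ _ (by norm_num)]
          exact min_le_min le_rfl (by linarith)
      _ = 10 * (min ε W.len ^ (1 - P.σ) * min ε W.len ^ P.σ) := by
          rw [← Real.rpow_add hm0]; simp
      _ ≤ _ := by
          gcongr
          · exact min_le_left _ _
          · exact min_le_right _ _
  calc M * B * min (10 * ε) W.len ≤ M * B * (10 * (ε ^ (1 - P.σ) * W.len ^ P.σ)) := by gcongr
    _ = _ := by ring

/-- The ramp has slope of order 1/ε, but acts only for a time of order ε, and a change of sign lasts
for a time of order δ, so the total is linear in δ uniformly in ε. The constant is B from the test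
functions, 60B from the ramp, 80B from the jump, and 4B from the unmatched ends. -/
theorem unstable_errorMul_small (hα : 4 ≤ α) (hε : 0 < ε) (hF : BddMeas F) (hB0 : 0 ≤ B)
    (hB : ∀ p, ‖F p‖ ≤ B) {K : ℝ≥0} (hK : LipschitzWith K F) {δ : ℝ} (hδ : 0 < δ) (hδε : δ ≤ ε)
    {W₁ W₂ : Leaf α} (hd : leafDist W₁ W₂ < δ) {u₁ u₂ : ℝ → ℂ}
    (hu₁ : TestOn 0 W₁.len 1 1 u₁) (hu₂ : TestOn 0 W₂.len 1 1 u₂)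
    (hu : ∀ t ∈ Icc 0 (min W₁.len W₂.len), ‖u₁ t - u₂ t‖ ≤ δ) :
    ‖(∫ t in (0 : ℝ)..W₁.len, u₁ t • errorMul ε F (W₁.path t))
      - ∫ t in (0 : ℝ)..W₂.len, u₂ t • errorMul ε F (W₂.path t)‖ ≤ (145 * B + K) * δ := by
  have hK0 : (0 : ℝ) ≤ K := K.2
  have l₁ := W₁.len_pos
  have l₂ := W₂.len_pos
  have hE := bddMeas_errorMul hε hF
  have hint (W : Leaf α) (u : ℝ → ℂ) (hu : TestOn 0 W.len 1 1 u) :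
      IntervalIntegrable (fun t => u t • errorMul ε F (W.path t)) volume 0 W.len :=
    hE.intervalIntegrable W.continuous_path.measurable
      (by rw [uIcc_of_le W.len_pos.le]; exact hu.continuousOn)
  have hrem (W : Leaf α) (u : ℝ → ℂ) (hu : TestOn 0 W.len 1 1 u) (a b : ℝ) (ha : 0 ≤ a)
      (hab : a ≤ b) (hb : b ≤ W.len) (hba : b - a ≤ δ) :
      ‖∫ t in a..b, u t • errorMul ε F (W.path t)‖ ≤ B * δ := by
    refine (norm_integral_errorMul_le hα hε hB0 hB W zero_le_one ha hab hb hu.bdd).trans ?_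
    rw [one_mul]
    gcongr
    exact (min_le_right _ _).trans hba
  have hcommon (a b : ℝ) (ha : 0 ≤ a) (_ : 0 ≤ a) (hab : a ≤ b) (hb₁ : b ≤ W₁.len)
      (hb₂ : b ≤ W₂.len) : ‖(∫ t in a..b, u₁ t • errorMul ε F (W₁.path t))
        - ∫ t in a..b, u₂ t • errorMul ε F (W₂.path t)‖ ≤ (141 * B + K) * δ := by
    have hsub (W : Leaf α) (u : ℝ → ℂ) (hu : TestOn 0 W.len 1 1 u) (hb : b ≤ W.len) :
        IntervalIntegrable (fun t => u t • errorMul ε F (W.path t)) volume a b := by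
      refine (hint W u hu).mono_set ?_
      rw [uIcc_of_le hab, uIcc_of_le W.len_pos.le]
      exact Icc_subset_Icc ha hb
    rw [← intervalIntegral.integral_sub (hsub W₁ u₁ hu₁ hb₁) (hsub W₂ u₂ hu₂ hb₂)]
    have hgi : IntervalIntegrable (fun t => (B + K) * δ + (B * (2 * δ / ε) *
        W₁.strip (ε + 2 * δ) t + B * 2 * W₁.strip (2 * (2 * δ)) t)) volume a b :=
      intervalIntegrable_const.add (((W₁.strip_integrable _ a b).const_mul _).add
        ((W₁.strip_integrable _ a b).const_mul _))
    refine (intervalIntegral.norm_integral_le_of_norm_le hab (Eventually.of_forall fun t ht => ?_)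
      hgi).trans ?_
    · have ht₁ : t ∈ Icc 0 W₁.len := ⟨by linarith [ht.1], ht.2.trans hb₁⟩
      have ht₂ : t ∈ Icc 0 W₂.len := ⟨by linarith [ht.1], ht.2.trans hb₂⟩
      have ht' : t ∈ Icc 0 (min W₁.len W₂.len) := ⟨ht₁.1, le_min ht₁.2 ht₂.2⟩
      have hp : dist (W₁.path t) (W₂.path t) ≤ δ := (dist_path_le_leafDist W₁ W₂ ht').trans hd.le
      have hs := (abs_sawtooth_sub_le (W₁.path t).2 (W₂.path t).2).trans
        (mul_le_mul_of_nonneg_left ((le_max_right _ _ : _ ≤ dist (W₁.path t) (W₂.path t)).trans hp)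
          zero_le_two)
      have herr := abs_signError_sub_le hε (by positivity : 0 < 2 * δ) hs
      have hFd : ‖F (W₁.path t) - F (W₂.path t)‖ ≤ K * δ := by
        rw [← dist_eq_norm]
        exact (hK.dist_le_mul _ _).trans (by gcongr)
      have e : u₁ t • errorMul ε F (W₁.path t) - u₂ t • errorMul ε F (W₂.path t)
          = (u₁ t - u₂ t) • errorMul ε F (W₁.path t)
            + u₂ t • (((signError ε (W₁.path t).2 - signError ε (W₂.path t).2 : ℝ) : ℂ) •
                F (W₁.path t)
              + ((signError ε (W₂.path t).2 : ℝ) : ℂ) • (F (W₁.path t) - F (W₂.path t))) := by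
        simp only [errorMul, sub_smul, smul_sub, smul_add, Complex.ofReal_sub]; abel
      rw [e]
      have n1 : ‖(u₁ t - u₂ t) • errorMul ε F (W₁.path t)‖ ≤ δ * B := by
        rw [norm_smul]
        exact mul_le_mul (hu t ht') (norm_errorMul_le' hε hB _) (norm_nonneg _) hδ.le
      have n2 : ‖((signError ε (W₁.path t).2 - signError ε (W₂.path t).2 : ℝ) : ℂ) •
          F (W₁.path t)‖ ≤ (2 * δ / ε * W₁.strip (ε + 2 * δ) t
            + 2 * W₁.strip (2 * (2 * δ)) t) * B := by
        rw [norm_smul, Complex.norm_real, Real.norm_eq_abs]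
        exact mul_le_mul herr (hB _) (norm_nonneg _) ((abs_nonneg _).trans herr)
      have n3 : ‖((signError ε (W₂.path t).2 : ℝ) : ℂ) • (F (W₁.path t) - F (W₂.path t))‖
          ≤ K * δ := by
        rw [norm_smul, Complex.norm_real, Real.norm_eq_abs]
        exact (mul_le_of_le_one_left (norm_nonneg _) (abs_signError_le hε _)).trans hFd
      refine (norm_add_le _ _).trans ?_
      rw [norm_smul (u₂ t)]
      have n4 := mul_le_of_le_one_left (norm_nonneg (((signError ε (W₁.path t).2
        - signError ε (W₂.path t).2 : ℝ) : ℂ) • F (W₁.path t)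
          + ((signError ε (W₂.path t).2 : ℝ) : ℂ) • (F (W₁.path t) - F (W₂.path t))))
        (hu₂.bdd t ht₂)
      have n5 := norm_add_le (((signError ε (W₁.path t).2
        - signError ε (W₂.path t).2 : ℝ) : ℂ) • F (W₁.path t))
        (((signError ε (W₂.path t).2 : ℝ) : ℂ) • (F (W₁.path t) - F (W₂.path t)))
      linarith
    · have s1 := W₁.integral_strip_le hα (ρ := ε + 2 * δ) (by positivity) ha hab
        (hb₁.trans W₁.len_le)
      have s2 := W₁.integral_strip_le hα (ρ := 2 * (2 * δ)) (by positivity) ha hab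
        (hb₁.trans W₁.len_le)
      rw [intervalIntegral.integral_add intervalIntegrable_const
          (((W₁.strip_integrable _ a b).const_mul _).add ((W₁.strip_integrable _ a b).const_mul _)),
        intervalIntegral.integral_add ((W₁.strip_integrable _ a b).const_mul _)
          ((W₁.strip_integrable _ a b).const_mul _), intervalIntegral.integral_const, smul_eq_mul,
        intervalIntegral.integral_const_mul, intervalIntegral.integral_const_mul]
      have h1 : (b - a) * ((B + K) * δ) ≤ 1 * ((B + K) * δ) := by
        gcongr
        linarith [W₁.len_le]
      have h2 : B * (2 * δ / ε) * (∫ t in a..b, W₁.strip (ε + 2 * δ) t) ≤ 60 * B * δ := by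
        calc _ ≤ B * (2 * δ / ε) * (10 * (ε + 2 * ε)) := by
              gcongr
              exact s1.trans (by gcongr)
          _ = _ := by field_simp; ring
      have h3 : B * 2 * (∫ t in a..b, W₁.strip (2 * (2 * δ)) t) ≤ 80 * B * δ := by
        calc _ ≤ B * 2 * (10 * (2 * (2 * δ))) := by gcongr
          _ = _ := by ring
      linarith
  refine (norm_integral_sub_le_common l₁.le l₂.le (hint W₁ u₁ hu₁) (hint W₂ u₂ hu₂) (D := δ)
    (by simpa using hδ.le) ((abs_len_sub_le_leafDist W₁ W₂).trans hd.le) (hrem W₁ u₁ hu₁)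
    (hrem W₂ u₂ hu₂) (by positivity) hcommon).trans (le_of_eq (by ring))

theorem unstable_errorMul (hα : 4 ≤ α) (hε : 0 < ε) (hF : BddMeas F) (hB0 : 0 ≤ B)
    (hB : ∀ p, ‖F p‖ ≤ B) {K : ℝ≥0} (hK : LipschitzWith K F) :
    unstableENorm P α (errorMul ε F) ≤ ENNReal.ofReal ((145 * B + K) * ε ^ (1 - P.β)) := by
  have hK0 : (0 : ℝ) ≤ K := K.2
  have hβ := P.β_pos
  have hβ1 := P.β_lt
  have split {x : ℝ} (hx : 0 < x) : x = x ^ (1 - P.β) * x ^ P.β := by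
    rw [← Real.rpow_add hx]; simp
  refine unstable_intro (by positivity) fun δ W₁ W₂ u₁ u₂ hδ _ hd hu₁ hu₂ _ _ hu => ?_
  rcases le_or_gt δ ε with hδε | hδε
  · refine (unstable_errorMul_small hα hε hF hB0 hB hK hδ hδε hd hu₁ hu₂ hu).trans ?_
    rw [mul_assoc]
    gcongr
    calc δ = δ ^ (1 - P.β) * δ ^ P.β := split hδ
      _ ≤ _ := by gcongr
  -- For leaves further apart than ε no cancellation is needed: each integral is of order ε.
  · have h (W : Leaf α) (u : ℝ → ℂ) (hu : TestOn 0 W.len 1 1 u) :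
        ‖∫ t in (0 : ℝ)..W.len, u t • errorMul ε F (W.path t)‖ ≤ B * (10 * ε) := by
      refine (norm_integral_errorMul_le hα hε hB0 hB W zero_le_one le_rfl W.len_pos.le le_rfl
        hu.bdd).trans ?_
      rw [one_mul]
      gcongr
      exact min_le_left _ _
    refine (norm_sub_le _ _).trans ((add_le_add (h W₁ u₁ hu₁) (h W₂ u₂ hu₂)).trans ?_)
    have e1 : ε ≤ ε ^ (1 - P.β) * δ ^ P.β := by
      calc ε = ε ^ (1 - P.β) * ε ^ P.β := split hε
        _ ≤ _ := by gcongr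
    calc B * (10 * ε) + B * (10 * ε) ≤ (145 * B + K) * ε := by nlinarith
      _ ≤ (145 * B + K) * (ε ^ (1 - P.β) * δ ^ P.β) := by gcongr
      _ = _ := by ring

end error

end StretchFold

namespace StretchFold

/-! ### Functions that are limits of Lipschitz functions in the strong norm -/

variable {P : Params} {α : ℕ} {u v f : Torus → C2}

/-- Bounded measurable functions that Lipschitz functions approximate in the strong norm. -/
def Approximable (P : Params) (α : ℕ) (u : Torus → C2) : Prop :=
  BddMeas u ∧ ∀ ε : ℝ, 0 < ε → ∃ f ∈ lipFun, strongENorm P α (u - f) ≤ ENNReal.ofReal ε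

theorem strongENorm_zero (P : Params) (α : ℕ) : strongENorm P α 0 = 0 := by
  have := strongENorm_smul P α 0 0
  simpa using this

theorem strongENorm_sub_comm (P : Params) (α : ℕ) (u v : Torus → C2) :
    strongENorm P α (u - v) = strongENorm P α (v - u) := by
  have := strongENorm_smul P α (-1) (v - u)
  simpa using this

theorem strongENorm_lt_top (hf : f ∈ lipFun) : strongENorm P α f < ⊤ :=
  ENNReal.add_lt_top.2 ⟨stableENorm_lt_top P α hf, unstableENorm_lt_top P α hf⟩

theorem Approximable.of_lip (hf : f ∈ lipFun) : Approximable P α f :=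
  ⟨.of_lip hf, fun ε _ => ⟨f, hf, by rw [sub_self, strongENorm_zero]; exact zero_le⟩⟩

/-- An operator that is bounded in the strong norm preserves approximability once it maps Lipschitz
functions to approximable ones. -/
theorem Approximable.map {A : (Torus → C2) → Torus → C2} {C : ℝ} (hC0 : 0 < C)
    (hA : ∀ f, BddMeas f → BddMeas (A f)) (hsub : ∀ f g, A (f - g) = A f - A g)
    (hC : ∀ f N, BddMeas f → 0 ≤ N → strongENorm P α f ≤ ENNReal.ofReal N →
      strongENorm P α (A f) ≤ ENNReal.ofReal (C * N))
    (hlip : ∀ f ∈ lipFun, Approximable P α (A f)) (hu : Approximable P α u) :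
    Approximable P α (A u) := by
  refine ⟨hA u hu.1, fun ε hε => ?_⟩
  obtain ⟨f, hf, hfu⟩ := hu.2 (ε / 2 / C) (by positivity)
  obtain ⟨g, hg, hgf⟩ := (hlip f hf).2 (ε / 2) (by positivity)
  refine ⟨g, hg, ?_⟩
  have h1 := hC (u - f) _ (hu.1.sub (.of_lip hf)) (by positivity) hfu
  rw [hsub, mul_div_cancel₀ _ hC0.ne'] at h1
  have e : A u - g = (A u - A f) + (A f - g) := by abel
  rw [e]
  refine (((hA u hu.1).sub (hA f (.of_lip hf))).strongENorm_add P
    ((hA f (.of_lip hf)).sub (.of_lip hg))).trans ((add_le_add h1 hgf).trans ?_)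
  rw [← ENNReal.ofReal_add (by positivity) (by positivity), add_halves]

/-! ### The half step -/

theorem halfTransfer_add (α : ℕ) (f g : Torus → C2) :
    halfTransfer α (f + g) = halfTransfer α f + halfTransfer α g := by
  ext p; simp [halfTransfer]

theorem halfTransfer_smul (α : ℕ) (c : ℂ) (f : Torus → C2) :
    halfTransfer α (c • f) = c • halfTransfer α f := by
  ext p; simp [halfTransfer]

theorem halfTransfer_sub (α : ℕ) (f g : Torus → C2) :
    halfTransfer α (f - g) = halfTransfer α f - halfTransfer α g := by
  ext p; simp [halfTransfer]

/-- A crude continuity bound, with every power of α replaced by one; it serves only for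
approximation and extension. -/
theorem strong_halfTransfer (hα : 100 ≤ α) (hf : BddMeas f) {N : ℝ} (hN : 0 ≤ N)
    (h : strongENorm P α f ≤ ENNReal.ofReal N) :
    strongENorm P α (halfTransfer α f) ≤ ENNReal.ofReal (7000000 * N) := by
  have hs := (stableENorm_le_strongENorm P α f).trans h
  have hv := (unstableENorm_le_strongENorm P α f).trans h
  have hw := (weakENorm_le_stableENorm P α f).trans hs
  have h1 : (1 : ℝ) ≤ α := by exact_mod_cast (by omega : 1 ≤ α)
  have pw {r : ℝ} (hr : r ≤ 0) : (α : ℝ) ^ r ≤ 1 := Real.rpow_le_one_of_one_le_of_nonpos h1 hr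
  have q1 := pw (r := -P.q) (by linarith [P.q_pos])
  have q2 := pw (r := P.σ - 1) (by linarith [P.σ_lt])
  have q3 := pw (r := P.β - 1) (by linarith [P.β_lt])
  have q4 := pw (r := -P.β) (by linarith [P.β_pos])
  refine (add_le_add (stable_halfTransfer (by omega) hf hN hw hN hs)
    (unstable_halfTransfer hα hf hN hs hN hv)).trans ?_
  rw [← ENNReal.ofReal_add (by positivity) (by positivity)]
  refine ENNReal.ofReal_le_ofReal ?_
  have t1 := mul_le_mul_of_nonneg_right q1 hN
  have t2 := mul_le_mul_of_nonneg_right q2 hN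
  have t3 := mul_le_mul_of_nonneg_right q3 hN
  have t4 := mul_le_mul_of_nonneg_right q4 hN
  linarith

theorem lipschitz_halfInv (α : ℕ) : LipschitzWith (1 + α) (halfInv α) := by
  refine LipschitzWith.of_dist_le_mul fun p q => ?_
  have h1 : dist p.1 q.1 ≤ dist p q := le_max_left _ _
  have h2 : dist p.2 q.2 ≤ dist p q := le_max_right _ _
  have h0 : 0 ≤ dist p q := dist_nonneg
  have hα : (0 : ℝ) ≤ α := by positivity
  rw [halfInv_eq, halfInv_eq, Prod.dist_eq]
  push_cast
  refine max_le (by nlinarith) ?_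
  refine (dist_add_add_le _ _ _ _).trans ?_
  have h3 : dist ((α : ℤ) • ((‖p.2‖ : ℝ) : UnitAddCircle)) ((α : ℤ) • ((‖q.2‖ : ℝ) : UnitAddCircle))
      ≤ α * dist p.2 q.2 := by
    rw [dist_eq_norm, ← smul_sub, ← AddCircle.coe_sub]
    refine (norm_zsmul_le _ _).trans ?_
    simp only [Int.norm_natCast]
    gcongr
    refine (circle_norm_coe_le _).trans ?_
    rw [dist_eq_norm]
    exact abs_norm_sub_norm_le _ _
  nlinarith

theorem lipFun_comp_clm {f : Torus → C2} (hf : f ∈ lipFun) (T : C2 →L[ℂ] C2) (α : ℕ) :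
    (fun p => T (f (halfInv α p))) ∈ lipFun := by
  obtain ⟨K, hK⟩ := hf
  exact ⟨_, T.lipschitz.comp (hK.comp (lipschitz_halfInv α))⟩

theorem lipschitz_softSign {ε : ℝ} (hε : 0 < ε) :
    LipschitzWith (2 / ε).toNNReal fun p : Torus => ((softSign ε p.2 : ℝ) : ℂ) := by
  refine LipschitzWith.of_dist_le_mul fun p q => ?_
  rw [Real.coe_toNNReal _ (by positivity), dist_eq_norm, ← Complex.ofReal_sub, Complex.norm_real,
    Real.norm_eq_abs]
  refine (abs_softSign_sub_le hε (abs_sawtooth_sub_le p.2 q.2)).trans ?_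
  have : dist p.2 q.2 ≤ dist p q := le_max_right _ _
  calc 2 * dist p.2 q.2 / ε ≤ 2 * dist p q / ε := by gcongr
    _ = _ := by ring

/-- The half step with the sign replaced by its Lipschitz approximation. -/
noncomputable def softHalf (α : ℕ) (ε : ℝ) (f : Torus → C2) (p : Torus) : C2 :=
  stepMap α (softSign ε p.2) (f (halfInv α p))

theorem softHalf_mem {ε : ℝ} (hε : 0 < ε) (hf : f ∈ lipFun) : softHalf α ε f ∈ lipFun := by
  have h1 := lip_smul_mem (lipschitz_softSign hε)
    (fun p => by rw [Complex.norm_real]; exact abs_softSign_le ε p.2)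
    (lipFun_comp_clm hf firstProj α)
  have h2 := lipFun.smul_mem (α : ℂ)⁻¹ (lipFun_comp_clm hf swapMap α)
  exact lipFun.add_mem h1 h2

theorem halfTransfer_sub_softHalf (α : ℕ) (ε : ℝ) (f : Torus → C2) :
    halfTransfer α f - softHalf α ε f = errorMul ε fun p => firstProj (f (halfInv α p)) := by
  funext p
  simp only [halfTransfer, softHalf, stepMap, errorMul, signError, Pi.sub_apply,
    add_apply, smul_apply, Complex.ofReal_sub, sub_smul]
  abel

/-- `halfInv` is Lipschitz, so the only discontinuity is the sign in front of the projection to the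
first axis. With the ramp in its place the half step is Lipschitz, and the error vanishes with ε
since σ and β are below one. -/
theorem approximable_halfTransfer_lip (hα : 4 ≤ α) (hf : f ∈ lipFun) :
    Approximable P α (halfTransfer α f) := by
  refine ⟨(BddMeas.of_lip hf).halfTransfer (by omega), fun η hη => ?_⟩
  have hF := lipFun_comp_clm hf firstProj α
  obtain ⟨B, hB0, hB⟩ := lipFun_bound hF
  obtain ⟨K, hK⟩ := id hF
  have hK0 : (0 : ℝ) ≤ K := K.2
  obtain ⟨ε, hε, hεη⟩ : ∃ ε : ℝ, 0 < ε ∧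
      10 * B * ε ^ (1 - P.σ) + (145 * B + K) * ε ^ (1 - P.β) ≤ η := by
    have hz : Tendsto (fun ε : ℝ => 10 * B * ε ^ (1 - P.σ) + (145 * B + K) * ε ^ (1 - P.β))
        (𝓝[>] 0) (𝓝 0) := by
      have h {r : ℝ} (hr : 0 < r) : Tendsto (fun ε : ℝ => ε ^ r) (𝓝[>] 0) (𝓝 0) := by
        have := (Real.continuousAt_rpow_const 0 r (Or.inr hr.le)).tendsto
        rw [Real.zero_rpow hr.ne'] at this
        exact this.mono_left nhdsWithin_le_nhds
      simpa using ((h (sub_pos.2 P.σ_lt)).const_mul (10 * B)).add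
        ((h (sub_pos.2 P.β_lt)).const_mul (145 * B + K))
    obtain ⟨ε, h1, h2⟩ := ((hz.eventually (ge_mem_nhds hη)).and self_mem_nhdsWithin).exists
    exact ⟨ε, h2, h1⟩
  refine ⟨softHalf α ε f, softHalf_mem hε hf, ?_⟩
  rw [halfTransfer_sub_softHalf]
  refine (add_le_add (stable_errorMul hα hε (.of_lip hF) hB0 hB)
    (unstable_errorMul hα hε (.of_lip hF) hB0 hB hK)).trans ?_
  rw [← ENNReal.ofReal_add (by positivity) (by positivity)]
  exact ENNReal.ofReal_le_ofReal hεη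

theorem Approximable.halfTransfer (hα : 100 ≤ α) (hu : Approximable P α u) :
    Approximable P α (halfTransfer α u) :=
  Approximable.map (C := 7000000) (by norm_num) (fun _ hf => hf.halfTransfer (by omega))
    (halfTransfer_sub α) (fun _ _ hf hN h => strong_halfTransfer hα hf hN h)
    (fun _ hf => approximable_halfTransfer_lip (by omega) hf) hu

/-! ### Multipliers -/

theorem strong_multiplier {e : Torus → ℂ} {K : ℝ≥0} (hα : 2 ≤ α) (hf : BddMeas f)
    (he : LipschitzWith K e) (he1 : ∀ p, ‖e p‖ ≤ 1) {N : ℝ} (hN : 0 ≤ N)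
    (h : strongENorm P α f ≤ ENNReal.ofReal N) :
    strongENorm P α (e • f) ≤ ENNReal.ofReal (12 * (1 + K) * N) := by
  have hs := (stableENorm_le_strongENorm P α f).trans h
  have hv := (unstableENorm_le_strongENorm P α f).trans h
  have hK0 : (0 : ℝ) ≤ K := K.2
  refine (add_le_add (stable_multiplier hf he he1 hN hs)
    (unstable_multiplier hα hf he he1 hN hs hN hv)).trans ?_
  rw [← ENNReal.ofReal_add (by positivity) (by positivity)]
  exact ENNReal.ofReal_le_ofReal (by ring_nf; rfl)

theorem Approximable.multiplier {e : Torus → ℂ} {K : ℝ≥0} (hα : 2 ≤ α)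
    (he : LipschitzWith K e) (he1 : ∀ p, ‖e p‖ ≤ 1) (hu : Approximable P α u) :
    Approximable P α (e • u) :=
  Approximable.map (A := fun f => e • f) (C := 12 * (1 + K)) (by have := K.2; positivity)
    (fun _ hf => hf.smul_fun he.continuous.measurable he1)
    (fun f g => by funext p; simp [smul_sub])
    (fun _ _ hf hN h => strong_multiplier hα hf he he1 hN h)
    (fun _ hf => .of_lip (lip_smul_mem he he1 hf)) hu

end StretchFold

namespace StretchFold

/-! ### The norms on the completion -/

open UniformSpace

variable {P : Params} {α : ℕ} {u v : Torus → C2}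

theorem StrongLip.fn_mem (f : StrongLip P α) : f.fn ∈ lipFun := f.2

theorem strongLip_norm_eq (f : StrongLip P α) : ‖f‖ = (strongENorm P α f.fn).toReal := by
  rw [strongLip_norm, strongENorm, ENNReal.toReal_add (stableENorm_lt_top P α f.fn_mem).ne
    (unstableENorm_lt_top P α f.fn_mem).ne]

theorem enorm_strongLip (f : StrongLip P α) : ENNReal.ofReal ‖f‖ = strongENorm P α f.fn := by
  rw [strongLip_norm_eq, ENNReal.ofReal_toReal (strongENorm_lt_top f.fn_mem).ne]

theorem strongLip_norm_le {f : StrongLip P α} {r : ℝ} (hr : 0 ≤ r)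
    (h : strongENorm P α f.fn ≤ ENNReal.ofReal r) : ‖f‖ ≤ r := by
  rw [strongLip_norm_eq]; exact ENNReal.toReal_le_of_le_ofReal hr h

/-- Each of the three norms remains 1-Lipschitz for the strong norm on the completion; bounds then
pass from functions to the elements they represent. -/
theorem extension_le_add (p : Seminorm ℂ lipFun)
    (hp : p ≤ stableSeminorm P α + unstableSeminorm P α) (x y : X P α) :
    Completion.extension (fun f : StrongLip P α => p (show lipFun from f)) x
      ≤ Completion.extension (fun f : StrongLip P α => p (show lipFun from f)) y + ‖x - y‖ := by
  induction x, y using Completion.induction_on₂ with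
  | hp =>
    exact isClosed_le (Completion.continuous_extension.comp continuous_fst)
      ((Completion.continuous_extension.comp continuous_snd).add
        (continuous_fst.sub continuous_snd).norm)
  | ih f g =>
    rw [Completion.extension_coe (uniformContinuous_seminorm p hp),
      Completion.extension_coe (uniformContinuous_seminorm p hp), ← Completion.coe_sub,
      Completion.norm_coe]
    have h1 := (abs_sub_map_le_sub p (show lipFun from f) (show lipFun from g)).trans (hp _)
    have h2 := (abs_le.1 h1).2
    change _ ≤ ‖f - g‖ at h2
    linarith

theorem weakSeminorm_le : weakSeminorm P α ≤ stableSeminorm P α + unstableSeminorm P α := by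
  intro f
  have h1 : weakSeminorm P α f ≤ stableSeminorm P α f :=
    ENNReal.toReal_mono (stableENorm_lt_top P α f.2).ne (weakENorm_le_stableENorm P α f)
  exact h1.trans (le_add_of_nonneg_right (apply_nonneg (unstableSeminorm P α) f))

theorem weakNorm_le_add (x y : X P α) : weakNorm x ≤ weakNorm y + ‖x - y‖ :=
  extension_le_add (weakSeminorm P α) weakSeminorm_le x y

theorem stableNorm_le_add (x y : X P α) : stableNorm x ≤ stableNorm y + ‖x - y‖ :=
  extension_le_add (stableSeminorm P α)
    (fun f => le_add_of_nonneg_right (apply_nonneg (unstableSeminorm P α) f)) x y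

theorem unstableNorm_le_add (x y : X P α) : unstableNorm x ≤ unstableNorm y + ‖x - y‖ :=
  extension_le_add (unstableSeminorm P α)
    (fun f => le_add_of_nonneg_left (apply_nonneg (stableSeminorm P α) f)) x y

theorem continuous_weakNorm : Continuous (weakNorm : X P α → ℝ) := Completion.continuous_extension

theorem continuous_stableNorm : Continuous (stableNorm : X P α → ℝ) :=
  Completion.continuous_extension

theorem continuous_unstableNorm : Continuous (unstableNorm : X P α → ℝ) :=
  Completion.continuous_extension

theorem norm_eq_stableNorm_add (x : X P α) : ‖x‖ = stableNorm x + unstableNorm x := by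
  induction x using Completion.induction_on with
  | hp => exact isClosed_eq continuous_norm (continuous_stableNorm.add continuous_unstableNorm)
  | ih f => rw [Completion.norm_coe, stableNorm_coe, unstableNorm_coe, strongLip_norm]

theorem weakNorm_nonneg (x : X P α) : 0 ≤ weakNorm x := by
  induction x using Completion.induction_on with
  | hp => exact isClosed_le continuous_const continuous_weakNorm
  | ih f => rw [weakNorm_coe]; exact ENNReal.toReal_nonneg

theorem stableNorm_nonneg (x : X P α) : 0 ≤ stableNorm x := by
  induction x using Completion.induction_on with
  | hp => exact isClosed_le continuous_const continuous_stableNorm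
  | ih f => rw [stableNorm_coe]; exact ENNReal.toReal_nonneg

theorem unstableNorm_nonneg (x : X P α) : 0 ≤ unstableNorm x := by
  induction x using Completion.induction_on with
  | hp => exact isClosed_le continuous_const continuous_unstableNorm
  | ih f => rw [unstableNorm_coe]; exact ENNReal.toReal_nonneg

/-! ### Elements of the completion that are functions -/

/-- A seminorm on the completion is bounded on an element that is a function by the corresponding
norm of the function. -/
theorem Represents.bound {x : X P α} (h : Represents x u) (hu : BddMeas u) {n : X P α → ℝ}
    {N : (Torus → C2) → ℝ≥0∞} (hn : ∀ x y, n x ≤ n y + ‖x - y‖)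
    (hnN : ∀ f : StrongLip P α, n (f : X P α) = (N f.fn).toReal)
    (hadd : ∀ f g, BddMeas f → BddMeas g → N (f + g) ≤ N f + N g)
    (hN : ∀ f, N f ≤ strongENorm P α f) {A : ℝ} (hA : 0 ≤ A) (huA : N u ≤ ENNReal.ofReal A) :
    n x ≤ A := by
  refine le_of_forall_pos_le_add fun ε hε => ?_
  obtain ⟨f, hxf, huf⟩ := h (ε / 2) (by positivity)
  have hf : BddMeas f.fn := .of_lip f.2
  have h1 : N f.fn ≤ ENNReal.ofReal (A + ε / 2) := by
    have e : f.fn = u + (f.fn - u) := by abel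
    rw [e, ENNReal.ofReal_add hA (by positivity)]
    refine (hadd _ _ hu (hf.sub hu)).trans (add_le_add huA ((hN _).trans ?_))
    rw [strongENorm_sub_comm]
    exact huf.le
  have h2 : n (f : X P α) ≤ A + ε / 2 := by
    rw [hnN]; exact ENNReal.toReal_le_of_le_ofReal (by positivity) h1
  linarith [hn x f]

theorem Represents.weakNorm_le {x : X P α} (h : Represents x u) (hu : BddMeas u) {A : ℝ}
    (hA : 0 ≤ A) (huA : weakENorm α u ≤ ENNReal.ofReal A) : weakNorm x ≤ A :=
  h.bound hu weakNorm_le_add weakNorm_coe (fun _ _ hf hg => hf.weakENorm_add hg)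
    (fun f => (weakENorm_le_stableENorm P α f).trans (stableENorm_le_strongENorm P α f)) hA huA

theorem Represents.stableNorm_le {x : X P α} (h : Represents x u) (hu : BddMeas u) {A : ℝ}
    (hA : 0 ≤ A) (huA : stableENorm P α u ≤ ENNReal.ofReal A) : stableNorm x ≤ A :=
  h.bound hu stableNorm_le_add stableNorm_coe (fun _ _ hf hg => hf.stableENorm_add P hg)
    (fun f => stableENorm_le_strongENorm P α f) hA huA

theorem Represents.unstableNorm_le {x : X P α} (h : Represents x u) (hu : BddMeas u) {A : ℝ}
    (hA : 0 ≤ A) (huA : unstableENorm P α u ≤ ENNReal.ofReal A) : unstableNorm x ≤ A :=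
  h.bound hu unstableNorm_le_add unstableNorm_coe (fun _ _ hf hg => hf.unstableENorm_add P hg)
    (fun f => unstableENorm_le_strongENorm P α f) hA huA

theorem Represents.norm_le {x : X P α} (h : Represents x u) (hu : BddMeas u) {A : ℝ}
    (hA : 0 ≤ A) (huA : strongENorm P α u ≤ ENNReal.ofReal A) : ‖x‖ ≤ A :=
  h.bound (n := norm) hu (fun x y => by
      have := norm_sub_norm_le x y; linarith)
    (fun f => by rw [Completion.norm_coe, strongLip_norm_eq])
    (fun _ _ hf hg => hf.strongENorm_add P hg) (fun _ => le_rfl) hA huA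

theorem Represents.sub {x y : X P α} (hx : Represents x u) (hy : Represents y v) (hu : BddMeas u)
    (hv : BddMeas v) : Represents (x - y) (u - v) := by
  intro ε hε
  obtain ⟨f, hf, hf'⟩ := hx (ε / 2) (by positivity)
  obtain ⟨g, hg, hg'⟩ := hy (ε / 2) (by positivity)
  refine ⟨f - g, ?_, ?_⟩
  · rw [Completion.coe_sub, show x - y - ((f : X P α) - g) = (x - f) - (y - g) by abel]
    exact (norm_sub_le _ _).trans_lt (by linarith)
  · have e : u - v - (f - g).fn = (u - f.fn) + (g.fn - v) := by
      change u - v - (f.fn - g.fn) = _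
      abel
    rw [e, ← add_halves ε, ENNReal.ofReal_add (by positivity) (by positivity)]
    refine ((hu.sub (.of_lip f.2)).strongENorm_add P ((BddMeas.of_lip g.2).sub hv)).trans_lt
      (ENNReal.add_lt_add hf' ?_)
    rwa [strongENorm_sub_comm]

theorem Represents.smul {x : X P α} (hx : Represents x u) (c : ℂ) : Represents (c • x) (c • u) := by
  intro ε hε
  obtain ⟨f, hf, hf'⟩ := hx (ε / (‖c‖ + 1)) (by positivity)
  have hlt : ‖c‖ * (ε / (‖c‖ + 1)) < ε := by
    rw [← mul_div_assoc, div_lt_iff₀ (by positivity)]; nlinarith [norm_nonneg c]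
  refine ⟨c • f, ?_, ?_⟩
  · rw [Completion.coe_smul, ← smul_sub, norm_smul]
    exact (mul_le_mul_of_nonneg_left hf.le (norm_nonneg _)).trans_lt hlt
  · have e : c • u - (c • f).fn = c • (u - f.fn) := by
      change c • u - c • f.fn = _
      rw [smul_sub]
    rw [e, strongENorm_smul, ← ofReal_norm]
    refine (mul_le_mul_right hf'.le _).trans_lt ?_
    rw [← ENNReal.ofReal_mul (norm_nonneg _)]
    exact (ENNReal.ofReal_lt_ofReal_iff hε).2 hlt

/-- The element is determined by the function. This yields the linearity of the operator built by
choosing representatives in `exists_extends`. -/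
theorem Represents.unique {x y : X P α} (hx : Represents x u) (hy : Represents y u)
    (hu : BddMeas u) : x = y := by
  have h := (hx.sub hy hu hu).norm_le (hu.sub hu) le_rfl
    (by rw [sub_self, strongENorm_zero]; exact zero_le)
  exact sub_eq_zero.1 (norm_le_zero_iff.1 h)

theorem Represents.add {x y : X P α} (hx : Represents x u) (hy : Represents y v) (hu : BddMeas u)
    (hv : BddMeas v) : Represents (x + y) (u + v) := by
  have h := hx.sub (hy.smul (-1)) hu (hv.const_smul (-1))
  simpa using h

theorem Approximable.exists_represents (hu : Approximable P α u) : ∃ x : X P α, Represents x u := by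
  have hpos (n : ℕ) : (0 : ℝ) < (1 / 2) ^ n := by positivity
  choose f hf hfu using fun n : ℕ => hu.2 ((1 / 2) ^ n) (hpos n)
  let F (n : ℕ) : StrongLip P α := ⟨f n, hf n⟩
  have hc : CauchySeq fun n => (F n : X P α) := by
    refine cauchySeq_of_le_geometric (1 / 2) 2 (by norm_num) fun n => ?_
    rw [dist_eq_norm, ← Completion.coe_sub, Completion.norm_coe]
    have h1 := hpos n
    refine (strongLip_norm_le (r := (1 / 2) ^ n + (1 / 2) ^ (n + 1)) (by positivity) ?_).trans ?_
    · have e : (F n - F (n + 1)).fn = (f n - u) + (u - f (n + 1)) := by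
        change f n - f (n + 1) = _
        abel
      rw [e, ENNReal.ofReal_add (by positivity) (by positivity)]
      refine (((BddMeas.of_lip (hf n)).sub hu.1).strongENorm_add P
        (hu.1.sub (.of_lip (hf _)))).trans (add_le_add ?_ (hfu _))
      rw [strongENorm_sub_comm]
      exact hfu n
    · rw [pow_succ]; linarith
  obtain ⟨x, hx⟩ := cauchySeq_tendsto_of_complete hc
  refine ⟨x, fun ε hε => ?_⟩
  have h1 : ∀ᶠ n in atTop, ‖x - F n‖ < ε := by
    have := Metric.tendsto_nhds.1 hx ε hε
    filter_upwards [this] with n hn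
    rwa [dist_comm, dist_eq_norm] at hn
  have h2 : ∀ᶠ n : ℕ in atTop, ((1 : ℝ) / 2) ^ n < ε :=
    (tendsto_pow_atTop_nhds_zero_of_lt_one (by norm_num) (by norm_num)).eventually
      (gt_mem_nhds hε)
  obtain ⟨n, hn1, hn2⟩ := (h1.and h2).exists
  exact ⟨F n, hn1, (hfu n).trans_lt ((ENNReal.ofReal_lt_ofReal_iff hε).2 hn2)⟩

/-! ### Extension of operators -/

/-- A linear operator on functions that maps Lipschitz functions boundedly to approximable functions
extends to the completion. -/
theorem exists_extends {A : (Torus → C2) → Torus → C2} (hadd : ∀ f g, A (f + g) = A f + A g)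
    (hsmul : ∀ (c : ℂ) f, A (c • f) = c • A f) (happ : ∀ f ∈ lipFun, Approximable P α (A f))
    {C : ℝ} (hC0 : 0 ≤ C) (hC : ∀ f N, BddMeas f → 0 ≤ N → strongENorm P α f ≤ ENNReal.ofReal N →
      strongENorm P α (A f) ≤ ENNReal.ofReal (C * N)) :
    ∃ L : X P α →L[ℂ] X P α, Extends L A := by
  choose T hT using fun f : StrongLip P α => (happ f.fn f.2).exists_represents
  let T₁ : StrongLip P α →ₗ[ℂ] X P α :=
    { toFun := T
      map_add' := fun f g => by
        refine (hT (f + g)).unique ?_ (happ _ (f + g).2).1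
        have h := (hT f).add (hT g) (happ _ f.2).1 (happ _ g.2).1
        rwa [← hadd] at h
      map_smul' := fun c f => by
        refine (hT (c • f)).unique ?_ (happ _ (c • f).2).1
        have h := (hT f).smul c
        rwa [← hsmul] at h }
  let T₂ : StrongLip P α →L[ℂ] X P α := T₁.mkContinuous C fun f =>
    (hT f).norm_le (happ _ f.2).1 (by positivity)
      (hC _ _ (.of_lip f.2) (norm_nonneg f) (enorm_strongLip f).ge)
  refine ⟨T₂.extend (Completion.toComplL (𝕜 := ℂ) (E := StrongLip P α)), fun f => ?_⟩
  have := T₂.extend_eq (e := Completion.toComplL (𝕜 := ℂ) (E := StrongLip P α))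
    Completion.denseRange_coe (Completion.isUniformInducing_coe _) f
  rw [Completion.coe_toComplL] at this
  rw [this]
  exact hT f

end StretchFold

namespace StretchFold

/-! ### The weak norm is a finite-rank seminorm up to a small multiple of the strong norm -/

open UniformSpace

variable {P : Params} {α : ℕ}

/-- A leaf with a test function of the weak norm. -/
structure Probe (α : ℕ) where
  leaf : Leaf α
  test : Torus → ℂ
  mem : MemLeaf 1 leaf test
  norm_le : leafNorm 1 leaf test ≤ 1

/-- The data of a leaf together with `n + 1` samples of the test function. -/
noncomputable def Probe.code (n : ℕ) (p : Probe α) :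
    Torus × EuclideanSpace ℝ (Fin 2) × ℝ × (Fin (n + 1) → ℂ) :=
  (p.leaf.base, p.leaf.dir, p.leaf.len, fun k => p.test (p.leaf.path (min ((k : ℝ) / n) p.leaf.len)))

theorem Probe.testOn (p : Probe α) : TestOn 0 p.leaf.len 1 1 fun t => p.test (p.leaf.path t) :=
  testOn_of_leafNorm p.norm_le

theorem totallyBounded_code (n : ℕ) : TotallyBounded (range (Probe.code (α := α) n)) := by
  have hK : IsCompact ((univ : Set Torus) ×ˢ Metric.closedBall (0 : EuclideanSpace ℝ (Fin 2)) 1 ×ˢ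
      Metric.closedBall (0 : ℝ) 1 ×ˢ Metric.closedBall (0 : Fin (n + 1) → ℂ) 1) :=
    isCompact_univ.prod ((isCompact_closedBall _ _).prod
      ((isCompact_closedBall _ _).prod (isCompact_closedBall _ _)))
  refine hK.totallyBounded.subset ?_
  rintro _ ⟨p, rfl⟩
  have hl := p.leaf.len_pos
  refine ⟨mem_univ _, ?_, ?_, ?_⟩
  · rw [mem_closedBall_zero_iff]; exact p.leaf.norm_dir.le
  · rw [mem_closedBall_zero_iff, Real.norm_eq_abs]
    exact (abs_of_pos hl).trans_le p.leaf.len_le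
  · rw [mem_closedBall_zero_iff, pi_norm_le_iff_of_nonneg zero_le_one]
    exact fun k => p.testOn.bdd _ ⟨le_min (by positivity) hl.le, min_le_right _ _⟩

theorem torusDist_le (x y : Torus) : torusDist x y ≤ 2 * dist x y := by
  have h1 : dist x.1 y.1 ≤ dist x y := le_max_left _ _
  have h2 : dist x.2 y.2 ≤ dist x y := le_max_right _ _
  rw [dist_eq_norm] at h1 h2
  refine Real.sqrt_le_iff.2 ⟨by positivity, ?_⟩
  nlinarith [norm_nonneg (x.1 - y.1), norm_nonneg (x.2 - y.2)]

/-- Test functions are 1-Lipschitz and sampled at spacing 1/n ≤ δ/4, so rounding a parameter down to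
a sample costs δ/4 for each function and the samples differ by less than δ/4. The leaf distance is
at most twice the distance of the bases plus two further terms, each below δ/4. -/
theorem code_close {n : ℕ} {δ : ℝ} (hδ : 0 < δ) (hn : 4 / δ ≤ n) {p p' : Probe α}
    (h : dist (p.code n) (p'.code n) < δ / 4) : leafDist p.leaf p'.leaf < δ ∧
      ∀ t ∈ Icc 0 (min p.leaf.len p'.leaf.len),
        ‖p.test (p.leaf.path t) - p'.test (p'.leaf.path t)‖ ≤ δ := by
  simp only [Probe.code, Prod.dist_eq, max_lt_iff] at h
  obtain ⟨⟨hb1, hb2⟩, hd, hl, hu⟩ := h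
  have hb : dist p.leaf.base p'.leaf.base < δ / 4 := max_lt hb1 hb2
  rw [dist_eq_norm] at hd
  rw [Real.dist_eq] at hl
  constructor
  · have := torusDist_le p.leaf.base p'.leaf.base
    unfold leafDist; linarith
  · intro t ht
    have hn0 : (0 : ℝ) < n := (by positivity : 0 < 4 / δ).trans_le hn
    have ht1 : t ≤ 1 := ht.2.trans ((min_le_left _ _).trans p.leaf.len_le)
    have hk : ⌊t * n⌋₊ < n + 1 := by
      have : ⌊t * n⌋₊ ≤ n := Nat.floor_le_of_le (by nlinarith)
      omega
    have hkt : (⌊t * n⌋₊ : ℝ) / n ≤ t := by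
      rw [div_le_iff₀ hn0]; exact Nat.floor_le (mul_nonneg ht.1 hn0.le)
    have htk : t - (⌊t * n⌋₊ : ℝ) / n ≤ δ / 4 := by
      have h1 := Nat.lt_floor_add_one (t * n)
      have h2 : (1 : ℝ) / n ≤ δ / 4 := by
        rw [div_le_iff₀ hn0]; rw [div_le_iff₀ hδ] at hn; linarith
      have h3 : t ≤ ((⌊t * n⌋₊ : ℝ) + 1) / n := by rw [le_div_iff₀ hn0]; exact h1.le
      rw [add_div] at h3
      linarith
    set s : ℝ := (⌊t * n⌋₊ : ℝ) / n with hs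
    have hs0 : 0 ≤ s := by positivity
    have hk' := (dist_pi_lt_iff (by positivity)).1 hu ⟨⌊t * n⌋₊, hk⟩
    have m1 := hkt.trans (ht.2.trans (min_le_left _ _))
    have m2 := hkt.trans (ht.2.trans (min_le_right _ _))
    simp only [← hs] at hk'
    rw [min_eq_left m1, min_eq_left m2, dist_eq_norm] at hk'
    have a1 := p.testOn.lip t ⟨ht.1, ht.2.trans (min_le_left _ _)⟩ s ⟨hs0, m1⟩
    have a2 := p'.testOn.lip t ⟨ht.1, ht.2.trans (min_le_right _ _)⟩ s ⟨hs0, m2⟩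
    rw [one_mul, abs_of_nonneg (sub_nonneg.2 hkt)] at a1 a2
    set x := p.test (p.leaf.path t)
    set y := p.test (p.leaf.path s)
    set x' := p'.test (p'.leaf.path t)
    set y' := p'.test (p'.leaf.path s)
    have e : x - x' = (x - y) + (y - y') - (x' - y') := by abel
    rw [e]
    refine (norm_sub_le _ _).trans ?_
    have := norm_add_le (x - y) (y - y')
    linarith

/-- The functional of a probe on the Lipschitz functions. -/
noncomputable def Probe.functional (P : Params) (p : Probe α) : StrongLip P α →L[ℂ] C2 :=
  LinearMap.mkContinuous
    { toFun := fun f => leafIntegral p.leaf f.fn p.test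
      map_add' := fun f g => leafIntegral_add one_pos
        (ne_top_of_le_ne_top ENNReal.one_ne_top p.norm_le) f.fn_mem g.fn_mem
      map_smul' := fun c f => leafIntegral_smul p.leaf p.test c f.fn } 1 fun f => by
    have h0 : ‖leafIntegral p.leaf f.fn p.test‖ₑ ≤ weakENorm α f.fn :=
      le_iSup_of_le p.leaf (le_iSup_of_le p.test (le_iSup_of_le ⟨p.mem, p.norm_le⟩ le_rfl))
    have h1 := h0.trans ((weakENorm_le_stableENorm P α _).trans (stableENorm_le_strongENorm P α _))
    rw [← enorm_strongLip, ← ofReal_norm, ENNReal.ofReal_le_ofReal_iff (norm_nonneg _)] at h1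
    rw [one_mul]
    exact h1

theorem Probe.functional_apply (p : Probe α) (f : StrongLip P α) :
    p.functional P f = leafIntegral p.leaf f.fn p.test := rfl

/-- Up to a small multiple of the strong norm, the weak norm is bounded by finitely many
functionals. -/
theorem exists_finiteRank (P : Params) (hα : 2 ≤ α) {ε : ℝ} (hε : 0 < ε) :
    ∃ (n : ℕ) (l : X P α →L[ℂ] (Fin n → C2)), ∀ x : X P α, weakNorm x ≤ ‖l x‖ + ε * ‖x‖ := by
  have hα' : (2 : ℝ) ≤ α := by exact_mod_cast hα
  obtain ⟨δ, hδ, hδα, hδε⟩ : ∃ δ : ℝ, 0 < δ ∧ δ ≤ 2 / (α : ℝ) ∧ 8 * δ ^ P.β ≤ ε := by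
    have hz : Tendsto (fun δ : ℝ => 8 * δ ^ P.β) (𝓝[>] 0) (𝓝 0) := by
      have := (Real.continuousAt_rpow_const 0 P.β (Or.inr P.β_pos.le)).tendsto
      rw [Real.zero_rpow P.β_pos.ne'] at this
      simpa using (this.mono_left nhdsWithin_le_nhds).const_mul 8
    have h2 : ∀ᶠ δ : ℝ in 𝓝[>] 0, δ ≤ 2 / (α : ℝ) :=
      nhdsWithin_le_nhds (ge_mem_nhds (by positivity))
    obtain ⟨δ, h1, h2, h3⟩ := ((hz.eventually (ge_mem_nhds hε)).and
      (h2.and self_mem_nhdsWithin)).exists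
    exact ⟨δ, h3, h2, h1⟩
  have hδ1 : δ ≤ 1 := hδα.trans ((div_le_one (by linarith)).2 hα')
  obtain ⟨N, hN⟩ := exists_nat_ge (4 / δ)
  -- The centres of the cover are taken among the codes themselves, so each one is an actual probe
  -- and defines a functional.
  obtain ⟨t, ht, htf, hcov⟩ := totallyBounded_iff_subset.1 (totallyBounded_code (α := α) N) _
    (Metric.dist_mem_uniformity (by positivity : 0 < δ / 4))
  obtain ⟨n, ⟨e⟩⟩ : ∃ n, Nonempty (t ≃ Fin n) := by
    have := htf.fintype
    exact ⟨_, ⟨Fintype.equivFin t⟩⟩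
  choose p hp using fun i : Fin n => ht (e.symm i).2
  let l₀ : StrongLip P α →L[ℂ] (Fin n → C2) := ContinuousLinearMap.pi fun i => (p i).functional P
  refine ⟨n, l₀.extend (Completion.toComplL (𝕜 := ℂ) (E := StrongLip P α)), fun x => ?_⟩
  induction x using Completion.induction_on with
  | hp =>
    exact isClosed_le continuous_weakNorm
      ((ContinuousLinearMap.continuous _).norm.add (continuous_norm.const_mul ε))
  | ih f =>
    have hext := l₀.extend_eq (e := Completion.toComplL (𝕜 := ℂ) (E := StrongLip P α))
      Completion.denseRange_coe (Completion.isUniformInducing_coe _) f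
    rw [Completion.coe_toComplL] at hext
    rw [hext, weakNorm_coe, Completion.norm_coe]
    refine ENNReal.toReal_le_of_le_ofReal (by positivity) ?_
    refine iSup_le fun W => iSup_le fun φ => iSup_le fun hφ => ?_
    let p₀ : Probe α := ⟨W, φ, hφ.1, hφ.2⟩
    obtain ⟨y, hy, hdist⟩ : ∃ y ∈ t, dist (p₀.code N) y < δ / 4 := by
      simpa using hcov (mem_range_self p₀)
    obtain ⟨i, hi⟩ : ∃ i, (p i).code N = y := ⟨e ⟨y, hy⟩, by rw [hp]; simp⟩
    rw [← hi] at hdist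
    obtain ⟨hd, hu⟩ := code_close hδ hN hdist
    set s := (stableENorm P α f.fn).toReal with hs
    set v := (unstableENorm P α f.fn).toReal with hv
    have hfs : s + v = ‖f‖ := (strongLip_norm f).symm
    have hs0 : 0 ≤ s := ENNReal.toReal_nonneg
    have hv0 : 0 ≤ v := ENNReal.toReal_nonneg
    have hcmp := unstable_compare (.of_lip f.fn_mem)
      (ENNReal.ofReal_toReal (stableENorm_lt_top P α f.fn_mem).ne).ge hs0
      (ENNReal.ofReal_toReal (unstableENorm_lt_top P α f.fn_mem).ne).ge hv0 one_pos hδ hδ1 hδα hd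
      p₀.testOn (p i).testOn (by simpa using hu) (W.closes_comp_path φ)
      ((p i).leaf.closes_comp_path (p i).test)
    rw [← ofReal_norm]
    refine ENNReal.ofReal_le_ofReal ?_
    have h1 : ‖leafIntegral (p i).leaf f.fn (p i).test‖ ≤ ‖l₀ f‖ := by
      have := norm_le_pi_norm (l₀ f) i
      simpa [l₀, Probe.functional_apply] using this
    have h2 : ‖leafIntegral W f.fn φ - leafIntegral (p i).leaf f.fn (p i).test‖ ≤ ε * ‖f‖ := by
      refine hcmp.trans ?_
      calc (2 * 1 * v + 8 * 1 * s) * δ ^ P.β ≤ (8 * (s + v)) * δ ^ P.β := by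
            gcongr; linarith
        _ = 8 * δ ^ P.β * ‖f‖ := by rw [hfs]; ring
        _ ≤ _ := by gcongr
    have h3 := norm_le_norm_add_norm_sub (leafIntegral (p i).leaf f.fn (p i).test)
      (leafIntegral W f.fn φ)
    rw [norm_sub_rev] at h3
    linarith

end StretchFold

namespace StretchFold

/-! ### The transfer operator -/

variable {P : Params} {α : ℕ} {f : Torus → C2}

theorem transfer_add (hα : 1 ≤ α) (f g : Torus → C2) :
    transfer α (f + g) = transfer α f + transfer α g := by
  simp only [← halfTransfer_halfTransfer hα, halfTransfer_add]

theorem transfer_smul (hα : 1 ≤ α) (c : ℂ) (f : Torus → C2) :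
    transfer α (c • f) = c • transfer α f := by
  simp only [← halfTransfer_halfTransfer hα, halfTransfer_smul]

theorem BddMeas.transfer (hα : 1 ≤ α) (hf : BddMeas f) : BddMeas (transfer α f) := by
  rw [← halfTransfer_halfTransfer hα]; exact (hf.halfTransfer hα).halfTransfer hα

theorem Approximable.transfer (hα : 100 ≤ α) (hf : Approximable P α f) :
    Approximable P α (transfer α f) := by
  rw [← halfTransfer_halfTransfer (by omega)]; exact (hf.halfTransfer hα).halfTransfer hα

theorem strong_transfer (hα : 100 ≤ α) (hf : BddMeas f) {N : ℝ} (hN : 0 ≤ N)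
    (h : strongENorm P α f ≤ ENNReal.ofReal N) :
    strongENorm P α (transfer α f) ≤ ENNReal.ofReal (49 * 10 ^ 12 * N) := by
  rw [← halfTransfer_halfTransfer (by omega)]
  have := strong_halfTransfer hα (hf.halfTransfer (by omega)) (by positivity)
    (strong_halfTransfer hα hf hN h)
  rwa [show (7000000 : ℝ) * (7000000 * N) = 49 * 10 ^ 12 * N by ring] at this

/-! ### Two half steps combined -/

section bounds

variable {w s v : ℝ}

theorem weak_transfer (hα : 100 ≤ α) (hf : BddMeas f) (hw0 : 0 ≤ w)
    (hw : weakENorm α f ≤ ENNReal.ofReal w) :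
    weakENorm α (transfer α f) ≤ ENNReal.ofReal (160000 * w) := by
  rw [← halfTransfer_halfTransfer (by omega)]
  have := weak_halfTransfer (by omega) (hf.halfTransfer (by omega)) (by positivity)
    (weak_halfTransfer (by omega) hf hw0 hw)
  rwa [show (400 : ℝ) * (400 * w) = 160000 * w by ring] at this

theorem natCast_rpow_le_one (hα : 1 ≤ α) {r : ℝ} (hr : r ≤ 0) : (α : ℝ) ^ r ≤ 1 :=
  Real.rpow_le_one_of_one_le_of_nonpos (by exact_mod_cast hα) hr

theorem natCast_rpow_le (hα : 1 ≤ α) {r r' : ℝ} (hr : r ≤ r') : (α : ℝ) ^ r ≤ (α : ℝ) ^ r' :=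
  Real.rpow_le_rpow_of_exponent_le (by exact_mod_cast hα) hr

/-- The half-step factor a + b is squared, and its cross term is absorbed by (a + b)² ≤ 2(a² + b²).
The weak terms of both half steps are kept with bounded coefficients. -/
theorem stable_transfer (hα : 100 ≤ α) (hf : BddMeas f) (hw0 : 0 ≤ w)
    (hw : weakENorm α f ≤ ENNReal.ofReal w) (hs0 : 0 ≤ s)
    (hs : stableENorm P α f ≤ ENNReal.ofReal s) :
    stableENorm P α (transfer α f) ≤ ENNReal.ofReal
      (2000000 * ((α : ℝ) ^ (-2 * P.q) + (α : ℝ) ^ (2 * P.σ - 2)) * s + 2400000 * w) := by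
  have hα1 : 1 ≤ α := by omega
  have hα0 : (0 : ℝ) < α := by exact_mod_cast hα1
  rw [← halfTransfer_halfTransfer hα1]
  refine (stable_halfTransfer (by omega) (hf.halfTransfer hα1) (by positivity)
    (weak_halfTransfer (by omega) hf hw0 hw) (by positivity)
    (stable_halfTransfer (by omega) hf hw0 hw hs0 hs)).trans (ENNReal.ofReal_le_ofReal ?_)
  have e1 : (α : ℝ) ^ (-2 * P.q) = (α : ℝ) ^ (-P.q) * (α : ℝ) ^ (-P.q) := by
    rw [← Real.rpow_add hα0]; congr 1; ring
  have e2 : (α : ℝ) ^ (2 * P.σ - 2) = (α : ℝ) ^ (P.σ - 1) * (α : ℝ) ^ (P.σ - 1) := by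
    rw [← Real.rpow_add hα0]; congr 1; ring
  have p1 := natCast_rpow_le_one hα1 (r := -P.q) (by linarith [P.q_pos])
  have p2 := natCast_rpow_le_one hα1 (r := P.σ - 1) (by linarith [P.σ_lt])
  rw [e1, e2]
  set a := (α : ℝ) ^ (-P.q)
  set b := (α : ℝ) ^ (P.σ - 1)
  have h1 : (a + b) * w ≤ 2 * w := mul_le_mul_of_nonneg_right (by linarith) hw0
  have h2 : (a + b) * (a + b) * s ≤ 2 * (a * a + b * b) * s :=
    mul_le_mul_of_nonneg_right (by nlinarith [sq_nonneg (a - b)]) hs0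
  linarith

/-- The second half step sees the stable norm of the first image, at most a multiple of s + w,
multiplied by α^(β-1); only the unstable term is contracted twice. -/
theorem unstable_transfer (hα : 100 ≤ α) (hf : BddMeas f) (hw0 : 0 ≤ w)
    (hw : weakENorm α f ≤ ENNReal.ofReal w) (hs0 : 0 ≤ s)
    (hs : stableENorm P α f ≤ ENNReal.ofReal s) (hv0 : 0 ≤ v)
    (hv : unstableENorm P α f ≤ ENNReal.ofReal v) :
    unstableENorm P α (transfer α f) ≤ ENNReal.ofReal
      (3 * 10 ^ 13 * ((α : ℝ) ^ (-1 + P.β) * (s + w) + (α : ℝ) ^ (-2 * P.β) * v)) := by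
  have hα1 : 1 ≤ α := by omega
  have hα0 : (0 : ℝ) < α := by exact_mod_cast hα1
  rw [← halfTransfer_halfTransfer hα1]
  refine (unstable_halfTransfer hα (hf.halfTransfer hα1) (by positivity)
    (stable_halfTransfer (by omega) hf hw0 hw hs0 hs) (by positivity)
    (unstable_halfTransfer hα hf hs0 hs hv0 hv)).trans (ENNReal.ofReal_le_ofReal ?_)
  have e1 : (α : ℝ) ^ (-2 * P.β) = (α : ℝ) ^ (-P.β) * (α : ℝ) ^ (-P.β) := by
    rw [← Real.rpow_add hα0]; congr 1; ring
  have p1 := natCast_rpow_le_one hα1 (r := -P.q) (by linarith [P.q_pos])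
  have p2 := natCast_rpow_le_one hα1 (r := P.σ - 1) (by linarith [P.σ_lt])
  have p3 := natCast_rpow_le_one hα1 (r := -P.β) (by linarith [P.β_pos])
  rw [e1, show -1 + P.β = P.β - 1 by ring]
  have c0 : 0 ≤ (α : ℝ) ^ (P.β - 1) := by positivity
  have d0 : 0 ≤ (α : ℝ) ^ (-P.β) := by positivity
  set a := (α : ℝ) ^ (-P.q)
  set b := (α : ℝ) ^ (P.σ - 1)
  set c := (α : ℝ) ^ (P.β - 1)
  set d := (α : ℝ) ^ (-P.β)
  have h1 : c * ((a + b) * s) ≤ c * (2 * s) :=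
    mul_le_mul_of_nonneg_left (mul_le_mul_of_nonneg_right (by linarith) hs0) c0
  have h2 : d * (c * s) ≤ 1 * (c * s) := mul_le_mul_of_nonneg_right p3 (by positivity)
  have h3 : 0 ≤ c * s := by positivity
  have h4 : 0 ≤ c * w := by positivity
  have h5 : 0 ≤ d * d * v := by positivity
  linarith

end bounds

/-! ### The phase -/

/-- The phase `e^{2πig}`. -/
noncomputable def phase (g : Torus → ℝ) (p : Torus) : ℂ :=
  Complex.exp (2 * Real.pi * Complex.I * (g p : ℂ))

theorem phaseTransfer_eq (g : Torus → ℝ) (α : ℕ) (f : Torus → C2) :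
    phaseTransfer g α f = phase g • transfer α f := rfl

theorem norm_phase_le (g : Torus → ℝ) (p : Torus) : ‖phase g p‖ ≤ 1 := by
  have e : 2 * Real.pi * Complex.I * (g p : ℂ) = ((2 * Real.pi * g p : ℝ) : ℂ) * Complex.I := by
    push_cast; ring
  rw [phase, e, Complex.norm_exp_ofReal_mul_I]

theorem lipschitz_phase {g : Torus → ℝ} {K : ℝ≥0} (hg : LipschitzWith K g) :
    LipschitzWith (7 * K) (phase g) := by
  refine LipschitzWith.of_dist_le_mul fun p q => ?_
  have e (p : Torus) : phase g p = Complex.exp (Complex.I * ((2 * Real.pi * g p : ℝ) : ℂ)) := by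
    rw [phase]; congr 1; push_cast; ring
  have h1 : phase g p - phase g q
      = phase g q * (Complex.exp (Complex.I * ((2 * Real.pi * (g p - g q) : ℝ) : ℂ)) - 1) := by
    rw [e, e, mul_sub, ← Complex.exp_add, mul_one]
    congr 2; push_cast; ring
  have h2 := Real.norm_exp_I_mul_ofReal_sub_one_le (x := 2 * Real.pi * (g p - g q))
  have h3 := hg.dist_le_mul p q
  rw [Real.dist_eq] at h3
  rw [dist_eq_norm, h1, norm_mul]
  refine (mul_le_of_le_one_left (norm_nonneg _) (norm_phase_le g q)).trans (h2.trans ?_)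
  rw [Real.norm_eq_abs, abs_mul, abs_of_pos Real.two_pi_pos]
  have h4 : 2 * Real.pi ≤ 7 := by linarith [Real.pi_lt_d2]
  push_cast
  rw [mul_assoc 7]
  exact mul_le_mul h4 h3 (abs_nonneg _) (by norm_num)

/-! ### Bounds on the completion -/

open UniformSpace

theorem exists_transfer (P : Params) (hα : 100 ≤ α) :
    ∃ L : X P α →L[ℂ] X P α, Extends L (transfer α) :=
  exists_extends (transfer_add (by omega)) (transfer_smul (by omega))
    (fun _ hf => (Approximable.of_lip hf).transfer hα) (C := 49 * 10 ^ 12) (by positivity)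
    fun _ _ hf hN h => strong_transfer hα hf hN h

theorem exists_phaseTransfer (P : Params) (hα : 100 ≤ α) {g : Torus → ℝ} {K : ℝ≥0}
    (hg : LipschitzWith K g) : ∃ L : X P α →L[ℂ] X P α, Extends L (phaseTransfer g α) := by
  have hK := (7 * K).2
  refine exists_extends (A := phaseTransfer g α) (fun f h => ?_) (fun c f => ?_) (fun f hf => ?_)
    (C := 12 * (1 + (7 * K : ℝ≥0)) * (49 * 10 ^ 12)) (by positivity) fun f N hf hN h => ?_
  · simp only [phaseTransfer_eq]; rw [transfer_add (by omega), smul_add]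
  · simp only [phaseTransfer_eq]; rw [transfer_smul (by omega), smul_comm]
  · exact ((Approximable.of_lip hf).transfer hα).multiplier (by omega) (lipschitz_phase hg)
      (norm_phase_le g)
  · rw [phaseTransfer_eq, mul_assoc]
    exact strong_multiplier (by omega) (hf.transfer (by omega)) (lipschitz_phase hg)
      (norm_phase_le g) (by positivity) (strong_transfer hα hf hN h)

theorem weakENorm_le_ofReal (f : StrongLip P α) :
    weakENorm α f.fn ≤ ENNReal.ofReal (weakNorm (f : X P α)) := by
  rw [weakNorm_coe, ENNReal.ofReal_toReal (weakENorm_lt_top P α f.fn_mem).ne]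

theorem stableENorm_le_ofReal (f : StrongLip P α) :
    stableENorm P α f.fn ≤ ENNReal.ofReal (stableNorm (f : X P α)) := by
  rw [stableNorm_coe, ENNReal.ofReal_toReal (stableENorm_lt_top P α f.fn_mem).ne]

theorem unstableENorm_le_ofReal (f : StrongLip P α) :
    unstableENorm P α f.fn ≤ ENNReal.ofReal (unstableNorm (f : X P α)) := by
  rw [unstableNorm_coe, ENNReal.ofReal_toReal (unstableENorm_lt_top P α f.fn_mem).ne]

variable {L : X P α →L[ℂ] X P α}

theorem Extends.transfer_bounds (hα : 100 ≤ α) (hL : Extends L (transfer α)) (h : X P α) :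
    weakNorm (L h) ≤ 160000 * weakNorm h ∧
    stableNorm (L h) ≤ 2000000 * ((α : ℝ) ^ (-2 * P.q) + (α : ℝ) ^ (2 * P.σ - 2)) * stableNorm h
      + 2400000 * weakNorm h ∧
    unstableNorm (L h) ≤ 3 * 10 ^ 13 * ((α : ℝ) ^ (-1 + P.β) * (stableNorm h + weakNorm h)
      + (α : ℝ) ^ (-2 * P.β) * unstableNorm h) := by
  have cw := continuous_weakNorm (P := P) (α := α)
  have cs := continuous_stableNorm (P := P) (α := α)
  have cu := continuous_unstableNorm (P := P) (α := α)
  induction h using Completion.induction_on with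
  | hp =>
    have hLc := L.continuous
    refine (isClosed_le (cw.comp hLc) (by fun_prop)).inter
      ((isClosed_le (cs.comp hLc) (by fun_prop)).inter (isClosed_le (cu.comp hLc) (by fun_prop)))
  | ih f =>
    have hf := BddMeas.of_lip f.fn_mem
    have hT := hf.transfer (α := α) (by omega)
    have w0 := weakNorm_nonneg (f : X P α)
    have s0 := stableNorm_nonneg (f : X P α)
    have v0 := unstableNorm_nonneg (f : X P α)
    have hw := weakENorm_le_ofReal f
    have hs := stableENorm_le_ofReal f
    have hv := unstableENorm_le_ofReal f
    generalize weakNorm (f : X P α) = w at *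
    generalize stableNorm (f : X P α) = s at *
    generalize unstableNorm (f : X P α) = v at *
    exact ⟨(hL f).weakNorm_le hT (by positivity) (weak_transfer hα hf w0 hw),
      (hL f).stableNorm_le hT (by positivity) (stable_transfer hα hf w0 hw s0 hs),
      (hL f).unstableNorm_le hT (by positivity) (unstable_transfer hα hf w0 hw s0 hs v0 hv)⟩

/-- The rate of contraction of the twisted transfer operator. -/
noncomputable def Params.η (P : Params) : ℝ :=
  min (min (2 * P.q) (2 - 2 * P.σ)) (min (1 - P.β) (2 * P.β))

theorem Params.η_pos (P : Params) : 0 < P.η := by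
  have := P.q_pos
  have := P.σ_lt
  have := P.β_pos
  have := P.β_lt
  exact lt_min (lt_min (by linarith) (by linarith)) (lt_min (by linarith) (by linarith))

/-- The phase spoils each bound by a factor proportional to its Lipschitz constant, independent of
α. All contraction rates are at least α^(-η), since η is the least of the four exponents in the
stable and unstable bounds. -/
theorem Extends.phaseTransfer_bounds (hα : 100 ≤ α) {g : Torus → ℝ} {K : ℝ≥0}
    (hg : LipschitzWith K g) (hL : Extends L (phaseTransfer g α)) (h : X P α) :
    weakNorm (L h) ≤ 7 * 10 ^ 14 * (1 + 7 * K) * weakNorm h ∧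
    ‖L h‖ ≤ 7 * 10 ^ 14 * (1 + 7 * K) * (α : ℝ) ^ (-P.η) * ‖h‖
      + 7 * 10 ^ 14 * (1 + 7 * K) * weakNorm h := by
  have cw := continuous_weakNorm (P := P) (α := α)
  have hα1 : 1 ≤ α := by omega
  have hK : (0 : ℝ) ≤ K := K.2
  induction h using Completion.induction_on with
  | hp =>
    have hLc := L.continuous
    exact (isClosed_le (cw.comp hLc) (by fun_prop)).inter (isClosed_le hLc.norm (by fun_prop))
  | ih f =>
    have hf := BddMeas.of_lip f.fn_mem
    have hT := hf.transfer (α := α) hα1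
    have he := lipschitz_phase hg
    have he1 := norm_phase_le g
    have hE : BddMeas (phaseTransfer g α f.fn) := hT.smul_fun he.continuous.measurable he1
    have w0 := weakNorm_nonneg (f : X P α)
    have s0 := stableNorm_nonneg (f : X P α)
    have v0 := unstableNorm_nonneg (f : X P α)
    have hw := weakENorm_le_ofReal f
    have hs := stableENorm_le_ofReal f
    have hv := unstableENorm_le_ofReal f
    have hsv := norm_eq_stableNorm_add (f : X P α)
    rw [hsv]
    clear hsv
    generalize weakNorm (f : X P α) = w at *
    generalize stableNorm (f : X P α) = s at *
    generalize unstableNorm (f : X P α) = v at *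
    constructor
    · refine ((hL f).weakNorm_le hE (by positivity)
        (weak_multiplier he he1 (by positivity) (weak_transfer hα hf w0 hw))).trans ?_
      push_cast
      have : 0 ≤ (1 + 7 * (K : ℝ)) * w := by positivity
      linarith
    · have hS := stable_transfer (P := P) hα hf w0 hw s0 hs
      have hU := unstable_transfer hα hf w0 hw s0 hs v0 hv
      have hη1 : P.η ≤ 2 * P.q := (min_le_left _ _).trans (min_le_left _ _)
      have hη2 : P.η ≤ 2 - 2 * P.σ := (min_le_left _ _).trans (min_le_right _ _)
      have hη3 : P.η ≤ 1 - P.β := (min_le_right _ _).trans (min_le_left _ _)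
      have hη4 : P.η ≤ 2 * P.β := (min_le_right _ _).trans (min_le_right _ _)
      have r1 := natCast_rpow_le hα1 (show -2 * P.q ≤ -P.η by linarith)
      have r2 := natCast_rpow_le hα1 (show 2 * P.σ - 2 ≤ -P.η by linarith)
      have r3 := natCast_rpow_le hα1 (show -1 + P.β ≤ -P.η by linarith)
      have r4 := natCast_rpow_le hα1 (show -2 * P.β ≤ -P.η by linarith)
      have r5 := natCast_rpow_le_one hα1 (r := -1 + P.β) (by linarith [P.β_lt])
      have a0 : 0 ≤ (α : ℝ) ^ (-P.η) := by positivity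
      set a := (α : ℝ) ^ (-P.η)
      have m1 : ((α : ℝ) ^ (-2 * P.q) + (α : ℝ) ^ (2 * P.σ - 2)) * s ≤ (a + a) * s :=
        mul_le_mul_of_nonneg_right (by linarith) s0
      have m2 : (α : ℝ) ^ (-1 + P.β) * s ≤ a * s := mul_le_mul_of_nonneg_right r3 s0
      have m3 : (α : ℝ) ^ (-1 + P.β) * w ≤ 1 * w := mul_le_mul_of_nonneg_right r5 w0
      have m4 : (α : ℝ) ^ (-2 * P.β) * v ≤ a * v := mul_le_mul_of_nonneg_right r4 v0
      have as0 : 0 ≤ a * s := by positivity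
      have av0 : 0 ≤ a * v := by positivity
      replace hS := hS.trans (ENNReal.ofReal_le_ofReal
        (show _ ≤ 3 * 10 ^ 13 * (a * s + w) by linarith))
      replace hU := hU.trans (ENNReal.ofReal_le_ofReal
        (show _ ≤ 3 * 10 ^ 13 * (a * s + a * v + w) by linarith))
      have hst := stable_multiplier hT he he1 (by positivity) hS
      have hun := unstable_multiplier (by omega) hT he he1 (by positivity) hS (by positivity) hU
      have key := (hL f).norm_le hE (A := 2 * (1 + (7 * K : ℝ≥0)) * (3 * 10 ^ 13 * (a * s + w))
        + (1 + (7 * K : ℝ≥0)) * (2 * (3 * 10 ^ 13 * (a * s + a * v + w))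
          + 8 * (3 * 10 ^ 13 * (a * s + w)))) (by positivity) (by
          rw [ENNReal.ofReal_add (by positivity) (by positivity)]
          exact add_le_add hst hun)
      refine key.trans ?_
      push_cast
      have k1 : 0 ≤ (1 + 7 * (K : ℝ)) * (a * s) := by positivity
      have k2 : 0 ≤ (1 + 7 * (K : ℝ)) * (a * v) := by positivity
      have k3 : 0 ≤ (1 + 7 * (K : ℝ)) * w := by positivity
      linarith

end StretchFold

/-! ### Assembly of the proposition -/

open StretchFold
theorem proposition5p1 (P : Params) :
    (∃ C : ℝ, 0 < C ∧ ∃ α₀ : ℝ, 0 < α₀ ∧ ∀ α : ℕ, Even α → α₀ ≤ (α : ℝ) →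
      ∃ L : X P α →L[ℂ] X P α, Extends L (transfer α) ∧ ∀ h : X P α,
        weakNorm (L h) ≤ C * weakNorm h ∧
        stableNorm (L h) ≤
          C * ((α : ℝ) ^ (-2 * P.q) + (α : ℝ) ^ (2 * P.σ - 2)) * stableNorm h + C * weakNorm h ∧
        unstableNorm (L h) ≤
          C * (((α : ℝ) ^ (-2 + P.σ + P.β) + (α : ℝ) ^ (-1 + P.β)
              + (α : ℝ) ^ (-2 * P.q + P.β - P.σ)) * stableNorm h
            + (α : ℝ) ^ (-2 * P.β) * unstableNorm h + (α : ℝ) ^ (P.β - P.σ) * weakNorm h)) ∧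
    (∃ η : ℝ, 0 < η ∧ ∀ g : Torus → ℝ, (∃ K : ℝ≥0, LipschitzWith K g) →
      ∃ C : ℝ, 0 < C ∧ ∃ α₀ : ℝ, 0 < α₀ ∧ ∀ α : ℕ, Even α → α₀ ≤ (α : ℝ) →
        ∃ L : X P α →L[ℂ] X P α, Extends L (phaseTransfer g α) ∧
          (∀ h : X P α,
            ‖L h‖ ≤ C * (α : ℝ) ^ (-η) * ‖h‖ + C * weakNorm h ∧
            weakNorm (L h) ≤ C * weakNorm h) ∧
          ∀ μ ∈ spectrum ℂ L, C * (α : ℝ) ^ (-η) < ‖μ‖ →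
            Module.End.HasEigenvalue (L : X P α →ₗ[ℂ] X P α) μ ∧
            (∀ᶠ z in 𝓝[≠] μ, z ∉ spectrum ℂ L) ∧
            FiniteDimensional ℂ
              (Module.End.maxGenEigenspace (L : X P α →ₗ[ℂ] X P α) μ)) := by
  refine ⟨⟨3 * 10 ^ 13, by positivity, 100, by norm_num, fun α _ hα' => ?_⟩,
    P.η, P.η_pos, fun g ⟨K, hg⟩ => ⟨8 * (7 * 10 ^ 14 * (1 + 7 * K)), ?_, 100, by norm_num,
      fun α _ hα' => ?_⟩⟩
  · have hα : 100 ≤ α := by exact_mod_cast hα'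
    obtain ⟨L, hL⟩ := exists_transfer P hα
    refine ⟨L, hL, fun h => ?_⟩
    obtain ⟨h1, h2, h3⟩ := hL.transfer_bounds hα h
    have w0 := weakNorm_nonneg h
    have s0 := stableNorm_nonneg h
    generalize weakNorm h = w at *
    generalize stableNorm h = s at *
    generalize unstableNorm h = v at *
    have b1 : 0 ≤ ((α : ℝ) ^ (-2 * P.q) + (α : ℝ) ^ (2 * P.σ - 2)) * s := by positivity
    have b2 : 0 ≤ (α : ℝ) ^ (-2 + P.σ + P.β) * s := by positivity
    have b3 : 0 ≤ (α : ℝ) ^ (-2 * P.q + P.β - P.σ) * s := by positivity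
    -- The half-step argument gives the weak norm the smaller coefficient α^(β-1), and σ < 1
    -- compares it with the required one. The other stable terms on the right are simply added.
    have b4 : (α : ℝ) ^ (-1 + P.β) * w ≤ (α : ℝ) ^ (P.β - P.σ) * w :=
      mul_le_mul_of_nonneg_right (natCast_rpow_le (by omega) (by linarith [P.σ_lt])) w0
    exact ⟨by linarith, by linarith, by linarith⟩
  · have := K.2
    positivity
  · have hα : 100 ≤ α := by exact_mod_cast hα'
    have hK : (0 : ℝ) ≤ K := K.2
    have hα0 : (0 : ℝ) < α := by linarith
    obtain ⟨L, hL⟩ := exists_phaseTransfer P hα hg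
    have hb := hL.phaseTransfer_bounds hα hg
    set C : ℝ := 7 * 10 ^ 14 * (1 + 7 * K) with hC
    have hC0 : 0 < C := by positivity
    set a := (α : ℝ) ^ (-P.η) with ha
    have ha0 : 0 < a := Real.rpow_pos_of_pos hα0 _
    refine ⟨L, hL, fun h => ?_, fun μ hμ hμ' => ?_⟩
    · obtain ⟨h1, h2⟩ := hb h
      have b1 : 0 ≤ C * weakNorm h := mul_nonneg hC0.le (weakNorm_nonneg h)
      have b2 : 0 ≤ C * a * ‖h‖ := by positivity
      exact ⟨by linarith, by linarith⟩
    · obtain ⟨n, l, hl⟩ := exists_finiteRank P (by omega : 2 ≤ α) ha0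
      -- One C a comes from the strong norm and one from the finite-rank approximation of the weak
      -- norm at precision a = α^(-η). The factor 8 in the announced constant is 4r = 8 C a.
      refine spectrum_outside_disc (l := (C : ℂ) • l) (r := 2 * (C * a)) (fun h => ?_)
        (by positivity) hμ (by linarith)
      have h1 := (hb h).2
      have h2 := mul_le_mul_of_nonneg_left (hl h) hC0.le
      rw [smul_apply, norm_smul, Complex.norm_real, Real.norm_of_nonneg hC0.le]
      linarith
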